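/- Let $f:\mathbb R^{d_x}\times\mathbb R^{d_y}\to\mathbb R$ ($d_y\ge 1$) be differentiable and $\ell$-smooth (its gradient is $\ell$-Lipschitz for the Euclidean norm), let $f(x,\cdot)$ be $\mu$-strongly concave with $\mu>0$ for every $x$, and suppose that $\Phi(x)=\max_{y}f(x,y)$ is bounded below. Put $\kappa=\ell/\mu$. Let $\nabla F(x,y;\xi)$, $\xi\sim\mathcal D$, be a stochastic first-order oracle with $$\mathbb E[\nabla F(x,y;\xi)]=\nabla f(x,y),\qquad \mathbb E\|\nabla F(x,y;\xi)-\nabla f(x,y)\|^p\le\sigma^p\qquad\text{for all }(x,y),$$ where $p\in(1,2]$ and $\sigma\ge 0$. Let $\varepsilon>0$, $\delta\in(0,1)$, $x_0\in\mathbb R^{d_x}$, $\hat y_{0,0}\in\mathbb R^{d_y}$, $\Delta_\Phi=\Phi(x_0)-\inf_x\Phi(x)$, let $R_0\ge\|\hat y_{0,0}-y^*(x_0)\|$, where $y^*(x_0)$ is the maximizer of $f(x_0,\cdot)$, and let $R_y=R_0+4\varepsilon/\ell$. **Algorithm (N²SGDA).** For $t=0,\dots,T-1$: for $k=0,\dots,K-1$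 draw a fresh sample $\xi$ and set $\hat y_{t,k+1}=\hat y_{t,k}+\eta_y\,\mathrm{clip}(\nabla_yF(x_t,\hat y_{t,k};\xi),\tau_k)$, where $\mathrm{clip}(v,\tau)=\min\{1,\tau/\|v\|\}\,v$ for $v\neq0$ and $\mathrm{clip}(0,\tau)=0$; put $y_t=\hat y_{t+1,0}=\hat y_{t,K}$; draw fresh samples $\xi_1,\dots,\xi_M$, let $g_t=\frac1M\sum_{i=1}^M\nabla_xF(x_t,y_t;\xi_i)$ and $x_{t+1}=x_t-\eta_x\,g_t/\|g_t\|$ (with $x_{t+1}=x_t$ if $g_t=0$). All samples are independent with law $\mathcal D$. **Parameters.** Let $\Lambda=\ln\!\big(e+\kappa+\tfrac{\sigma}{\varepsilon}+\tfrac{\Delta_\Phi\ell}{\varepsilon^2}+\tfrac{\ell R_0}{\varepsilon}+\tfrac1\delta\big)$. For a constant $C\ge1$ let $$T=\max\Big\{1,\Big\lceil C\big(1+\ln\tfrac1\delta\big)^2\tfrac{\Delta_\Phi\kappa\ell}{\varepsilon^2}\Big\rceil\Big\},\qquad M=\max\Big\{1,\Big\lceil\big(\tfrac{C\sigma}{\varepsilon}\big)^{\frac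 p{p-1}}\Big\rceil\Big\},$$ $$K=\Big\lceil C^{\frac p{p-1}}\Big(\kappa\,\Lambda^2+\Big(\tfrac{\ell^2\sigma^2}{\mu^2\varepsilon^2}\Big)^{\frac p{2(p-1)}}\Lambda^{\frac p{p-1}+1}\Big)\Big\rceil,\qquad \eta_x=\sqrt{\frac{\Delta_\Phi}{(\kappa+1)\ell T}},$$ $$\eta_y=\min\Big\{\frac1{400\,\ell\ln(8TK/\delta)},\frac{\ln B}{\mu K}\Big\},\qquad \tau_k=\frac{\exp(-\eta_y\mu(1+k/2))\,R_y}{120\,\eta_y\ln(8TK/\delta)},$$ where $B$ is the unique solution of $$B=\max\Big\{2,\ \frac{\mu^2K^{\frac{2(p-1)}p}R_y^2}{5400^{\frac2p}\sigma^2(\ln B)^2(\ln(8TK/\delta))^{\frac{2(p-1)}p}}\Big\}$$ (if $\sigma=0$, then $B=\infty$, i.e. $\eta_y=1/(400\,\ell\ln(8TK/\delta))$). **Theorem.** There are absolute constants $C,C'\ge1$ such that, for all data as above, $\Phi$ is differentiable and, with probability at least $1-\delta$, the iterates of N²SGDA with these parameters satisfy $$\frac1T\sum_{t=0}^{T-1}\|\nabla\Phi(x_t)\|\le\varepsilon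 .$$ If $\varepsilon^2\le\Delta_\Phi\kappa\ell$, the total number of calls of the stochastic first-order oracle (SFO) is at most $$C'^{\frac p{p-1}}\Lambda^{\frac p{p-1}+3}\Big(\frac{\Delta_\Phi\,\kappa^{\frac{2p-1}{p-1}}\,\ell\,\sigma^{\frac p{p-1}}}{\varepsilon^{\frac{3p-2}{p-1}}}+\frac{\Delta_\Phi\,\kappa^2\,\ell}{\varepsilon^2}\Big)=\tilde{\mathcal O}\Big(\frac{\Delta_\Phi\kappa^{\frac{2p-1}{p-1}}\ell\sigma^{\frac p{p-1}}}{\varepsilon^{\frac{3p-2}{p-1}}}+\frac{\Delta_\Phi\kappa^2\ell}{\varepsilon^2}\Big);$$ without the restriction on $\varepsilon$ the same bound holds with the additional summand $\kappa+\big(\tfrac{\ell^2\sigma^2}{\mu^2\varepsilon^2}\big)^{\frac p{2(p-1)}}$ in the bracket (the cost of the one outer iteration that is always made). -/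

import Mathlib

open MeasureTheory ProbabilityTheory Set

namespace N2SGDA

noncomputable section

/-! ### The minimax problem -/

/-- Euclidean space `ℝⁿ`. -/
abbrev E (n : ℕ) := EuclideanSpace ℝ (Fin n)

/-- The space `ℝ^dx × ℝ^dy` of pairs `(x, y)`, with its Euclidean norm. -/
abbrev Z (dx dy : ℕ) := WithLp 2 (E dx × E dy)

/-- The pair `(x, y)`. -/
def pt {dx dy : ℕ} (x : E dx) (y : E dy) : Z dx dy := WithLp.toLp 2 (x, y)

/-- `Φ(x) = max_y f(x, y)`. -/
def Phi {dx dy : ℕ} (f : Z dx dy → ℝ) (x : E dx) : ℝ := ⨆ y : E dy, f (pt x y)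

/-- `Δ_Φ = Φ(x₀) - inf_x Φ(x)`. -/
def gap {dx dy : ℕ} (f : Z dx dy → ℝ) (x₀ : E dx) : ℝ := Phi f x₀ - ⨅ x : E dx, Phi f x

/-- `f` is `ℓ`-smooth, `f(x, ·)` is `μ`-strongly concave, and `inf_x max_y f(x, y) > -∞`. -/
structure MinimaxAssumption {dx dy : ℕ} (f : Z dx dy → ℝ) (ℓ μ : ℝ) : Prop where
  differentiable : Differentiable ℝ f
  smooth : ∀ z w, ‖gradient f z - gradient f w‖ ≤ ℓ * ‖z - w‖
  mu_pos : 0 < μ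
  strongConcave : ∀ x, StrongConcaveOn univ μ (fun y => f (pt x y))
  lowerBounded : BddBelow (range (Phi f))

/-- The map `(z, ξ) ↦ G z ξ`, with `ξ` distributed according to `D`, is an unbiased stochastic
oracle for the gradient of `f`, whose noise has `p`-th central moment at most `σ ^ p`. -/
structure PBCM {dx dy : ℕ} {Ξ : Type*} [MeasurableSpace Ξ] (f : Z dx dy → ℝ) (D : Measure Ξ)
    (G : Z dx dy → Ξ → Z dx dy) (σ p : ℝ) : Prop where
  measurable : Measurable (Function.uncurry G)
  one_lt_p : 1 < p
  p_le_two : p ≤ 2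
  sigma_nonneg : 0 ≤ σ
  integrable : ∀ z, Integrable (G z) D
  unbiased : ∀ z, ∫ ξ, G z ξ ∂D = gradient f z
  integrable_moment : ∀ z, Integrable (fun ξ => ‖G z ξ - gradient f z‖ ^ p) D
  moment : ∀ z, ∫ ξ, ‖G z ξ - gradient f z‖ ^ p ∂D ≤ σ ^ p

/-! ### The algorithm -/

/-- `clip(v, τ) = min {1, τ / ‖v‖} v` for `v ≠ 0`, and `clip(0, τ) = 0`. -/
def clip {n : ℕ} (v : E n) (τ : ℝ) : E n := min 1 (τ / ‖v‖) • v

/-- State of the algorithm: the current iterates and the number of calls of the stochastic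
first-order oracle made so far. -/
structure State (dx dy : ℕ) where
  x : E dx
  y : E dy
  calls : ℕ

/-- One clipped stochastic ascent step in `y`; it makes one oracle call. -/
def innerStep {dx dy : ℕ} {Ξ : Type*} (G : Z dx dy → Ξ → Z dx dy) (ηy τ : ℝ) (ξ : Ξ)
    (s : State dx dy) : State dx dy where
  x := s.x
  y := s.y + ηy • clip (G (pt s.x s.y) ξ).snd τ
  calls := s.calls + 1

/-- The first `k` steps of the inner loop, started at `s`. -/
def innerLoop {dx dy : ℕ} {Ξ : Type*} (G : Z dx dy → Ξ → Z dx dy) (ηy : ℝ) (τ : ℕ → ℝ)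
    (ξ : ℕ → Ξ) (s : State dx dy) : ℕ → State dx dy
  | 0 => s
  | k + 1 => innerStep G ηy (τ k) (ξ k) (innerLoop G ηy τ ξ s k)

/-- The mini-batch estimator `(1 / M) ∑ᵢ ∇ₓF(x, y; ξᵢ)`. -/
def batchGrad {dx dy : ℕ} {Ξ : Type*} (G : Z dx dy → Ξ → Z dx dy) (M : ℕ) (ξ : ℕ → Ξ)
    (x : E dx) (y : E dy) : E dx :=
  (M : ℝ)⁻¹ • ∑ i ∈ Finset.range M, (G (pt x y) (ξ i)).fst

/-- The normalized step in `x`; it makes `M` oracle calls. If the estimator vanishes, the step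
is zero. -/
def normalizedStep {dx dy : ℕ} {Ξ : Type*} (G : Z dx dy → Ξ → Z dx dy) (ηx : ℝ) (M : ℕ)
    (ξ : ℕ → Ξ) (s : State dx dy) : State dx dy where
  x := s.x - ηx • (‖batchGrad G M ξ s.x s.y‖⁻¹ • batchGrad G M ξ s.x s.y)
  y := s.y
  calls := s.calls + M

/-- The state after `t` outer iterations. The sample `S t (Sum.inl k)` is used in the `k`-th inner
step of the `t`-th outer iteration, the sample `S t (Sum.inr i)` in its mini-batch. -/
def run {dx dy : ℕ} {Ξ : Type*} (G : Z dx dy → Ξ → Z dx dy) (ηx : ℝ) (ηy : ℕ → ℝ)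
    (τ : ℕ → ℕ → ℝ) (K M : ℕ) (x₀ : E dx) (y₀ : E dy) (S : ℕ → ℕ ⊕ ℕ → Ξ) : ℕ → State dx dy
  | 0 => ⟨x₀, y₀, 0⟩
  | t + 1 => normalizedStep G ηx M (fun i => S t (Sum.inr i))
      (innerLoop G (ηy t) (τ t) (fun k => S t (Sum.inl k)) (run G ηx ηy τ K M x₀ y₀ S t) K)

/-! ### The parameters -/

/-- The implicit equation `B = max {2, c / (ln B)²}` has exactly one solution. -/
theorem existsUnique_fixedPoint {c : ℝ} (hc : 0 ≤ c) :
    ∃! B : ℝ, B = max 2 (c / Real.log B ^ 2) := by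
  have anti : ∀ a b : ℝ, 2 ≤ a → a ≤ b →
      max 2 (c / Real.log b ^ 2) ≤ max 2 (c / Real.log a ^ 2) := by
    intro a b ha hab
    have h1 : 0 < Real.log a := Real.log_pos (by linarith)
    have h2 : Real.log a ≤ Real.log b := Real.log_le_log (by linarith) hab
    have h3 : c / Real.log b ^ 2 ≤ c / Real.log a ^ 2 := by gcongr
    exact max_le_max le_rfl h3
  set N : ℝ := max 2 (c / Real.log 2 ^ 2) with hN
  have h2N : (2 : ℝ) ≤ N := le_max_left _ _
  have hcont : ContinuousOn (fun b : ℝ => b - max 2 (c / Real.log b ^ 2)) (Icc 2 N) := by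
    refine continuousOn_id.sub (continuousOn_const.sup (continuousOn_const.div ?_ ?_))
    · exact (Real.continuousOn_log.mono (fun b hb => by
        have : (2 : ℝ) ≤ b := hb.1
        simp only [mem_compl_iff, mem_singleton_iff]
        linarith)).pow 2
    · intro b hb
      have : 0 < Real.log b := Real.log_pos (by linarith [hb.1])
      positivity
  obtain ⟨B, hB, hB0⟩ := intermediate_value_Icc h2N hcont
    (show (0 : ℝ) ∈ Icc _ _ from
      ⟨by simp, by have := anti 2 N le_rfl h2N; simp only [sub_nonneg]; exact this⟩)
  refine ⟨B, by simp only at hB0; linarith, fun b hb => ?_⟩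
  have hBe : B = max 2 (c / Real.log B ^ 2) := by simp only at hB0; linarith
  have hb2 : 2 ≤ b := hb ▸ le_max_left _ _
  rcases le_total b B with h | h
  · have := anti b B hb2 h
    rw [← hb, ← hBe] at this
    exact le_antisymm h this
  · have := anti B b hB.1 h
    rw [← hb, ← hBe] at this
    exact le_antisymm this h

open Classical in
/-- The solution `B` of `B = max {2, c / (ln B)²}`, for `c ≥ 0`. -/
def implicitB (c : ℝ) : ℝ :=
  if hc : 0 ≤ c then (existsUnique_fixedPoint hc).choose else 0

theorem implicitB_eq {c : ℝ} (hc : 0 ≤ c) :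
    implicitB c = max 2 (c / Real.log (implicitB c) ^ 2) := by
  have h := (existsUnique_fixedPoint hc).choose_spec.1
  unfold implicitB
  rw [dif_pos hc]
  exact h

/-- `ln (8 T K / δ)`. -/
def logTerm (T K : ℕ) (δ : ℝ) : ℝ := Real.log (8 * T * K / δ)

/-- `R_y = R₀ + 4 ε / ℓ`. -/
def radius (ℓ ε R₀ : ℝ) : ℝ := R₀ + 4 * ε / ℓ

/-- `B = max {2, μ² K^(2(p-1)/p) R_y² / (5400^(2/p) σ² (ln B)² (ln (8TK/δ))^(2(p-1)/p))}`,
for `σ > 0`. -/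
def paramB (ℓ μ σ p ε δ R₀ : ℝ) (T K : ℕ) : ℝ :=
  implicitB (μ ^ 2 * (K : ℝ) ^ (2 * (p - 1) / p) * radius ℓ ε R₀ ^ 2 /
    ((5400 : ℝ) ^ (2 / p) * σ ^ 2 * logTerm T K δ ^ (2 * (p - 1) / p)))

/-- Outer stepsize `η_x = √(Δ / ((κ + 1) ℓ T))`, with `κ = ℓ / μ`. -/
def etaX (ℓ μ Δ : ℝ) (T : ℕ) : ℝ := Real.sqrt (Δ / ((ℓ / μ + 1) * ℓ * T))

/-- Inner stepsize `η_y = min {1 / (400 ℓ ln (8TK/δ)), ln B / (μ K)}`; for `σ = 0` one has `B = ∞`,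
and the minimum is its first member. -/
def etaY (ℓ μ σ p ε δ R₀ : ℝ) (T K : ℕ) : ℝ :=
  if σ = 0 then 1 / (400 * ℓ * logTerm T K δ)
  else min (1 / (400 * ℓ * logTerm T K δ)) (Real.log (paramB ℓ μ σ p ε δ R₀ T K) / (μ * K))

/-- Clipping level `τ_k = exp (-η_y μ (1 + k/2)) R_y / (120 η_y ln (8TK/δ))`. -/
def clipLevel (ℓ μ σ p ε δ R₀ : ℝ) (T K k : ℕ) : ℝ :=
  Real.exp (-(etaY ℓ μ σ p ε δ R₀ T K * μ * (1 + k / 2))) * radius ℓ ε R₀ /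
    (120 * etaY ℓ μ σ p ε δ R₀ T K * logTerm T K δ)

/-- The logarithmic factor `ln (e + κ + σ/ε + Δ ℓ/ε² + ℓ R₀/ε + 1/δ) ≥ 1`. -/
def logFactor (ℓ μ σ ε δ R₀ Δ : ℝ) : ℝ :=
  Real.log (Real.exp 1 + ℓ / μ + σ / ε + Δ * ℓ / ε ^ 2 + ℓ * R₀ / ε + 1 / δ)

/-- `T = max {1, ⌈C (1 + ln (1/δ))² Δ κ ℓ / ε²⌉}`. -/
def outerIters (C ℓ μ ε δ Δ : ℝ) : ℕ :=
  max 1 ⌈C * (1 + Real.log (1 / δ)) ^ 2 * (Δ * (ℓ / μ) * ℓ / ε ^ 2)⌉₊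

/-- `M = max {1, ⌈(C σ / ε)^(p/(p-1))⌉}`. -/
def batchSize (C σ p ε : ℝ) : ℕ := max 1 ⌈(C * σ / ε) ^ (p / (p - 1))⌉₊

/-- `K = ⌈C^(p/(p-1)) (κ Λ² + (ℓ² σ² / (μ² ε²))^(p/(2(p-1))) Λ^(p/(p-1) + 1))⌉`, where `Λ` is the
logarithmic factor. -/
def innerIters (C ℓ μ σ p ε δ R₀ Δ : ℝ) : ℕ :=
  ⌈C ^ (p / (p - 1)) * (ℓ / μ * logFactor ℓ μ σ ε δ R₀ Δ ^ 2 +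
    (ℓ ^ 2 * σ ^ 2 / (μ ^ 2 * ε ^ 2)) ^ (p / (2 * (p - 1))) *
      logFactor ℓ μ σ ε δ R₀ Δ ^ (p / (p - 1) + 1))⌉₊

/-- `Δ κ^((2p-1)/(p-1)) ℓ σ^(p/(p-1)) / ε^((3p-2)/(p-1)) + Δ κ² ℓ / ε²`. -/
def sfoRate (ℓ μ σ p ε Δ : ℝ) : ℝ :=
  Δ * (ℓ / μ) ^ ((2 * p - 1) / (p - 1)) * ℓ * σ ^ (p / (p - 1)) / ε ^ ((3 * p - 2) / (p - 1)) +
    Δ * (ℓ / μ) ^ 2 * ℓ / ε ^ 2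

/-- `κ + (ℓ² σ² / (μ² ε²))^(p/(2(p-1)))`. -/
def sfoRateOneIter (ℓ μ σ p ε : ℝ) : ℝ :=
  ℓ / μ + (ℓ ^ 2 * σ ^ 2 / (μ ^ 2 * ε ^ 2)) ^ (p / (2 * (p - 1)))

end

end N2SGDA

/-! The function Φ has gradient ∇ₓf(x, y*(x)), and this gradient is Lipschitz with constant L =
(κ+1)ℓ, because y* is κ-Lipschitz. A normalized step of length at most η_x therefore lowers Φ by
η_x‖∇Φ(x_t)‖, up to Lη_x²/2 and η_x times the direction loss ‖∇Φ‖ - ⟪∇Φ, g/‖g‖⟫. Telescoping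
(`sum_norm_gradient_le`) bounds the sum of the gradient norms by Δ/η_x + TLη_x/2 plus the sum of the
losses.

The loss is nonnegative and at most 2‖g - ∇Φ‖, so its conditional mean is at most twice the sum of
the mini-batch error and ℓ times the inner error. The former is small in mean by a von Bahr–Esseen
inequality (`norm_add_rpow_le`). Since steps have length at most η_x, the gradients, and hence the
losses, are also bounded surely by a number c of order TLη_x. A nonnegative variable bounded by c
has an exponential moment at scale 1/c that is controlled by its mean alone, so heavy tails do no
harm. Markov's inequality gives a total loss of at most c ln(2/δ) plus T times a multiple of the
mean bound (`measure_accLoss_bad_le`); the first term is the reason for the factor (1 + ln(1/δ))² in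
T.

For one inner loop, consider w_k = exp(ημk)‖y_k - y*‖²/R². The weight cancels the contraction, so
only noise moves w. While w ≤ 2 the true gradient is below half the clipping level; hence clipped
increments are bounded, and their bias and square are controlled by the p-th moment. The potential
min(1, exp(2A(w - 2 + (K-k)/(2K)))) then does not increase in mean. It is at most exp(-A) at the
start and equals 1 whenever w_K ≥ 2 at the end, so an inner loop fails with probability at most
exp(-A), where A = ln(8TK/δ) (`measure_innerLoop_le`). After a success the error is at most ε/(16ℓ),
and the next maximizer is at most κη_x ≤ ε/ℓ away; so the same radius R_y serves every inner loop.

In both arguments conditional expectations are Fubini integrals over fresh samples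
(`lintegral_chain_le`). What remains is arithmetic: K must be large enough for both the contraction
and the noise balance encoded in the equation for B, although ln K itself enters the step size. -/

namespace N2SGDA

open scoped RealInnerProductSpace

/-! ### Smooth functions on a Hilbert space -/

section Smooth

variable {H : Type*} [NormedAddCommGroup H] [InnerProductSpace ℝ H] [CompleteSpace H]

theorem hasDerivAt_line {F : H → ℝ} (hF : Differentiable ℝ F) (a v : H) (t : ℝ) :
    HasDerivAt (fun t : ℝ => F (a + t • v)) ⟪gradient F (a + t • v), v⟫ t := by
  have h1 : HasDerivAt (fun t : ℝ => a + t • v) v t := by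
    simpa using ((hasDerivAt_id t).smul_const v).const_add a
  have h2 := (hF (a + t • v)).hasGradientAt.hasFDerivAt
  refine (h2.comp_hasDerivAt t h1).congr_deriv ?_
  rw [InnerProductSpace.toDual_apply_apply]

/-- The descent lemma for functions with Lipschitz gradient. -/
theorem descent_upper {F : H → ℝ} (hF : Differentiable ℝ F) {ℓ : ℝ}
    (hs : ∀ z w, ‖gradient F z - gradient F w‖ ≤ ℓ * ‖z - w‖) (a b : H) :
    F b ≤ F a + ⟪gradient F a, b - a⟫ + ℓ / 2 * ‖b - a‖ ^ 2 := by
  set v := b - a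
  have hd : ∀ t : ℝ, HasDerivAt
      (fun t : ℝ => F (a + t • v) - t * ⟪gradient F a, v⟫ - ℓ / 2 * t ^ 2 * ‖v‖ ^ 2)
      (⟪gradient F (a + t • v), v⟫ - ⟪gradient F a, v⟫ - ℓ * t * ‖v‖ ^ 2) t := by
    intro t
    have h := ((hasDerivAt_line hF a v t).sub ((hasDerivAt_id t).mul_const ⟪gradient F a, v⟫)).sub
      (((hasDerivAt_pow 2 t).const_mul (ℓ / 2)).mul_const (‖v‖ ^ 2))
    refine h.congr_deriv ?_
    simp only [one_mul, Nat.cast_ofNat, Nat.add_one_sub_one, pow_one]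
    ring
  have hanti : AntitoneOn
      (fun t : ℝ => F (a + t • v) - t * ⟪gradient F a, v⟫ - ℓ / 2 * t ^ 2 * ‖v‖ ^ 2) (Icc 0 1) := by
    refine antitoneOn_of_deriv_nonpos (convex_Icc 0 1)
      (fun t _ => (hd t).continuousAt.continuousWithinAt)
      (fun t _ => (hd t).differentiableAt.differentiableWithinAt) fun t ht => ?_
    rw [interior_Icc] at ht
    rw [(hd t).deriv, ← inner_sub_left]
    have h1 := real_inner_le_norm (gradient F (a + t • v) - gradient F a) v
    have h2 := hs (a + t • v) a
    rw [add_sub_cancel_left, norm_smul, Real.norm_of_nonneg ht.1.le] at h2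
    have h3 := mul_le_mul_of_nonneg_right h2 (norm_nonneg v)
    nlinarith
  have h := hanti (left_mem_Icc.2 zero_le_one) (right_mem_Icc.2 zero_le_one) zero_le_one
  simp only [one_smul, zero_smul, add_zero, one_mul, one_pow, mul_one, zero_mul, sub_zero,
    ne_eq, OfNat.ofNat_ne_zero, not_false_eq_true, zero_pow, mul_zero] at h
  rw [show a + v = b by simp [v]] at h
  linarith

theorem gradient_fun_neg (F : H → ℝ) (x : H) : gradient (fun y => -F y) x = -gradient F x := by
  simp [gradient, fderiv_fun_neg]

theorem descent_lower {F : H → ℝ} (hF : Differentiable ℝ F) {ℓ : ℝ}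
    (hs : ∀ z w, ‖gradient F z - gradient F w‖ ≤ ℓ * ‖z - w‖) (a b : H) :
    F a + ⟪gradient F a, b - a⟫ - ℓ / 2 * ‖b - a‖ ^ 2 ≤ F b := by
  have h := descent_upper hF.fun_neg (ℓ := ℓ) (fun z w => by
    rw [gradient_fun_neg, gradient_fun_neg, neg_sub_neg, norm_sub_rev]; exact hs z w) a b
  rw [gradient_fun_neg, inner_neg_left] at h
  linarith

/-- A gradient step of length factor 1/L lowers F by ‖∇F‖²/(2L), and F cannot fall below its
infimum. This controls the initial gradient of Φ by the gap. -/
theorem norm_sq_gradient_le {F : H → ℝ} (hF : Differentiable ℝ F) {L : ℝ} (hL : 0 < L)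
    (hs : ∀ z w, ‖gradient F z - gradient F w‖ ≤ L * ‖z - w‖) (hb : BddBelow (range F)) (x : H) :
    ‖gradient F x‖ ^ 2 ≤ 2 * L * (F x - ⨅ z, F z) := by
  have h := descent_upper hF hs x (x - L⁻¹ • gradient F x)
  have h1 : ⨅ z, F z ≤ F (x - L⁻¹ • gradient F x) := ciInf_le hb _
  rw [show x - L⁻¹ • gradient F x - x = -(L⁻¹ • gradient F x) by abel, inner_neg_right,
    real_inner_smul_right, real_inner_self_eq_norm_sq, norm_neg, norm_smul, norm_inv,
    Real.norm_of_nonneg hL.le] at h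
  have h2 : L / 2 * (L⁻¹ * ‖gradient F x‖) ^ 2 = L⁻¹ * ‖gradient F x‖ ^ 2 / 2 := by
    field_simp
  rw [h2] at h
  have h3 : L⁻¹ * ‖gradient F x‖ ^ 2 ≤ 2 * (F x - ⨅ z, F z) := by linarith
  have h4 := mul_le_mul_of_nonneg_left h3 hL.le
  rw [← mul_assoc, mul_inv_cancel₀ hL.ne', one_mul] at h4
  linarith

/-- A quadratic remainder is o(‖z - x‖). In this form Φ can be differentiated by sandwiching, with
no differentiability of y*. -/
theorem hasGradientAt_of_quadratic_bound {F : H → ℝ} {g x : H} {c : ℝ}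
    (h : ∀ z, |F z - F x - ⟪g, z - x⟫| ≤ c * ‖z - x‖ ^ 2) : HasGradientAt F g x := by
  rw [hasGradientAt_iff_isLittleO]
  refine Asymptotics.IsBigO.trans_isLittleO (g := fun z => ‖z - x‖ ^ 2) ?_ ?_
  · refine Asymptotics.IsBigO.of_bound c (Filter.Eventually.of_forall fun z => ?_)
    rw [Real.norm_eq_abs, Real.norm_of_nonneg (by positivity)]
    exact h z
  · have : Filter.Tendsto (fun z : H => z - x) (nhds x) (nhds 0) := by
      have : Continuous fun z : H => z - x := by fun_prop
      simpa using this.tendsto x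
    exact (Asymptotics.isLittleO_norm_pow_id one_lt_two).comp_tendsto this

end Smooth

/-! ### Norms and inner products of pairs -/

section Pairs

variable {dx dy : ℕ}

theorem norm_fst_le (z : Z dx dy) : ‖z.fst‖ ≤ ‖z‖ := by
  have := WithLp.prod_norm_sq_eq_of_L2 z
  exact abs_le_of_sq_le_sq' (by nlinarith [sq_nonneg ‖z.snd‖]) (norm_nonneg z) |>.2

theorem norm_snd_le (z : Z dx dy) : ‖z.snd‖ ≤ ‖z‖ := by
  have := WithLp.prod_norm_sq_eq_of_L2 z
  exact abs_le_of_sq_le_sq' (by nlinarith [sq_nonneg ‖z.fst‖]) (norm_nonneg z) |>.2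

theorem norm_pt_sub_sq (x x' : E dx) (y y' : E dy) :
    ‖pt x y - pt x' y'‖ ^ 2 = ‖x - x'‖ ^ 2 + ‖y - y'‖ ^ 2 := by
  rw [WithLp.prod_norm_sq_eq_of_L2]
  rfl

theorem norm_pt_sub_left (x x' : E dx) (y : E dy) : ‖pt x y - pt x' y‖ = ‖x - x'‖ := by
  have := norm_pt_sub_sq x x' y y
  rw [sub_self, norm_zero] at this
  exact (pow_left_inj₀ (norm_nonneg _) (norm_nonneg _) two_ne_zero).1 (by linarith)

theorem norm_pt_sub_right (x : E dx) (y y' : E dy) : ‖pt x y - pt x y'‖ = ‖y - y'‖ := by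
  have := norm_pt_sub_sq x x y y'
  rw [sub_self, norm_zero] at this
  exact (pow_left_inj₀ (norm_nonneg _) (norm_nonneg _) two_ne_zero).1 (by linarith)

theorem norm_pt_sub_le (x x' : E dx) (y y' : E dy) :
    ‖pt x y - pt x' y'‖ ≤ ‖x - x'‖ + ‖y - y'‖ := by
  have := norm_pt_sub_sq x x' y y'
  refine abs_le_of_sq_le_sq' ?_ (by positivity) |>.2
  nlinarith [mul_nonneg (norm_nonneg (x - x')) (norm_nonneg (y - y'))]

theorem inner_pt_sub (g : Z dx dy) (x x' : E dx) (y y' : E dy) :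
    ⟪g, pt x y - pt x' y'⟫ = ⟪g.fst, x - x'⟫ + ⟪g.snd, y - y'⟫ := by
  rw [WithLp.prod_inner_apply]
  rfl

theorem continuous_pt : Continuous fun q : E dx × E dy => pt q.1 q.2 :=
  WithLp.prod_continuous_toLp 2 _ _

theorem continuous_fst : Continuous fun z : Z dx dy => z.fst := WithLp.continuous_fst ..

theorem continuous_snd : Continuous fun z : Z dx dy => z.snd := WithLp.continuous_snd ..

end Pairs

/-! ### The maximizer y*(x) and the smoothness of Φ -/

namespace MinimaxAssumption

variable {dx dy : ℕ} {f : Z dx dy → ℝ} {ℓ μ : ℝ}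

/-- The first-order form of strong concavity. -/
theorem le_first_order (h : MinimaxAssumption f ℓ μ) (x : E dx) (y z : E dy) :
    f (pt x z) ≤ f (pt x y) + ⟪(gradient f (pt x y)).snd, z - y⟫ - μ / 2 * ‖z - y‖ ^ 2 := by
  have hd := hasDerivAt_line h.differentiable (pt x y) (pt x z - pt x y) 0
  rw [zero_smul, add_zero, inner_pt_sub, sub_self, inner_zero_right, zero_add] at hd
  have h1 := hd.tendsto_slope_zero_right
  have h2 : Filter.Tendsto (fun t : ℝ => f (pt x z) - f (pt x y) + (1 - t) * (μ / 2 * ‖z - y‖ ^ 2))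
      (nhdsWithin 0 (Ioi 0)) (nhds (f (pt x z) - f (pt x y) + μ / 2 * ‖z - y‖ ^ 2)) := by
    have : Continuous fun t : ℝ =>
        f (pt x z) - f (pt x y) + (1 - t) * (μ / 2 * ‖z - y‖ ^ 2) := by fun_prop
    refine Filter.Tendsto.mono_left ?_ nhdsWithin_le_nhds
    simpa using this.tendsto 0
  -- Strong concavity on the segment from y to z, divided by t, in the limit t → 0+.
  have h3 := le_of_tendsto_of_tendsto h2 h1 (by
    filter_upwards [Ioo_mem_nhdsGT (zero_lt_one' ℝ)] with t ht
    have hc := (h.strongConcave x).2 (mem_univ z) (mem_univ y) ht.1.le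
      (sub_nonneg.2 ht.2.le) (add_sub_cancel t 1)
    simp only [smul_eq_mul] at hc
    have he : pt x y + (0 + t) • (pt x z - pt x y) = pt x (t • z + (1 - t) • y) := by
      rw [zero_add]
      refine WithLp.ofLp_injective 2 (Prod.ext ?_ ?_)
      · change x + t • (x - x) = x
        simp
      · change y + t • (z - y) = t • z + (1 - t) • y
        module
    have he0 : pt x y + (0 : ℝ) • (pt x z - pt x y) = pt x y := by rw [zero_smul, add_zero]
    simp only [he, he0, smul_eq_mul]
    rw [le_inv_mul_iff₀ ht.1]
    nlinarith)
  linarith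

theorem continuous (h : MinimaxAssumption f ℓ μ) : Continuous f :=
  continuous_iff_continuousAt.2 fun z => (h.differentiable z).hasGradientAt.continuousAt

/-- By the first-order inequality at 0, f(x, z) is at most a constant plus ‖z‖(‖g‖ - μ‖z‖/2), which
tends to -∞; a continuous function with this property attains its maximum. -/
theorem exists_maximizer (h : MinimaxAssumption f ℓ μ) (x : E dx) :
    ∃ y, ∀ z, f (pt x z) ≤ f (pt x y) := by
  have hc : Continuous fun y : E dy => f (pt x y) :=
    h.continuous.comp (continuous_pt.comp (continuous_const.prodMk continuous_id))
  refine hc.exists_forall_ge ?_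
  set g := (gradient f (pt x 0)).snd
  have hb : ∀ z : E dy, f (pt x z) ≤ f (pt x 0) + ‖z‖ * (‖g‖ - μ / 2 * ‖z‖) := by
    intro z
    have h1 := h.le_first_order x 0 z
    rw [sub_zero] at h1
    have h2 := real_inner_le_norm g z
    nlinarith
  refine Filter.tendsto_atBot_mono hb (Filter.tendsto_atBot_add_const_left _ _ ?_)
  have hn := tendsto_norm_cocompact_atTop (E := E dy)
  refine Filter.Tendsto.atTop_mul_atBot₀ hn ?_
  have := Filter.Tendsto.const_mul_atTop (half_pos h.mu_pos) hn
  have h3 := Filter.tendsto_atBot_add_const_left _ ‖g‖ (Filter.tendsto_neg_atTop_atBot.comp this)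
  refine h3.congr fun z => ?_
  simp [sub_eq_add_neg]

/-- The maximizer `y*(x)` of `f (x, ·)`. -/
noncomputable def argmax (h : MinimaxAssumption f ℓ μ) (x : E dx) : E dy :=
  (h.exists_maximizer x).choose

theorem le_argmax (h : MinimaxAssumption f ℓ μ) (x : E dx) (y : E dy) :
    f (pt x y) ≤ f (pt x (h.argmax x)) :=
  (h.exists_maximizer x).choose_spec y

theorem Phi_eq (h : MinimaxAssumption f ℓ μ) (x : E dx) : Phi f x = f (pt x (h.argmax x)) :=
  le_antisymm (ciSup_le fun y => h.le_argmax x y)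
    (le_ciSup (f := fun y => f (pt x y)) ⟨_, forall_mem_range.2 (h.le_argmax x)⟩ (h.argmax x))

theorem le_Phi (h : MinimaxAssumption f ℓ μ) (x : E dx) (y : E dy) : f (pt x y) ≤ Phi f x :=
  (h.le_argmax x y).trans_eq (h.Phi_eq x).symm

/-- An ascent step of length factor 1/ℓ in y gains ‖∇_y f‖²/(2ℓ), and the value cannot exceed Φ(x).
-/
theorem sq_snd_gradient_le (h : MinimaxAssumption f ℓ μ) (hℓ : 0 < ℓ) (x : E dx) (y : E dy) :
    ‖(gradient f (pt x y)).snd‖ ^ 2 ≤ 2 * ℓ * (Phi f x - f (pt x y)) := by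
  set g := (gradient f (pt x y)).snd
  have h1 := descent_lower h.differentiable h.smooth (pt x y) (pt x (y + ℓ⁻¹ • g))
  rw [norm_pt_sub_right, inner_pt_sub, sub_self, inner_zero_right, zero_add,
    add_sub_cancel_left, real_inner_smul_right, real_inner_self_eq_norm_sq, norm_smul, norm_inv,
    Real.norm_of_nonneg hℓ.le] at h1
  have h2 : ℓ / 2 * (ℓ⁻¹ * ‖g‖) ^ 2 = ℓ⁻¹ * ‖g‖ ^ 2 / 2 := by field_simp
  rw [h2] at h1
  have h3 := h.le_Phi x (y + ℓ⁻¹ • g)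
  have h4 : ℓ⁻¹ * ‖g‖ ^ 2 ≤ 2 * (Phi f x - f (pt x y)) := by linarith
  have h5 := mul_le_mul_of_nonneg_left h4 hℓ.le
  rw [← mul_assoc, mul_inv_cancel₀ hℓ.ne', one_mul] at h5
  linarith

theorem smooth_nonneg (h : MinimaxAssumption f ℓ μ) (hdy : 0 < dy) : 0 ≤ ℓ := by
  have : NeZero dy := ⟨hdy.ne'⟩
  obtain ⟨v, hv⟩ := exists_norm_eq (E dy) zero_le_one
  have h1 := h.smooth (pt 0 v) (pt 0 0)
  rw [norm_pt_sub_right, sub_zero, hv, mul_one] at h1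
  exact (norm_nonneg _).trans h1

theorem snd_gradient_argmax (h : MinimaxAssumption f ℓ μ) (hdy : 0 < dy) (x : E dx) :
    (gradient f (pt x (h.argmax x))).snd = 0 := by
  have h0 := h.smooth_nonneg hdy
  -- Only ℓ ≥ 0 is known here: ℓ > 0 comes from μ ≤ ℓ, whose proof uses this lemma. Any larger
  -- Lipschitz constant serves as well.
  have h' : MinimaxAssumption f (ℓ + 1) μ :=
    { h with smooth := fun z w => (h.smooth z w).trans (by gcongr; linarith) }
  have h1 := h'.sq_snd_gradient_le (by linarith) x (h.argmax x)
  rw [h.Phi_eq, sub_self, mul_zero] at h1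
  exact norm_eq_zero.1 (pow_eq_zero_iff two_ne_zero |>.1 (le_antisymm h1 (by positivity)))

theorem norm_snd_gradient_le (h : MinimaxAssumption f ℓ μ) (hdy : 0 < dy) (x : E dx) (y : E dy) :
    ‖(gradient f (pt x y)).snd‖ ≤ ℓ * ‖y - h.argmax x‖ := by
  have h1 := norm_snd_le (gradient f (pt x y) - gradient f (pt x (h.argmax x)))
  rw [WithLp.sub_snd, h.snd_gradient_argmax hdy, sub_zero] at h1
  have h2 := h.smooth (pt x y) (pt x (h.argmax x))
  rw [norm_pt_sub_right] at h2
  exact h1.trans h2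

/-- Sum of the first-order inequalities from y to y* and from y* to y, where the gradient at y*
vanishes. -/
theorem strong_monotone (h : MinimaxAssumption f ℓ μ) (hdy : 0 < dy) (x : E dx) (y : E dy) :
    μ * ‖y - h.argmax x‖ ^ 2 ≤ -⟪y - h.argmax x, (gradient f (pt x y)).snd⟫ := by
  have h1 := h.le_first_order x y (h.argmax x)
  have h2 := h.le_first_order x (h.argmax x) y
  rw [h.snd_gradient_argmax hdy, inner_zero_left] at h2
  rw [real_inner_comm, ← neg_sub y, inner_neg_left, norm_neg] at h1
  linarith

/-- At distance one from y* the gradient has norm at least μ by monotonicity and at most ℓ by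
smoothness. A unit vector exists because d_y ≥ 1. -/
theorem mu_le_smooth (h : MinimaxAssumption f ℓ μ) (hdy : 0 < dy) : μ ≤ ℓ := by
  have : NeZero dy := ⟨hdy.ne'⟩
  obtain ⟨v, hv⟩ := exists_norm_eq (E dy) zero_le_one
  have h1 := h.strong_monotone hdy 0 (h.argmax 0 + v)
  have h2 := h.norm_snd_gradient_le hdy 0 (h.argmax 0 + v)
  rw [add_sub_cancel_left, hv] at h1 h2
  rw [← inner_neg_left] at h1
  have h3 := real_inner_le_norm (-v) (gradient f (pt 0 (h.argmax 0 + v))).snd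
  rw [norm_neg, hv] at h3
  linarith

theorem smooth_pos (h : MinimaxAssumption f ℓ μ) (hdy : 0 < dy) : 0 < ℓ :=
  h.mu_pos.trans_le (h.mu_le_smooth hdy)

/-- Strong concavity leaves Φ(x) - f(x, y) to spare, and this gap dominates ‖∇_y f‖²/(2ℓ). The
gradient term is what later absorbs the square of the step. -/
theorem cocoercive (h : MinimaxAssumption f ℓ μ) (hdy : 0 < dy) (x : E dx) (y : E dy) :
    ‖(gradient f (pt x y)).snd‖ ^ 2 / (2 * ℓ) + μ / 2 * ‖y - h.argmax x‖ ^ 2 ≤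
      -⟪y - h.argmax x, (gradient f (pt x y)).snd⟫ := by
  have hℓ := h.smooth_pos hdy
  have h1 := h.le_first_order x y (h.argmax x)
  have h2 := h.sq_snd_gradient_le hℓ x y
  rw [real_inner_comm, ← neg_sub y, inner_neg_left, norm_neg, ← h.Phi_eq] at h1
  have h3 : ‖(gradient f (pt x y)).snd‖ ^ 2 / (2 * ℓ) ≤ Phi f x - f (pt x y) := by
    rw [div_le_iff₀ (by positivity)]
    linarith
  linarith

theorem eq_argmax (h : MinimaxAssumption f ℓ μ) (hdy : 0 < dy) {x : E dx} {y : E dy}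
    (hy : ∀ z, f (pt x z) ≤ f (pt x y)) : y = h.argmax x := by
  have h2 := h.le_first_order x (h.argmax x) y
  rw [h.snd_gradient_argmax hdy, inner_zero_left] at h2
  have h3 := hy (h.argmax x)
  have h4 : ‖y - h.argmax x‖ ^ 2 ≤ 0 := by nlinarith [h.mu_pos]
  exact sub_eq_zero.1 (norm_eq_zero.1
    (pow_eq_zero_iff two_ne_zero |>.1 (le_antisymm h4 (by positivity))))

/-- At y*(x') the gradient of f(x, ·) differs from the zero gradient of f(x', ·) by at most ℓ‖x -
x'‖, while strong monotonicity makes it at least μ times the distance to y*(x). -/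
theorem argmax_lipschitz (h : MinimaxAssumption f ℓ μ) (hdy : 0 < dy) (x x' : E dx) :
    ‖h.argmax x - h.argmax x'‖ ≤ ℓ / μ * ‖x - x'‖ := by
  have hμ := h.mu_pos
  have h1 := h.strong_monotone hdy x (h.argmax x')
  have h2 := norm_snd_le (gradient f (pt x (h.argmax x')) - gradient f (pt x' (h.argmax x')))
  rw [WithLp.sub_snd, h.snd_gradient_argmax hdy, sub_zero] at h2
  have h3 := h.smooth (pt x (h.argmax x')) (pt x' (h.argmax x'))
  rw [norm_pt_sub_left] at h3
  rw [← inner_neg_left, neg_sub, norm_sub_rev] at h1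
  have h4 := real_inner_le_norm (h.argmax x - h.argmax x') (gradient f (pt x (h.argmax x'))).snd
  rcases (norm_nonneg (h.argmax x - h.argmax x')).eq_or_lt with h5 | h5
  · rw [← h5]
    have := h.smooth_nonneg hdy
    positivity
  · have h6 : μ * ‖h.argmax x - h.argmax x'‖ ≤ ℓ * ‖x - x'‖ := by
      refine le_of_mul_le_mul_left ?_ h5
      calc _ = μ * ‖h.argmax x - h.argmax x'‖ ^ 2 := by ring
        _ ≤ _ := h1.trans (h4.trans (by gcongr; exact h2.trans h3))
    rw [div_mul_eq_mul_div, le_div_iff₀ hμ]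
    linarith

/-- Φ(z) lies above f(z, y*(x)) and equals f(z, y*(z)). Both are expanded at (x, y*(x)), where the
y-gradient vanishes; the Lipschitz bound for y* makes the remainder quadratic. -/
theorem hasGradientAt_Phi (h : MinimaxAssumption f ℓ μ) (hdy : 0 < dy) (x : E dx) :
    HasGradientAt (Phi f) (gradient f (pt x (h.argmax x))).fst x := by
  have hℓ := h.smooth_pos hdy
  refine hasGradientAt_of_quadratic_bound (c := ℓ / 2 * (1 + (ℓ / μ) ^ 2)) fun z => ?_
  have h1 := descent_lower h.differentiable h.smooth (pt x (h.argmax x)) (pt z (h.argmax x))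
  have h2 := descent_upper h.differentiable h.smooth (pt x (h.argmax x)) (pt z (h.argmax z))
  rw [inner_pt_sub, norm_pt_sub_left, sub_self, inner_zero_right, add_zero, ← h.Phi_eq] at h1
  rw [inner_pt_sub, norm_pt_sub_sq, h.snd_gradient_argmax hdy, inner_zero_left, add_zero,
    ← h.Phi_eq, ← h.Phi_eq] at h2
  have h3 := h.le_Phi z (h.argmax x)
  have h4 := pow_le_pow_left₀ (norm_nonneg _) (h.argmax_lipschitz hdy z x) 2
  rw [mul_pow] at h4
  have h5 := mul_le_mul_of_nonneg_left h4 hℓ.le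
  have h6 : 0 ≤ ℓ * ((ℓ / μ) ^ 2 * ‖z - x‖ ^ 2) := by positivity
  rw [abs_le]
  constructor <;> nlinarith

theorem differentiable_Phi (h : MinimaxAssumption f ℓ μ) (hdy : 0 < dy) :
    Differentiable ℝ (Phi f) :=
  fun x => (h.hasGradientAt_Phi hdy x).differentiableAt

theorem gradient_Phi (h : MinimaxAssumption f ℓ μ) (hdy : 0 < dy) (x : E dx) :
    gradient (Phi f) x = (gradient f (pt x (h.argmax x))).fst :=
  (h.hasGradientAt_Phi hdy x).gradient

theorem norm_fst_gradient_sub_le (h : MinimaxAssumption f ℓ μ) (hdy : 0 < dy) (x : E dx)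
    (y : E dy) :
    ‖(gradient f (pt x y)).fst - gradient (Phi f) x‖ ≤ ℓ * ‖y - h.argmax x‖ := by
  have h1 := norm_fst_le (gradient f (pt x y) - gradient f (pt x (h.argmax x)))
  rw [WithLp.sub_fst, ← h.gradient_Phi hdy] at h1
  have h2 := h.smooth (pt x y) (pt x (h.argmax x))
  rw [norm_pt_sub_right] at h2
  exact h1.trans h2

theorem gradient_Phi_lipschitz (h : MinimaxAssumption f ℓ μ) (hdy : 0 < dy) (x x' : E dx) :
    ‖gradient (Phi f) x - gradient (Phi f) x'‖ ≤ (ℓ / μ + 1) * ℓ * ‖x - x'‖ := by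
  have hℓ := h.smooth_nonneg hdy
  rw [h.gradient_Phi hdy, h.gradient_Phi hdy, ← WithLp.sub_fst]
  refine (norm_fst_le _).trans ((h.smooth _ _).trans ?_)
  have h1 := norm_pt_sub_le x x' (h.argmax x) (h.argmax x')
  have h2 := h.argmax_lipschitz hdy x x'
  calc ℓ * ‖pt x (h.argmax x) - pt x' (h.argmax x')‖
      ≤ ℓ * (‖x - x'‖ + ℓ / μ * ‖x - x'‖) := by gcongr; linarith
    _ = _ := by ring

theorem continuous_argmax (h : MinimaxAssumption f ℓ μ) (hdy : 0 < dy) : Continuous h.argmax := by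
  refine (LipschitzWith.of_dist_le_mul (K := (ℓ / μ).toNNReal) fun x x' => ?_).continuous
  have := h.mu_pos
  have := h.smooth_pos hdy
  rw [Real.coe_toNNReal _ (by positivity), dist_eq_norm, dist_eq_norm]
  exact h.argmax_lipschitz hdy x x'

theorem continuous_gradient_Phi (h : MinimaxAssumption f ℓ μ) (hdy : 0 < dy) :
    Continuous (gradient (Phi f)) := by
  have := h.mu_pos
  have := h.smooth_pos hdy
  refine (LipschitzWith.of_dist_le_mul (K := ((ℓ / μ + 1) * ℓ).toNNReal) fun x x' => ?_).continuous
  rw [Real.coe_toNNReal _ (by positivity), dist_eq_norm, dist_eq_norm]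
  exact h.gradient_Phi_lipschitz hdy x x'

theorem gap_nonneg (h : MinimaxAssumption f ℓ μ) (x₀ : E dx) : 0 ≤ gap f x₀ :=
  sub_nonneg.2 (ciInf_le h.lowerBounded x₀)

end MinimaxAssumption

end N2SGDA

namespace N2SGDA

open scoped RealInnerProductSpace

/-! ### Independence of samples and potentials along Markov chains -/

section Independence

variable {Ω Ξ J : Type*} [MeasurableSpace Ξ]

/-- The σ-algebra generated by the samples with index in `A`. -/
abbrev sigmaOf (S : J → Ω → Ξ) (A : Set J) : MeasurableSpace Ω :=
  ⨆ j ∈ A, MeasurableSpace.comap (S j) inferInstance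

theorem measurable_sigmaOf (S : J → Ω → Ξ) {A : Set J} {j : J} (hj : j ∈ A) :
    Measurable[sigmaOf S A] (S j) :=
  (comap_measurable (S j)).mono (le_iSup₂_of_le j hj le_rfl) le_rfl

variable [MeasurableSpace Ω] {P : Measure Ω}

theorem sigmaOf_le {S : J → Ω → Ξ} (hS : ∀ j, Measurable (S j)) (A : Set J) :
    sigmaOf S A ≤ ‹MeasurableSpace Ω› :=
  iSup₂_le fun j _ => (hS j).comap_le

theorem indepFun_of_disjoint {S : J → Ω → Ξ} (hS : ∀ j, Measurable (S j))
    (hind : iIndepFun S P) {A B : Set J} (hAB : Disjoint A B) {α β : Type*} [MeasurableSpace α]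
    [MeasurableSpace β] {U : Ω → α} {V : Ω → β} (hU : Measurable[sigmaOf S A] U)
    (hV : Measurable[sigmaOf S B] V) : IndepFun U V P := by
  rw [IndepFun_iff_Indep]
  have h := indep_iSup_of_disjoint (fun j => (hS j).comap_le) hind.iIndep hAB
  exact indep_of_indep_of_le_left (indep_of_indep_of_le_right h hV.comap_le) hU.comap_le

/-- Fubini for the product law. It replaces conditional expectation given U throughout. -/
theorem lintegral_indepFun [IsProbabilityMeasure P] {α β : Type*} [MeasurableSpace α]
    [MeasurableSpace β] {U : Ω → α} {V : Ω → β} (hU : Measurable U) (hV : Measurable V)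
    (h : IndepFun U V P) {F : α × β → ENNReal} (hF : Measurable F) :
    ∫⁻ ω, F (U ω, V ω) ∂P = ∫⁻ ω, ∫⁻ ω', F (U ω, V ω') ∂P ∂P := by
  have : IsProbabilityMeasure (P.map V) := Measure.isProbabilityMeasure_map hV.aemeasurable
  calc ∫⁻ ω, F (U ω, V ω) ∂P = ∫⁻ q, F q ∂(P.map fun ω => (U ω, V ω)) :=
        (lintegral_map hF (hU.prodMk hV)).symm
    _ = ∫⁻ q, F q ∂((P.map U).prod (P.map V)) := by
        rw [(indepFun_iff_map_prod_eq_prod_map_map hU.aemeasurable hV.aemeasurable).1 h]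
    _ = ∫⁻ u, ∫⁻ v, F (u, v) ∂(P.map V) ∂(P.map U) := lintegral_prod _ hF.aemeasurable
    _ = ∫⁻ ω, ∫⁻ v, F (U ω, v) ∂(P.map V) ∂P :=
        lintegral_map (hF.lintegral_prod_right' (ν := P.map V)) hU
    _ = _ := by
        refine lintegral_congr fun ω => ?_
        exact lintegral_map (f := fun v => F (U ω, v)) (hF.comp measurable_prodMk_left) hV

/-- Potentials that do not increase in conditional expectation along a Markov chain. -/
theorem lintegral_chain_le [IsProbabilityMeasure P] {𝒳 Θ : Type*} [MeasurableSpace 𝒳]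
    [MeasurableSpace Θ] {X : ℕ → Ω → 𝒳} {ξ : ℕ → Ω → Θ} {step : ℕ → 𝒳 × Θ → 𝒳}
    {V : ℕ → 𝒳 → ENNReal} (hX : ∀ k, Measurable (X k)) (hξ : ∀ k, Measurable (ξ k))
    (hstep : ∀ k, Measurable (step k)) (hV : ∀ k, Measurable (V k))
    (hind : ∀ k, IndepFun (X k) (ξ k) P) (hrec : ∀ k ω, X (k + 1) ω = step k (X k ω, ξ k ω))
    {n : ℕ} (hle : ∀ k < n, ∀ x, ∫⁻ ω, V (k + 1) (step k (x, ξ k ω)) ∂P ≤ V k x) :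
    ∫⁻ ω, V n (X n ω) ∂P ≤ ∫⁻ ω, V 0 (X 0 ω) ∂P := by
  induction n with
  | zero => exact le_rfl
  | succ n ih =>
    refine le_trans ?_ (ih fun k hk => hle k (hk.trans n.lt_succ_self))
    simp_rw [hrec]
    rw [lintegral_indepFun (F := fun q => V (n + 1) (step n q)) (hX n) (hξ n) (hind n)
      ((hV _).comp (hstep _))]
    exact lintegral_mono fun ω => hle n n.lt_succ_self _

end Independence

/-! ### Centered noise with a p-th moment -/

section Noise

variable {Ξ H : Type*} [MeasurableSpace Ξ] [NormedAddCommGroup H] [InnerProductSpace ℝ H]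
  [CompleteSpace H]

/-- A centered random vector whose `p`-th moment is at most `m`. -/
structure IsNoise (D : Measure Ξ) (n : Ξ → H) (p m : ℝ) : Prop where
  integrable : Integrable n D
  mean : ∫ ξ, n ξ ∂D = 0
  integrable_moment : Integrable (fun ξ => ‖n ξ‖ ^ p) D
  moment : ∫ ξ, ‖n ξ‖ ^ p ∂D ≤ m

/-- The linear term integrates to zero. Both noise estimates of the proof are therefore reduced to a
pointwise majorant of the form a + ⟪d, n⟫ + b‖n‖^p. -/
theorem IsNoise.lintegral_le {D : Measure Ξ} [IsProbabilityMeasure D] {n : Ξ → H} {p m : ℝ}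
    (h : IsNoise D n p m) {F : Ξ → ℝ} {a b : ℝ} {d : H} (hb : 0 ≤ b) (hF0 : ∀ ξ, 0 ≤ F ξ)
    (hF : ∀ ξ, F ξ ≤ a + ⟪d, n ξ⟫ + b * ‖n ξ‖ ^ p) :
    ∫⁻ ξ, ENNReal.ofReal (F ξ) ∂D ≤ ENNReal.ofReal (a + b * m) := by
  have h1 : Integrable (fun ξ => ⟪d, n ξ⟫) D := h.integrable.const_inner d
  have h2 := h.integrable_moment.const_mul b
  have h3 : Integrable (fun ξ => a + ⟪d, n ξ⟫ + b * ‖n ξ‖ ^ p) D :=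
    ((integrable_const a).add h1).add h2
  calc ∫⁻ ξ, ENNReal.ofReal (F ξ) ∂D
      ≤ ∫⁻ ξ, ENNReal.ofReal (a + ⟪d, n ξ⟫ + b * ‖n ξ‖ ^ p) ∂D :=
        lintegral_mono fun ξ => ENNReal.ofReal_le_ofReal (hF ξ)
    _ = ENNReal.ofReal (∫ ξ, (a + ⟪d, n ξ⟫ + b * ‖n ξ‖ ^ p) ∂D) :=
        (ofReal_integral_eq_lintegral_ofReal h3
          (Filter.Eventually.of_forall fun ξ => (hF0 ξ).trans (hF ξ))).symm
    _ ≤ _ := by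
        refine ENNReal.ofReal_le_ofReal ?_
        rw [integral_add (by exact (integrable_const a).add h1) h2, integral_add (integrable_const a) h1,
          integral_inner h.integrable, h.mean, integral_const_mul]
        simp only [integral_const, probReal_univ, smul_eq_mul, one_mul, inner_zero_right, add_zero]
        gcongr
        exact h.moment

variable {dx dy : ℕ} {f : Z dx dy → ℝ} {D : Measure Ξ} {G : Z dx dy → Ξ → Z dx dy} {σ p : ℝ}

theorem PBCM.isNoise_comp [IsProbabilityMeasure D] (h : PBCM f D G σ p) (z : Z dx dy)
    (A : Z dx dy →L[ℝ] H) (hA : ∀ w, ‖A w‖ ≤ ‖w‖) :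
    IsNoise D (fun ξ => A (G z ξ) - A (gradient f z)) p (σ ^ p) := by
  have hp : 0 ≤ p := by linarith [h.one_lt_p]
  have h1 : Integrable (fun ξ => A (G z ξ)) D := A.integrable_comp (h.integrable z)
  have hle : ∀ ξ, ‖A (G z ξ) - A (gradient f z)‖ ^ p ≤ ‖G z ξ - gradient f z‖ ^ p := fun ξ => by
    rw [← map_sub]
    exact Real.rpow_le_rpow (norm_nonneg _) (hA _) hp
  have h2 : Integrable (fun ξ => A (G z ξ) - A (gradient f z)) D := h1.sub (integrable_const _)
  have h3 : Integrable (fun ξ => ‖A (G z ξ) - A (gradient f z)‖ ^ p) D := by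
    refine (h.integrable_moment z).mono' ?_ (Filter.Eventually.of_forall fun ξ => ?_)
    · exact (h2.aestronglyMeasurable.norm.aemeasurable.pow_const p).aestronglyMeasurable
    · rw [Real.norm_of_nonneg (by positivity)]
      exact hle ξ
  refine ⟨h2, ?_, h3, (integral_mono h3 (h.integrable_moment z) hle).trans (h.moment z)⟩
  rw [integral_sub h1 (integrable_const _), A.integral_comp_comm (h.integrable z), h.unbiased z]
  simp

theorem PBCM.isNoise_fst [IsProbabilityMeasure D] (h : PBCM f D G σ p) (z : Z dx dy) :
    IsNoise D (fun ξ => (G z ξ).fst - (gradient f z).fst) p (σ ^ p) :=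
  h.isNoise_comp z (WithLp.fstL 2 ℝ (E dx) (E dy)) norm_fst_le

theorem PBCM.isNoise_snd [IsProbabilityMeasure D] (h : PBCM f D G σ p) (z : Z dx dy) :
    IsNoise D (fun ξ => (G z ξ).snd - (gradient f z).snd) p (σ ^ p) :=
  h.isNoise_comp z (WithLp.sndL 2 ℝ (E dx) (E dy)) norm_snd_le

end Noise

/-! ### Measurability of the iterates in the samples -/

section Measurability

variable {α Ξ : Type*} [MeasurableSpace α] [MeasurableSpace Ξ] {dx dy : ℕ}
  {G : Z dx dy → Ξ → Z dx dy}

theorem measurable_oracle (hG : Measurable (Function.uncurry G)) {x : α → E dx} {y : α → E dy}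
    {ξ : α → Ξ} (hx : Measurable x) (hy : Measurable y) (hξ : Measurable ξ) :
    Measurable fun a => G (pt (x a) (y a)) (ξ a) :=
  hG.comp ((continuous_pt.measurable.comp (hx.prodMk hy)).prodMk hξ)

theorem measurable_clip {n : ℕ} {v : α → E n} (hv : Measurable v) (τ : ℝ) :
    Measurable fun a => clip (v a) τ :=
  (measurable_const.min (measurable_const.div hv.norm)).smul hv

theorem measurable_batchGrad (hG : Measurable (Function.uncurry G)) {x : α → E dx} {y : α → E dy}
    {ξ : ℕ → α → Ξ} (hx : Measurable x) (hy : Measurable y) (hξ : ∀ i, Measurable (ξ i)) (M : ℕ) :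
    Measurable fun a => batchGrad G M (fun i => ξ i a) (x a) (y a) := by
  refine measurable_const.fun_smul (Finset.measurable_fun_sum _ fun i _ => ?_)
  exact continuous_fst.measurable.comp (measurable_oracle hG hx hy (hξ i))

theorem measurable_innerLoop (hG : Measurable (Function.uncurry G)) {s : α → State dx dy}
    {ξ : ℕ → α → Ξ} (hx : Measurable fun a => (s a).x) (hy : Measurable fun a => (s a).y)
    {k : ℕ} (hξ : ∀ i < k, Measurable (ξ i)) (η : ℝ) (τ : ℕ → ℝ) :
    (Measurable fun a => (innerLoop G η τ (fun i => ξ i a) (s a) k).x) ∧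
      Measurable fun a => (innerLoop G η τ (fun i => ξ i a) (s a) k).y := by
  induction k with
  | zero => exact ⟨hx, hy⟩
  | succ k ih =>
    obtain ⟨h1, h2⟩ := ih fun i hi => hξ i (hi.trans k.lt_succ_self)
    refine ⟨h1, h2.add (measurable_const.fun_smul (measurable_clip ?_ _))⟩
    exact continuous_snd.measurable.comp (measurable_oracle hG h1 h2 (hξ k k.lt_succ_self))

theorem measurable_run (hG : Measurable (Function.uncurry G)) {S : ℕ → ℕ ⊕ ℕ → α → Ξ} {t : ℕ}
    (hS : ∀ s < t, ∀ i, Measurable (S s i)) (ηx : ℝ) (ηy : ℕ → ℝ) (τ : ℕ → ℕ → ℝ) (K M : ℕ)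
    (x₀ : E dx) (y₀ : E dy) :
    (Measurable fun a => (run G ηx ηy τ K M x₀ y₀ (fun s i => S s i a) t).x) ∧
      Measurable fun a => (run G ηx ηy τ K M x₀ y₀ (fun s i => S s i a) t).y := by
  induction t with
  | zero => exact ⟨measurable_const, measurable_const⟩
  | succ t ih =>
    obtain ⟨h1, h2⟩ := ih fun s hs => hS s (hs.trans t.lt_succ_self)
    obtain ⟨h3, h4⟩ := measurable_innerLoop hG h1 h2 (k := K)
      (fun i _ => hS t t.lt_succ_self (Sum.inl i)) (ηy t) (τ t)
    refine ⟨h3.sub (measurable_const.fun_smul ?_), h4⟩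
    have h5 := measurable_batchGrad hG h3 h4 (fun i => hS t t.lt_succ_self (Sum.inr i)) M
    exact h5.norm.inv.smul h5

end Measurability

end N2SGDA

namespace N2SGDA

open scoped RealInnerProductSpace

/-! ### Bias and size of the clipped gradient -/

section Clip

variable {n : ℕ}

theorem clip_of_norm_le {v : E n} {τ : ℝ} (h : ‖v‖ ≤ τ) : clip v τ = v := by
  rcases eq_or_ne v 0 with rfl | hv
  · simp [clip]
  · rw [clip, min_eq_left ((one_le_div (norm_pos_iff.2 hv)).2 h), one_smul]

theorem clip_of_le_norm {v : E n} {τ : ℝ} (hτ : 0 < τ) (h : τ ≤ ‖v‖) :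
    clip v τ = (τ / ‖v‖) • v := by
  rw [clip, min_eq_right ((div_le_one (hτ.trans_le h)).2 h)]

theorem norm_clip_le {v : E n} {τ : ℝ} (hτ : 0 < τ) : ‖clip v τ‖ ≤ τ := by
  rcases le_total ‖v‖ τ with h | h
  · rwa [clip_of_norm_le h]
  · have := hτ.trans_le h
    rw [clip_of_le_norm hτ h, norm_smul, Real.norm_of_nonneg (by positivity),
      div_mul_cancel₀ _ this.ne']

theorem norm_clip_sub_self_le {v : E n} {τ : ℝ} (hτ : 0 < τ) :
    ‖clip v τ - v‖ ≤ max 0 (‖v‖ - τ) := by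
  rcases le_total ‖v‖ τ with h | h
  · simp [clip_of_norm_le h]
  · have h0 := hτ.trans_le h
    have h1 : clip v τ - v = -((1 - τ / ‖v‖) • v) := by
      rw [clip_of_le_norm hτ h]
      module
    have h2 : 0 ≤ 1 - τ / ‖v‖ := sub_nonneg.2 ((div_le_one h0).2 h)
    rw [h1, norm_neg, norm_smul, Real.norm_of_nonneg h2]
    refine le_max_of_le_right (le_of_eq ?_)
    field_simp

variable {τ p : ℝ} {v g : E n}

/-- Clipping acts only if ‖g‖ > τ, hence ‖g - v‖ ≥ τ/2. Then the ratio t = ‖g - v‖/τ is at least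
1/2, so 2t ≤ (2t)^p ≤ 4t^p, and the excess ‖g‖ - τ is at most τt. -/
theorem norm_clip_sub_self_le_rpow (hτ : 0 < τ) (hp : 1 ≤ p) (hp2 : p ≤ 2) (hv : ‖v‖ ≤ τ / 2) :
    ‖clip g τ - g‖ ≤ 2 * τ * (‖g - v‖ / τ) ^ p := by
  set t := ‖g - v‖ / τ with ht
  have ht0 : 0 ≤ t := by positivity
  have h1 := norm_clip_sub_self_le (v := g) hτ
  rcases le_total ‖g‖ τ with h | h
  · rw [max_eq_left (by linarith)] at h1
    exact h1.trans (by positivity)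
  · rw [max_eq_right (by linarith)] at h1
    have h2 : ‖g‖ ≤ ‖g - v‖ + ‖v‖ := by simpa using norm_add_le (g - v) v
    have h3 : ‖g - v‖ = τ * t := by rw [ht]; field_simp
    have h4 : 1 ≤ 2 * t := by
      refine le_of_mul_le_mul_left ?_ hτ
      linarith
    have h5 : 2 * t ≤ (2 * t) ^ p := Real.self_le_rpow_of_one_le h4 hp
    have h6 : (2 : ℝ) ^ p ≤ 4 := by
      calc (2 : ℝ) ^ p ≤ 2 ^ (2 : ℝ) := Real.rpow_le_rpow_of_exponent_le one_le_two hp2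
        _ = 4 := by norm_num
    rw [Real.mul_rpow zero_le_two ht0] at h5
    have h7 : t ≤ 2 * t ^ p := by nlinarith [Real.rpow_nonneg ht0 p]
    nlinarith [mul_le_mul_of_nonneg_left h7 hτ.le]

theorem norm_clip_sub_le (hτ : 0 < τ) (hv : ‖v‖ ≤ τ / 2) : ‖clip g τ - v‖ ≤ 2 * τ := by
  have h1 := norm_sub_le (clip g τ) v
  have h2 := norm_clip_le (v := g) hτ
  linarith

/-- The clipped error is at most 2τ and also at most 2‖g - v‖. Divided by 2τ it is thus at most
min(1, t), and for such s one has s² ≤ s^p ≤ t^p: boundedness trades the missing second moment for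
the p-th. -/
theorem sq_norm_clip_sub_le_rpow (hτ : 0 < τ) (hp : 1 ≤ p) (hp2 : p ≤ 2) (hv : ‖v‖ ≤ τ / 2) :
    ‖clip g τ - v‖ ^ 2 ≤ 4 * τ ^ 2 * (‖g - v‖ / τ) ^ p := by
  set t := ‖g - v‖ / τ with ht
  have ht0 : 0 ≤ t := by positivity
  have h3 : ‖g - v‖ = τ * t := by rw [ht]; field_simp
  set s := ‖clip g τ - v‖ / (2 * τ) with hs
  have hs0 : 0 ≤ s := by positivity
  have h4 : ‖clip g τ - v‖ = 2 * τ * s := by rw [hs]; field_simp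
  have hs1 : s ≤ 1 := (div_le_one (by positivity)).2 (norm_clip_sub_le hτ hv)
  have hst : s ≤ t := by
    have h5 : ‖clip g τ - v‖ ≤ ‖clip g τ - g‖ + ‖g - v‖ := norm_sub_le_norm_sub_add_norm_sub _ _ _
    have h2 : ‖g‖ ≤ ‖g - v‖ + ‖v‖ := by simpa using norm_add_le (g - v) v
    have h6 : ‖clip g τ - g‖ ≤ ‖g - v‖ :=
      (norm_clip_sub_self_le hτ).trans (max_le (norm_nonneg _) (by linarith))
    refine le_of_mul_le_mul_left ?_ (show 0 < 2 * τ by positivity)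
    rw [← h4]
    linarith
  have h7 : s ^ 2 ≤ t ^ p := by
    rcases hs0.eq_or_lt with h0 | h0
    · rw [← h0, zero_pow two_ne_zero]
      positivity
    · calc s ^ 2 = s ^ (2 : ℝ) := (Real.rpow_two s).symm
        _ ≤ s ^ p := Real.rpow_le_rpow_of_exponent_ge h0 hs1 hp2
        _ ≤ t ^ p := Real.rpow_le_rpow hs0 hst (by linarith)
  rw [h4]
  nlinarith [mul_le_mul_of_nonneg_left h7 (show 0 ≤ 4 * τ ^ 2 by positivity)]

end Clip

theorem exp_le_one_add_add_sq {u : ℝ} (hu : |u| ≤ 1) : Real.exp u ≤ 1 + u + u ^ 2 := by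
  have := (abs_le.1 (Real.abs_exp_sub_one_sub_id_le hu)).2
  linarith

/-! ### One inner step -/

section InnerStep

variable {dx dy : ℕ} {f : Z dx dy → ℝ} {ℓ μ : ℝ}

/-- Expand the square with c = v + θ and ‖v + θ‖² ≤ 2‖v‖² + 2‖θ‖². The term 2η²‖v‖² is absorbed by
`cocoercive` since 2ηℓ ≤ 1, which leaves a contraction by 1 - ημ. -/
theorem MinimaxAssumption.dist_sq_ascent_le (h : MinimaxAssumption f ℓ μ) (hdy : 0 < dy)
    {η : ℝ} (hη : 0 ≤ η) (hηℓ : 2 * η * ℓ ≤ 1) (x : E dx) (y c : E dy) :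
    ‖y + η • c - h.argmax x‖ ^ 2 ≤ (1 - η * μ) * ‖y - h.argmax x‖ ^ 2 +
      2 * η * ⟪y - h.argmax x, c - (gradient f (pt x y)).snd⟫ +
      2 * η ^ 2 * ‖c - (gradient f (pt x y)).snd‖ ^ 2 := by
  have hℓ := h.smooth_pos hdy
  have hco := h.cocoercive hdy x y
  set d := y - h.argmax x
  set v := (gradient f (pt x y)).snd
  set θ := c - v
  have e1 : y + η • c - h.argmax x = d + η • (v + θ) := by simp only [d, θ]; module
  rw [e1, norm_add_sq_real, real_inner_smul_right, inner_add_right, norm_smul,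
    Real.norm_of_nonneg hη, mul_pow]
  have h2 : ‖v + θ‖ ^ 2 ≤ 2 * ‖v‖ ^ 2 + 2 * ‖θ‖ ^ 2 := by
    have := parallelogram_law_with_norm ℝ v θ
    nlinarith [sq_nonneg ‖v - θ‖]
  have h3 := mul_le_mul_of_nonneg_left h2 (sq_nonneg η)
  have h4 := mul_le_mul_of_nonneg_left hco (show 0 ≤ 2 * η by positivity)
  have h5 : 2 * η ^ 2 * ‖v‖ ^ 2 ≤ 2 * η * (‖v‖ ^ 2 / (2 * ℓ)) := by
    rw [show 2 * η * (‖v‖ ^ 2 / (2 * ℓ)) = η * ‖v‖ ^ 2 / ℓ by field_simp, le_div_iff₀ hℓ]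
    nlinarith [mul_le_mul_of_nonneg_left hηℓ (show 0 ≤ η * ‖v‖ ^ 2 by positivity)]
  nlinarith

/-- The exponential moment of one normalized inner step, in dimensionless quantities. -/
theorem exp_inner_step_le {A e D s m b J Jn Q : ℝ} (hA : 1 ≤ A) (he : 120 * A * e = 1)
    (hD0 : 0 ≤ D) (hD : D ≤ 3 / 2) (hs0 : 0 ≤ s) (hs : s ≤ 2) (hsm : s ^ 2 ≤ 4 * m)
    (hb : b ≤ 2 * m) (hJ : |J| ≤ 2 * D * e * s) (hJn : J ≤ 2 * D * e * b + Jn) (hQ0 : 0 ≤ Q)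
    (hQ : Q ≤ 2 * e ^ 2 * s ^ 2) :
    Real.exp (2 * A * (J + Q)) ≤ 1 + 2 * A * Jn + m / 8 := by
  -- Dictionary: D is the weighted distance √w, at most √2 < 3/2; s and b are the clipped error and
  -- the clipping bias divided by the level; m is the p-th power of the noise divided by the level;
  -- J and Q are the linear and quadratic parts of the increment of w, and Jn is the part linear in
  -- the raw noise.
  have he0 : 0 < e := by
    by_contra hc
    nlinarith
  have he1 : e ≤ 1 / 120 := by nlinarith
  have hm : 0 ≤ m := by nlinarith
  have hAe : A * e = 1 / 120 := by linarith
  have hJ3 : |J| ≤ 3 * (e * s) := hJ.trans (by nlinarith [mul_nonneg he0.le hs0])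
  have hQ4 : Q ≤ 8 * e ^ 2 * m := hQ.trans (by nlinarith [sq_nonneg e])
  have hes : e * s ≤ 2 * e := by nlinarith
  have hs4 : s ^ 2 ≤ 4 := by nlinarith
  have hQs : Q ≤ 8 * e ^ 2 := hQ.trans (by nlinarith [sq_nonneg e])
  have hJ2 : J ^ 2 ≤ 36 * (e ^ 2 * m) := by
    have := pow_le_pow_left₀ (abs_nonneg J) hJ3 2
    rw [sq_abs] at this
    nlinarith [sq_nonneg e]
  have hQ1 : Q ≤ e := by nlinarith
  have hQ2 : Q ^ 2 ≤ e ^ 2 * m := by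
    calc Q ^ 2 = Q * Q := sq Q
      _ ≤ e * (8 * e ^ 2 * m) := by gcongr
      _ ≤ e ^ 2 * m := by nlinarith [mul_nonneg (sq_nonneg e) hm]
  -- The bound 60e is exactly what 120Ae = 1 permits; it allows the estimate exp u ≤ 1 + u + u².
  have hu : |2 * A * (J + Q)| ≤ 1 := by
    have h1 : |J + Q| ≤ 60 * e := by
      refine (abs_add_le J Q).trans ?_
      rw [abs_of_nonneg hQ0]
      nlinarith
    rw [abs_mul, abs_of_nonneg (by linarith)]
    nlinarith [abs_nonneg (J + Q)]
  refine (exp_le_one_add_add_sq hu).trans ?_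
  have hX2 : (2 * A * (J + Q)) ^ 2 ≤ m / 48 := by
    have h1 : (J + Q) ^ 2 ≤ 74 * (e ^ 2 * m) := by nlinarith [sq_nonneg (J - Q)]
    have h2 : A ^ 2 * e ^ 2 = 1 / 14400 := by rw [← mul_pow, hAe]; norm_num
    calc (2 * A * (J + Q)) ^ 2 = 4 * A ^ 2 * (J + Q) ^ 2 := by ring
      _ ≤ 4 * A ^ 2 * (74 * (e ^ 2 * m)) := by gcongr
      _ = 4 * 74 * (A ^ 2 * e ^ 2) * m := by ring
      _ ≤ m / 48 := by rw [h2]; linarith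
  have hJb : 2 * A * J ≤ 2 * A * Jn + m / 10 := by
    have h1 : 2 * D * e * b ≤ 6 * e * m := by
      calc 2 * D * e * b ≤ 2 * D * e * (2 * m) := by gcongr
        _ ≤ 2 * (3 / 2) * e * (2 * m) := by gcongr
        _ = 6 * e * m := by ring
    calc 2 * A * J ≤ 2 * A * (6 * e * m + Jn) := by gcongr; linarith
      _ = 2 * A * Jn + 12 * (A * e) * m := by ring
      _ = _ := by rw [hAe]; ring
  have hQb : 2 * A * Q ≤ m / 800 := by
    calc 2 * A * Q ≤ 2 * A * (8 * e ^ 2 * m) := by gcongr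
      _ = 16 * (A * e) * e * m := by ring
      _ ≤ 16 * (1 / 120) * (1 / 120) * m := by rw [hAe]; gcongr
      _ ≤ m / 800 := by linarith
  -- The multiples of m from bias, quadratic part and square add up to 1/10 + 1/800 + 1/48 < 1/8.
  linarith

end InnerStep

end N2SGDA

/-! ### High-probability contraction of one inner loop -/

namespace N2SGDA

open scoped RealInnerProductSpace

/-- The relations between the parameters of the inner loop that its analysis uses. -/
structure InnerParams (ℓ μ σ p η R A : ℝ) (K : ℕ) (τ : ℕ → ℝ) : Prop where
  one_le_A : 1 ≤ A
  eta_pos : 0 < η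
  eta_le : η * ℓ * A ≤ 1 / 400
  R_pos : 0 < R
  K_pos : 0 < K
  clip_eq : ∀ k, τ k = Real.exp (-(η * μ * (1 + k / 2))) * R / (120 * η * A)
  noise_le : ∀ k < K, σ ^ p / τ k ^ p ≤ 8 * A / K

/-- The normalized squared distance `exp (η μ k) ‖y - y*‖² / R²`. -/
noncomputable def normDist {dy : ℕ} (η μ R : ℝ) (ys : E dy) (k : ℕ) (y : E dy) : ℝ :=
  Real.exp (η * μ * k) * ‖y - ys‖ ^ 2 / R ^ 2

/-- A potential that dominates the probability of `2 ≤ normDist` after `K` steps. -/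
noncomputable def innerPotential {dy : ℕ} (η μ R A : ℝ) (K : ℕ) (ys : E dy) (k : ℕ) (y : E dy) :
    ENNReal :=
  min 1 (ENNReal.ofReal
    (Real.exp (2 * A * (normDist η μ R ys k y - 2 + ((K : ℝ) - k) / (2 * K)))))

section

variable {Ξ : Type*} [MeasurableSpace Ξ] {dx dy : ℕ} {f : Z dx dy → ℝ} {D : Measure Ξ}
  {G : Z dx dy → Ξ → Z dx dy} {ℓ μ σ p η R A : ℝ} {K : ℕ} {τ : ℕ → ℝ}

theorem InnerParams.clip_pos (hq : InnerParams ℓ μ σ p η R A K τ) (k : ℕ) : 0 < τ k := by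
  have := hq.eta_pos
  have := hq.one_le_A
  have := hq.R_pos
  rw [hq.clip_eq]
  positivity

/-- The exponential moment of the increment of `normDist`. Here `a = exp (η μ)` and
`ρ ^ 2 = exp (η μ k)`. -/
theorem exp_clip_step_le {d v g : E dy} {a ρ e t : ℝ} (hA : 1 ≤ A) (hη : 0 < η) (hR : 0 < R)
    (ht : 0 < t) (hp : 1 ≤ p) (hp2 : p ≤ 2) (ha1 : 1 ≤ a) (ha2 : a ≤ 11 / 10) (hρ : 0 < ρ)
    (he : 120 * A * e = 1) (hte : η * (a * (ρ * t)) = e * R) (hv : ‖v‖ ≤ ℓ * ‖d‖)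
    (hηℓ : η * ℓ ≤ 3 / 10 * e) (hw : (ρ * ‖d‖ / R) ^ 2 ≤ 2) :
    Real.exp (2 * A * (a * ρ ^ 2 * (2 * η * ⟪d, clip g t - v⟫) / R ^ 2 +
      a * ρ ^ 2 * (2 * η ^ 2 * ‖clip g t - v‖ ^ 2) / R ^ 2)) ≤
      1 + ⟪(2 * A * (a * ρ ^ 2 * (2 * η) / R ^ 2)) • d, g - v⟫ +
      (8 * t ^ p)⁻¹ * ‖g - v‖ ^ p := by
  have he0 : 0 < e := by
    by_contra hc
    nlinarith
  obtain ⟨Dn, hDn⟩ : ∃ Dn, Dn = ρ * ‖d‖ / R := ⟨_, rfl⟩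
  have hDn0 : 0 ≤ Dn := by rw [hDn]; positivity
  rw [← hDn] at hw
  have hDn2 : Dn ≤ 3 / 2 := by nlinarith
  have hd : ‖d‖ = Dn * R / ρ := by rw [hDn]; field_simp
  have ht' : t = e * R / (η * (a * ρ)) := by
    rw [← hte]
    field_simp
  -- While w ≤ 2 the true gradient stays below half the clipping level: the margin is 3/10 · 11/10 ·
  -- 3/2 = 0.495 < 1/2.
  have hvt : ‖v‖ ≤ t / 2 := by
    refine hv.trans ?_
    rw [hd, ht', ← mul_div_assoc, div_div, div_le_div_iff₀ hρ (by positivity)]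
    have h2 : a * Dn ≤ 11 / 10 * (3 / 2) := by gcongr
    have h3 : (η * ℓ) * (a * Dn) ≤ (3 / 10 * e) * (11 / 10 * (3 / 2)) := by gcongr
    calc ℓ * (Dn * R) * (η * (a * ρ) * 2) = (η * ℓ) * (a * Dn) * (2 * R * ρ) := by ring
      _ ≤ (3 / 10 * e) * (11 / 10 * (3 / 2)) * (2 * R * ρ) := by gcongr
      _ ≤ e * R * ρ := by linarith [mul_pos (mul_pos he0 hR) hρ]
  have hb := norm_clip_sub_self_le_rpow (g := g) ht hp hp2 hvt
  have hs := norm_clip_sub_le (g := g) ht hvt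
  have hsq := sq_norm_clip_sub_le_rpow (g := g) ht hp hp2 hvt
  have hcoef : a * ρ ^ 2 * (2 * η) * ‖d‖ / R ^ 2 * t = 2 * Dn * e := by
    rw [hd]
    calc a * ρ ^ 2 * (2 * η) * (Dn * R / ρ) / R ^ 2 * t
        = 2 * Dn * (η * (a * (ρ * t))) / R := by field_simp
      _ = 2 * Dn * e := by rw [hte]; field_simp
  have hJabs : |a * ρ ^ 2 * (2 * η * ⟪d, clip g t - v⟫) / R ^ 2| ≤
      2 * Dn * e * (‖clip g t - v‖ / t) := by
    have h1 := abs_real_inner_le_norm d (clip g t - v)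
    rw [abs_div, abs_mul, abs_mul (2 * η), abs_of_pos (show 0 < R ^ 2 by positivity),
      abs_of_pos (show 0 < 2 * η by positivity), abs_of_pos (show 0 < a * ρ ^ 2 by positivity),
      ← hcoef]
    calc a * ρ ^ 2 * (2 * η * |⟪d, clip g t - v⟫|) / R ^ 2
        ≤ a * ρ ^ 2 * (2 * η * (‖d‖ * ‖clip g t - v‖)) / R ^ 2 := by gcongr
      _ = _ := by field_simp
  have hJle : a * ρ ^ 2 * (2 * η * ⟪d, clip g t - v⟫) / R ^ 2 ≤
      2 * Dn * e * (‖clip g t - g‖ / t) + a * ρ ^ 2 * (2 * η * ⟪d, g - v⟫) / R ^ 2 := by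
    have h1 : ⟪d, clip g t - v⟫ ≤ ‖d‖ * ‖clip g t - g‖ + ⟪d, g - v⟫ := by
      have h2 := real_inner_le_norm d (clip g t - g)
      rw [show clip g t - v = (clip g t - g) + (g - v) by abel, inner_add_right]
      linarith
    rw [← hcoef]
    calc a * ρ ^ 2 * (2 * η * ⟪d, clip g t - v⟫) / R ^ 2
        ≤ a * ρ ^ 2 * (2 * η * (‖d‖ * ‖clip g t - g‖ + ⟪d, g - v⟫)) / R ^ 2 := by gcongr
      _ = _ := by field_simp
  have hQ : a * ρ ^ 2 * (2 * η ^ 2 * ‖clip g t - v‖ ^ 2) / R ^ 2 ≤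
      2 * e ^ 2 * (‖clip g t - v‖ / t) ^ 2 := by
    have h1 : a * ρ ^ 2 * (2 * η ^ 2 * ‖clip g t - v‖ ^ 2) / R ^ 2 =
        2 * (η * (a * (ρ * t)) / R) ^ 2 * (‖clip g t - v‖ / t) ^ 2 / a := by
      field_simp
    rw [h1, hte, mul_div_cancel_right₀ _ hR.ne']
    exact div_le_self (by positivity) ha1
  have hexp := exp_inner_step_le hA he hDn0 hDn2 (by positivity) ((div_le_iff₀ ht).2 hs)
    (m := (‖g - v‖ / t) ^ p) (by rw [div_pow, div_le_iff₀ (by positivity)]; linarith)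
    ((div_le_iff₀ ht).2 (by linarith)) hJabs hJle (by positivity) hQ
  refine hexp.trans (le_of_eq ?_)
  rw [real_inner_smul_left, Real.div_rpow (norm_nonneg _) ht.le]
  field_simp

/-- Since (1 - ημ)exp(ημ) ≤ 1, the contraction pays for the growth of the weight, and the increment
of `normDist` consists of the linear and quadratic noise terms only. The majorant has the form
required by `IsNoise.lintegral_le`. -/
theorem normDist_step_le (h : MinimaxAssumption f ℓ μ) (hdy : 0 < dy)
    (hq : InnerParams ℓ μ σ p η R A K τ) (hp : 1 ≤ p) (hp2 : p ≤ 2) (x : E dx) (y g : E dy) (k : ℕ)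
    (hw : normDist η μ R (h.argmax x) k y ≤ 2) :
    Real.exp (2 * A * (normDist η μ R (h.argmax x) (k + 1) (y + η • clip g (τ k)) -
      normDist η μ R (h.argmax x) k y)) ≤
      1 + ⟪(2 * A * (Real.exp (η * μ) * Real.exp (η * μ * k / 2) ^ 2 * (2 * η) / R ^ 2)) •
        (y - h.argmax x), g - (gradient f (pt x y)).snd⟫ +
      (8 * τ k ^ p)⁻¹ * ‖g - (gradient f (pt x y)).snd‖ ^ p := by
  have hA := hq.one_le_A
  have hη := hq.eta_pos
  have hR := hq.R_pos
  have hτ := hq.clip_pos k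
  have hμ := h.mu_pos
  have hℓ := h.smooth_pos hdy
  have hμℓ := h.mu_le_smooth hdy
  have hηℓ : η * ℓ ≤ 1 / 400 := by nlinarith [hq.eta_le, mul_pos hη hℓ]
  have hone := h.dist_sq_ascent_le hdy hη.le (by linarith) x y (clip g (τ k))
  have hv := h.norm_snd_gradient_le hdy x y
  have hτ_eq := hq.clip_eq k
  have hρ2 : Real.exp (η * μ * k) = Real.exp (η * μ * k / 2) ^ 2 := by
    rw [← Real.exp_nat_mul]
    congr 1
    push_cast
    ring
  have haρ : Real.exp (η * μ * (k + 1)) = Real.exp (η * μ) * Real.exp (η * μ * k / 2) ^ 2 := by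
    rw [← hρ2, ← Real.exp_add]
    congr 1
    ring
  have hτaρ : Real.exp (-(η * μ * (1 + k / 2))) =
      (Real.exp (η * μ) * Real.exp (η * μ * k / 2))⁻¹ := by
    rw [Real.exp_neg, ← Real.exp_add]
    congr 2
    ring
  have ha3 : (1 - η * μ) * Real.exp (η * μ) ≤ 1 := by
    have h2 := Real.add_one_le_exp (-(η * μ))
    have h3 : Real.exp (-(η * μ)) * Real.exp (η * μ) = 1 := by rw [← Real.exp_add]; simp
    nlinarith [Real.exp_pos (η * μ)]
  have ha1 : 1 ≤ Real.exp (η * μ) := Real.one_le_exp (by positivity)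
  have ha2 : Real.exp (η * μ) ≤ 11 / 10 := by
    have h1 : η * μ ≤ 1 / 400 := le_trans (by gcongr) hηℓ
    have h2 : 0 ≤ η * μ := by positivity
    have := exp_le_one_add_add_sq (u := η * μ) (by rw [abs_of_nonneg h2]; linarith)
    nlinarith
  have hρ0 : 0 < Real.exp (η * μ * k / 2) := Real.exp_pos _
  rw [normDist, normDist, Nat.cast_succ, haρ, hρ2]
  rw [normDist, hρ2] at hw
  rw [hτaρ] at hτ_eq
  generalize Real.exp (η * μ) = a at *
  generalize Real.exp (η * μ * k / 2) = ρ at *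
  generalize (gradient f (pt x y)).snd = v at *
  generalize τ k = t at *
  -- This is the step size bound 1/(400A), since 3/10 · 1/120 = 1/400.
  have hηℓ2 : η * ℓ ≤ 3 / 10 * (1 / (120 * A)) := by
    rw [mul_one_div, le_div_iff₀ (by positivity)]
    linarith [hq.eta_le]
  refine le_trans (Real.exp_le_exp.2 (mul_le_mul_of_nonneg_left ?_ (by positivity)))
    (exp_clip_step_le (e := 1 / (120 * A)) hA hη hR hτ hp hp2 ha1 ha2 hρ0 (by field_simp)
      (by rw [hτ_eq]; field_simp) hv hηℓ2 (by rw [div_pow, mul_pow]; exact hw))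
  have h3 := mul_le_mul_of_nonneg_left hone (show 0 ≤ a * ρ ^ 2 by positivity)
  have h4 := mul_le_mul_of_nonneg_right ha3 (show 0 ≤ ρ ^ 2 * ‖y - h.argmax x‖ ^ 2 by positivity)
  rw [← add_div, ← sub_div]
  refine div_le_div_of_nonneg_right ?_ (by positivity)
  linarith

theorem measurable_normDist (η μ R : ℝ) (ys : E dy) (k : ℕ) :
    Measurable (normDist η μ R ys k) :=
  (measurable_const.mul ((measurable_id.sub_const ys).norm.pow_const 2)).div_const _

theorem measurable_innerPotential (η μ R A : ℝ) (K : ℕ) (ys : E dy) (k : ℕ) :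
    Measurable (innerPotential η μ R A K ys k) :=
  measurable_const.min (Real.measurable_exp.comp
    ((((measurable_normDist η μ R ys k).sub_const 2).add_const _).const_mul _)).ennreal_ofReal

variable [IsProbabilityMeasure D]

/-- Integration leaves 1 + σ^p/(8τ_k^p), which the noise condition bounds by 1 + A/K ≤ exp(A/K). -/
theorem lintegral_exp_normDist_le (h : MinimaxAssumption f ℓ μ) (hG : PBCM f D G σ p)
    (hdy : 0 < dy) (hq : InnerParams ℓ μ σ p η R A K τ) (x : E dx) (y : E dy) {k : ℕ} (hk : k < K)
    (hw : normDist η μ R (h.argmax x) k y ≤ 2) :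
    ∫⁻ ξ, ENNReal.ofReal (Real.exp (2 * A *
      (normDist η μ R (h.argmax x) (k + 1) (y + η • clip (G (pt x y) ξ).snd (τ k)) -
        normDist η μ R (h.argmax x) k y))) ∂D ≤ ENNReal.ofReal (Real.exp (A / K)) := by
  have hτ := hq.clip_pos k
  refine ((hG.isNoise_snd (pt x y)).lintegral_le (b := (8 * τ k ^ p)⁻¹) (by positivity)
    (fun ξ => (Real.exp_pos _).le) fun ξ => normDist_step_le h hdy hq hG.one_lt_p.le
      hG.p_le_two x y _ k hw).trans (ENNReal.ofReal_le_ofReal ?_)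
  have h1 := hq.noise_le k hk
  have h2 := Real.add_one_le_exp (A / K)
  have h3 : (8 * τ k ^ p)⁻¹ * σ ^ p = (σ ^ p / τ k ^ p) / 8 := by
    rw [mul_inv, div_eq_mul_inv, div_eq_mul_inv]
    ring
  rw [h3]
  have h4 : 8 * A / K = 8 * (A / K) := by ring
  linarith

/-- Below level 2 the term (K-k)/(2K) drops by 1/(2K) per step; multiplied by 2A this is A/K, the
growth allowed by the exponential moment. From level 2 on the potential already equals its cap 1, so
the minimum acts as a stopping time. -/
theorem lintegral_innerPotential_le (h : MinimaxAssumption f ℓ μ) (hG : PBCM f D G σ p)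
    (hdy : 0 < dy) (hq : InnerParams ℓ μ σ p η R A K τ) (x : E dx) (y : E dy) {k : ℕ}
    (hk : k < K) :
    ∫⁻ ξ, innerPotential η μ R A K (h.argmax x) (k + 1)
      (y + η • clip (G (pt x y) ξ).snd (τ k)) ∂D ≤
      innerPotential η μ R A K (h.argmax x) k y := by
  have hA := hq.one_le_A
  have hK : (0 : ℝ) < K := Nat.cast_pos.2 hq.K_pos
  have hkK : (k : ℝ) ≤ K := Nat.cast_le.2 hk.le
  refine le_min ?_ ?_
  · exact (lintegral_mono fun ξ => min_le_left _ _).trans (by simp)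
  rcases le_total (normDist η μ R (h.argmax x) k y) 2 with hw | hw
  · set w := normDist η μ R (h.argmax x) k y
    have h1 := lintegral_exp_normDist_le h hG hdy hq x y hk hw
    set B := 2 * A * (w - 2 + ((K : ℝ) - (k + 1)) / (2 * K)) with hB
    calc _ ≤ ∫⁻ ξ, ENNReal.ofReal (Real.exp B) * ENNReal.ofReal (Real.exp (2 * A *
          (normDist η μ R (h.argmax x) (k + 1) (y + η • clip (G (pt x y) ξ).snd (τ k)) - w))) ∂D := by
          refine lintegral_mono fun ξ => (min_le_right _ _).trans (le_of_eq ?_)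
          rw [← ENNReal.ofReal_mul (Real.exp_pos _).le, ← Real.exp_add, hB]
          congr 2
          push_cast
          ring
      _ = ENNReal.ofReal (Real.exp B) * _ := lintegral_const_mul' _ _ ENNReal.ofReal_ne_top
      _ ≤ ENNReal.ofReal (Real.exp B) * ENNReal.ofReal (Real.exp (A / K)) := by gcongr
      _ = _ := by
          rw [← ENNReal.ofReal_mul (Real.exp_pos _).le, ← Real.exp_add, hB]
          congr 2
          field_simp
          ring
  · refine le_trans ?_ (ENNReal.ofReal_le_ofReal (Real.one_le_exp
      (mul_nonneg (by linarith) (add_nonneg (sub_nonneg.2 hw) ?_))))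
    · exact (lintegral_mono fun ξ => min_le_left _ _).trans (by simp)
    · exact div_nonneg (sub_nonneg.2 hkK) (by positivity)

theorem innerLoop_x {Ξ : Type*} (G : Z dx dy → Ξ → Z dx dy) (η : ℝ) (τ : ℕ → ℝ) (ξ : ℕ → Ξ) (s : State dx dy)
    (k : ℕ) : (innerLoop G η τ ξ s k).x = s.x := by
  induction k with
  | zero => rfl
  | succ k ih => exact ih

/-- The inner loop contracts the distance to the maximizer with high probability. -/
theorem measure_innerLoop_le {Ω : Type*} [MeasurableSpace Ω] {P : Measure Ω}
    [IsProbabilityMeasure P] (h : MinimaxAssumption f ℓ μ) (hG : PBCM f D G σ p)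
    (hdy : 0 < dy) (hq : InnerParams ℓ μ σ p η R A K τ) {ξ : ℕ → Ω → Ξ}
    (hξ : ∀ k, Measurable (ξ k)) (hD : ∀ k, P.map (ξ k) = D) (hind : iIndepFun ξ P)
    (s : State dx dy) (hs : ‖s.y - h.argmax s.x‖ ≤ R) :
    P {ω | 2 * Real.exp (-(η * μ * K)) * R ^ 2 ≤
      ‖(innerLoop G η τ (fun k => ξ k ω) s K).y - h.argmax s.x‖ ^ 2} ≤
      ENNReal.ofReal (Real.exp (-A)) := by
  have hR := hq.R_pos
  have hA := hq.one_le_A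
  have hK : (0 : ℝ) < K := Nat.cast_pos.2 hq.K_pos
  set X : ℕ → Ω → E dy := fun k ω => (innerLoop G η τ (fun k => ξ k ω) s k).y with hX
  set V := innerPotential η μ R A K (h.argmax s.x) with hV
  set step : ℕ → E dy × Ξ → E dy := fun k q => q.1 + η • clip (G (pt s.x q.1) q.2).snd (τ k)
    with hst
  have hstep : ∀ k, Measurable (step k) := fun k =>
    measurable_fst.add (measurable_const.fun_smul (measurable_clip
      (continuous_snd.measurable.comp (measurable_oracle hG.measurable measurable_const
        measurable_fst measurable_snd)) _))
  have hVm : ∀ k, Measurable (V k) := measurable_innerPotential _ _ _ _ _ _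
  have hXm : ∀ k, Measurable (X k) := fun k => (measurable_innerLoop hG.measurable
    (s := fun _ => s) measurable_const measurable_const (fun i _ => hξ i) η τ).2
  have hXind : ∀ k, IndepFun (X k) (ξ k) P := by
    intro k
    refine indepFun_of_disjoint hξ hind (A := {i | i < k}) (B := {k}) (by simp) ?_
      (measurable_sigmaOf ξ rfl)
    exact (@measurable_innerLoop Ω Ξ (sigmaOf ξ {i | i < k}) _ dx dy G hG.measurable
      (fun _ => s) ξ measurable_const measurable_const k
      (fun i hi => measurable_sigmaOf ξ hi) η τ).2
  have hchain := lintegral_chain_le (P := P) (X := X) (ξ := ξ) (step := step) (V := V) hXm hξ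
    hstep hVm hXind (fun k ω => by simp only [hX, innerLoop, innerStep, hst, innerLoop_x]) (n := K)
    (fun k hk x => by
      refine le_trans (le_of_eq ?_) (lintegral_innerPotential_le h hG hdy hq s.x x hk)
      rw [← hD k]
      exact (lintegral_map (f := fun v => V (k + 1) (step k (x, v)))
        ((hVm _).comp ((hstep k).comp measurable_prodMk_left)) (hξ k)).symm)
  have hw : ∀ y : E dy, 2 * Real.exp (-(η * μ * K)) * R ^ 2 ≤ ‖y - h.argmax s.x‖ ^ 2 →
      1 ≤ V K y := by
    intro y hy
    refine le_min le_rfl ?_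
    rw [ENNReal.one_le_ofReal, sub_self, zero_div, add_zero]
    refine Real.one_le_exp (mul_nonneg (by linarith) (sub_nonneg.2 ?_))
    rw [normDist, le_div_iff₀ (by positivity)]
    have h1 := mul_le_mul_of_nonneg_left hy (Real.exp_pos (η * μ * K)).le
    rw [Real.exp_neg] at h1
    refine le_trans (le_of_eq ?_) h1
    field_simp
  calc _ ≤ P {ω | 1 ≤ V K (X K ω)} := measure_mono fun ω hω => hw _ hω
    _ ≤ ∫⁻ ω, V K (X K ω) ∂P := by
        simpa using mul_meas_ge_le_lintegral₀ ((hVm K).comp (hXm K)).aemeasurable 1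
    _ ≤ ∫⁻ ω, V 0 (X 0 ω) ∂P := hchain
    _ = V 0 s.y := by simp [hX, innerLoop]
    _ ≤ _ := by
        -- Initially w ≤ 1, so the exponent is at most 2A(1 - 2 + 1/2) = -A.
        refine (min_le_right _ _).trans (ENNReal.ofReal_le_ofReal (Real.exp_le_exp.2 ?_))
        have h1 : normDist η μ R (h.argmax s.x) 0 s.y ≤ 1 := by
          rw [normDist, Nat.cast_zero, mul_zero, Real.exp_zero, one_mul]
          exact div_le_one_of_le₀ (pow_le_pow_left₀ (norm_nonneg _) hs 2) (by positivity)
        have h2 : ((K : ℝ) - (0 : ℕ)) / (2 * K) = 1 / 2 := by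
          field_simp
          simp
        rw [h2]
        nlinarith

end

end N2SGDA

namespace N2SGDA

open scoped RealInnerProductSpace

/-! ### Pointwise inequalities for powers and normalized directions -/

section Pointwise

variable {H : Type*} [NormedAddCommGroup H] [InnerProductSpace ℝ H]

/-- A pointwise form of the von Bahr–Esseen inequality. -/
theorem norm_add_rpow_le {p : ℝ} (hp : 1 < p) (hp2 : p ≤ 2) (z n : H) :
    ‖z + n‖ ^ p ≤ ‖z‖ ^ p + ⟪(p * ‖z‖ ^ (p - 2)) • z, n⟫ + 6 * ‖n‖ ^ p := by
  have hp0 : 0 < p := by linarith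
  rcases (norm_nonneg z).eq_or_lt with hz | hz
  · have hz' : z = 0 := norm_eq_zero.1 hz.symm
    rw [hz', zero_add, smul_zero, inner_zero_left, norm_zero, Real.zero_rpow hp0.ne']
    have : 0 ≤ ‖n‖ ^ p := by positivity
    linarith
  have hpow : ‖z‖ ^ p = ‖z‖ ^ (p - 2) * ‖z‖ ^ 2 := by
    rw [← Real.rpow_two, ← Real.rpow_add hz]
    congr 1
    ring
  rw [real_inner_smul_left]
  -- For small n, ‖z + n‖^p is a power p/2 ≤ 1 of the square, and Bernoulli's inequality linearizes
  -- it. For large n, everything is of order ‖n‖^p: 4 for the left side and 2 for the inner product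
  -- give the constant 6.
  rcases le_total ‖n‖ ‖z‖ with hn | hn
  · set s := (2 * ⟪z, n⟫ + ‖n‖ ^ 2) / ‖z‖ ^ 2 with hs
    have h1 : ‖z + n‖ ^ 2 = ‖z‖ ^ 2 * (1 + s) := by
      rw [norm_add_sq_real, hs]
      field_simp
      ring
    have hs1 : -1 ≤ s := by
      have : 0 ≤ 1 + s := nonneg_of_mul_nonneg_right (h1 ▸ sq_nonneg _) (by positivity)
      linarith
    have h2 : ‖z + n‖ ^ p ≤ ‖z‖ ^ p * (1 + p / 2 * s) := by
      have h3 : ∀ v : H, ‖v‖ ^ p = (‖v‖ ^ 2) ^ (p / 2) := fun v => by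
        rw [← Real.rpow_two, ← Real.rpow_mul (norm_nonneg _)]
        congr 1
        ring
      rw [h3 (z + n), h1, Real.mul_rpow (by positivity) (by linarith), ← h3]
      gcongr
      exact rpow_one_add_le_one_add_mul_self hs1 (by linarith) (by linarith)
    have h4 : ‖z‖ ^ p * (1 + p / 2 * s) =
        ‖z‖ ^ p + p * ‖z‖ ^ (p - 2) * ⟪z, n⟫ + p / 2 * (‖z‖ ^ (p - 2) * ‖n‖ ^ 2) := by
      rw [hpow, hs]
      field_simp
      ring
    have h5 : ‖z‖ ^ (p - 2) * ‖n‖ ^ 2 ≤ ‖n‖ ^ p := by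
      rcases (norm_nonneg n).eq_or_lt with h0 | h0
      · rw [← h0]
        simp [hp0.ne']
      · calc ‖z‖ ^ (p - 2) * ‖n‖ ^ 2 ≤ ‖n‖ ^ (p - 2) * ‖n‖ ^ 2 := by
              exact mul_le_mul_of_nonneg_right
                (Real.rpow_le_rpow_of_nonpos h0 hn (by linarith)) (sq_nonneg _)
          _ = ‖n‖ ^ p := by
              rw [← Real.rpow_two, ← Real.rpow_add h0]
              congr 1
              ring
    have h6 : 0 ≤ ‖n‖ ^ p := by positivity
    nlinarith
  · have h1 : ‖z + n‖ ^ p ≤ 4 * ‖n‖ ^ p := by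
      calc ‖z + n‖ ^ p ≤ (2 * ‖n‖) ^ p :=
            Real.rpow_le_rpow (norm_nonneg _) ((norm_add_le z n).trans (by linarith)) hp0.le
        _ = 2 ^ p * ‖n‖ ^ p := Real.mul_rpow zero_le_two (norm_nonneg _)
        _ ≤ 2 ^ (2 : ℝ) * ‖n‖ ^ p := by gcongr; exact one_le_two
        _ = 4 * ‖n‖ ^ p := by norm_num
    have hn0 : 0 < ‖n‖ := hz.trans_le hn
    have h2 : ‖z‖ ^ (p - 2) * (‖z‖ * ‖n‖) ≤ ‖n‖ ^ p := by
      calc ‖z‖ ^ (p - 2) * (‖z‖ * ‖n‖) = ‖z‖ ^ (p - 1) * ‖n‖ := by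
            rw [← mul_assoc, show p - 1 = (p - 2) + 1 by ring, Real.rpow_add_one hz.ne']
        _ ≤ ‖n‖ ^ (p - 1) * ‖n‖ := by gcongr
        _ = ‖n‖ ^ p := by rw [← Real.rpow_add_one hn0.ne']; ring_nf
    have h3 : -(‖z‖ * ‖n‖) ≤ ⟪z, n⟫ := neg_le_of_abs_le (abs_real_inner_le_norm z n)
    have h4 : 0 ≤ ‖z‖ ^ (p - 2) := by positivity
    have h5 : -(2 * ‖n‖ ^ p) ≤ p * ‖z‖ ^ (p - 2) * ⟪z, n⟫ := by
      have h6 := mul_le_mul_of_nonneg_left h3 (mul_nonneg hp0.le h4)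
      have h7 : p * (‖z‖ ^ (p - 2) * (‖z‖ * ‖n‖)) ≤ 2 * ‖n‖ ^ p := by gcongr
      linarith
    have h8 : 0 ≤ ‖z‖ ^ p := by positivity
    linarith

theorem norm_sub_inner_normalize_nonneg (v g : H) : 0 ≤ ‖v‖ - ⟪v, ‖g‖⁻¹ • g⟫ := by
  have h1 := real_inner_le_norm v (‖g‖⁻¹ • g)
  have h2 : ‖‖g‖⁻¹ • g‖ ≤ 1 := by
    rw [norm_smul, norm_inv, norm_norm]
    exact inv_mul_le_one
  nlinarith [norm_nonneg v]

theorem norm_sub_inner_normalize_le_two_mul (v g : H) :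
    ‖v‖ - ⟪v, ‖g‖⁻¹ • g⟫ ≤ 2 * ‖v‖ := by
  have h1 := neg_le_of_abs_le (abs_real_inner_le_norm v (‖g‖⁻¹ • g))
  have h2 : ‖‖g‖⁻¹ • g‖ ≤ 1 := by
    rw [norm_smul, norm_inv, norm_norm]
    exact inv_mul_le_one
  nlinarith [norm_nonneg v]

/-- For v = g the difference is zero, as ⟪g, g/‖g‖⟫ = ‖g‖, and replacing v by g in each term costs
‖g - v‖. The case g = 0 is included, since there ‖g‖⁻¹ • g = 0. -/
theorem norm_sub_inner_normalize_le (v g : H) :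
    ‖v‖ - ⟪v, ‖g‖⁻¹ • g⟫ ≤ 2 * ‖g - v‖ := by
  have h1 : ‖‖g‖⁻¹ • g‖ ≤ 1 := by
    rw [norm_smul, norm_inv, norm_norm]
    exact inv_mul_le_one
  have h2 := real_inner_le_norm (g - v) (‖g‖⁻¹ • g)
  have h3 : ⟪g, ‖g‖⁻¹ • g⟫ = ‖g‖ := by
    rw [real_inner_smul_right, real_inner_self_eq_norm_sq]
    rcases eq_or_ne ‖g‖ 0 with h | h
    · simp [h]
    · field_simp
  rw [inner_sub_left, h3] at h2
  have h4 : ‖v‖ ≤ ‖g‖ + ‖g - v‖ := by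
    rw [norm_sub_rev]
    simpa using norm_add_le g (v - g)
  nlinarith [norm_nonneg (g - v)]

end Pointwise

/-- Either u ≤ b, or u/b ≥ 1 is at most its p-th power. This passes from a p-th moment to a mean
without Jensen's inequality. -/
theorem le_add_mul_rpow {p u b : ℝ} (hp : 1 ≤ p) (hu : 0 ≤ u) (hb : 0 < b) :
    u ≤ b + b * (u / b) ^ p := by
  have h0 : 0 ≤ (u / b) ^ p := by positivity
  rcases le_total u b with h | h
  · nlinarith
  · have h1 := Real.self_le_rpow_of_one_le ((one_le_div hb).2 h) hp
    have h2 : b * (u / b) = u := by field_simp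
    nlinarith

/-! ### Mean error of the mini-batch -/

section Batch

variable {Ξ Ω : Type*} [MeasurableSpace Ξ] [MeasurableSpace Ω] {P : Measure Ω}
  [IsProbabilityMeasure P] {D : Measure Ξ} [IsProbabilityMeasure D]

/-- By `norm_add_rpow_le` each new summand adds at most 6m to the mean p-th power of the partial
sum; the potential ‖z‖^p + (M-k)·6m records the summands still to come. -/
theorem lintegral_norm_sum_rpow_le {d : ℕ} {n : Ξ → E d} {p m : ℝ} (hn : Measurable n)
    (h : IsNoise D n p m) (hp : 1 < p) (hp2 : p ≤ 2) (hm : 0 ≤ m) {ξ : ℕ → Ω → Ξ}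
    (hξ : ∀ k, Measurable (ξ k)) (hD : ∀ k, P.map (ξ k) = D) (hind : iIndepFun ξ P) (M : ℕ) :
    ∫⁻ ω, ENNReal.ofReal (‖∑ i ∈ Finset.range M, n (ξ i ω)‖ ^ p) ∂P ≤
      ENNReal.ofReal (6 * M * m) := by
  set X : ℕ → Ω → E d := fun k ω => ∑ i ∈ Finset.range k, n (ξ i ω) with hX
  set V : ℕ → E d → ENNReal := fun k z => ENNReal.ofReal (‖z‖ ^ p + ((M : ℝ) - k) * (6 * m))
    with hV
  have hVm : ∀ k, Measurable (V k) := fun k =>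
    ((measurable_norm.pow_const p).add_const _).ennreal_ofReal
  have hstep : Measurable fun q : E d × Ξ => q.1 + n q.2 :=
    measurable_fst.add (hn.comp measurable_snd)
  have hXind : ∀ k, IndepFun (X k) (ξ k) P := by
    intro k
    refine indepFun_of_disjoint hξ hind (A := {i | i < k}) (B := {k}) (by simp) ?_
      (measurable_sigmaOf ξ rfl)
    exact Finset.measurable_fun_sum _ fun i hi =>
      hn.comp (measurable_sigmaOf ξ (Finset.mem_range.1 hi))
  have hchain := lintegral_chain_le (P := P) (X := X) (ξ := ξ)
    (step := fun _ q => q.1 + n q.2) (V := V)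
    (fun k => Finset.measurable_fun_sum _ fun i _ => hn.comp (hξ i)) hξ (fun _ => hstep) hVm hXind
    (fun k ω => Finset.sum_range_succ _ k) (n := M) (fun k hk z => by
      have hk' : (k : ℝ) + 1 ≤ M := by exact_mod_cast hk
      have h1 : ∫⁻ ω, V (k + 1) (z + n (ξ k ω)) ∂P = ∫⁻ v, V (k + 1) (z + n v) ∂D := by
        rw [← hD k]
        exact (lintegral_map (f := fun v => V (k + 1) (z + n v))
          ((hVm _).comp (hstep.comp measurable_prodMk_left)) (hξ k)).symm
      rw [h1]
      have h0 : 0 ≤ ((M : ℝ) - (k + 1)) * (6 * m) := mul_nonneg (by linarith) (by linarith)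
      refine (h.lintegral_le (F := fun v => ‖z + n v‖ ^ p + ((M : ℝ) - (k + 1 : ℕ)) * (6 * m))
        (a := ‖z‖ ^ p + ((M : ℝ) - (k + 1)) * (6 * m)) (b := 6) (d := (p * ‖z‖ ^ (p - 2)) • z)
        (by norm_num) (fun v => ?_) fun v => ?_).trans (le_of_eq ?_)
      · push_cast
        positivity
      · have := norm_add_rpow_le hp hp2 z (n v)
        push_cast
        linarith
      · simp only [hV]
        congr 1
        ring)
  have hM : ∀ ω, V M (X M ω) = ENNReal.ofReal (‖∑ i ∈ Finset.range M, n (ξ i ω)‖ ^ p) := by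
    intro ω
    simp [hV, hX]
  simp_rw [hM] at hchain
  refine hchain.trans (le_of_eq ?_)
  have : p ≠ 0 := by linarith
  simp only [hX, hV, Finset.range_zero, Finset.sum_empty, norm_zero, lintegral_const, measure_univ,
    mul_one, Real.zero_rpow this, Nat.cast_zero]
  congr 1
  ring

variable {dx dy : ℕ} {f : Z dx dy → ℝ} {G : Z dx dy → Ξ → Z dx dy} {σ p : ℝ}

/-- The condition on M says that the p-th moment of the error relative to b is at most 1, so
`le_add_mul_rpow` gives b + b. -/
theorem lintegral_batchGrad_sub_le (hG : PBCM f D G σ p) {ξ : ℕ → Ω → Ξ}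
    (hξ : ∀ k, Measurable (ξ k)) (hD : ∀ k, P.map (ξ k) = D) (hind : iIndepFun ξ P) {M : ℕ}
    (hM : 0 < M) {b : ℝ} (hb : 0 < b) (hMb : 6 * M * σ ^ p ≤ (M * b) ^ p) (x : E dx) (y : E dy) :
    ∫⁻ ω, ENNReal.ofReal ‖batchGrad G M (fun i => ξ i ω) x y - (gradient f (pt x y)).fst‖ ∂P ≤
      ENNReal.ofReal (2 * b) := by
  have hM' : (0 : ℝ) < M := Nat.cast_pos.2 hM
  have hp := hG.one_lt_p
  have hσ := hG.sigma_nonneg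
  set n : Ξ → E dx := fun v => (G (pt x y) v).fst - (gradient f (pt x y)).fst with hn
  have hnm : Measurable n := (continuous_fst.measurable.comp
    (hG.measurable.comp measurable_prodMk_left)).sub_const _
  have hsum := lintegral_norm_sum_rpow_le hnm (hG.isNoise_fst (pt x y)) hp hG.p_le_two
    (by positivity) hξ hD hind M
  have hpt : ∀ ω, ‖batchGrad G M (fun i => ξ i ω) x y - (gradient f (pt x y)).fst‖ ≤
      b + b * ((M * b) ^ p)⁻¹ * ‖∑ i ∈ Finset.range M, n (ξ i ω)‖ ^ p := by
    intro ω
    have h1 : batchGrad G M (fun i => ξ i ω) x y - (gradient f (pt x y)).fst =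
        (M : ℝ)⁻¹ • ∑ i ∈ Finset.range M, n (ξ i ω) := by
      simp only [hn, Finset.sum_sub_distrib, Finset.sum_const, Finset.card_range, smul_sub,
        batchGrad, ← Nat.cast_smul_eq_nsmul ℝ, smul_smul, inv_mul_cancel₀ hM'.ne', one_smul]
    rw [h1, norm_smul, norm_inv, Real.norm_of_nonneg hM'.le]
    have h2 := le_add_mul_rpow hp.le
      (show 0 ≤ (M : ℝ)⁻¹ * ‖∑ i ∈ Finset.range M, n (ξ i ω)‖ by positivity) hb
    refine h2.trans (le_of_eq ?_)
    rw [inv_mul_eq_div, div_div, Real.div_rpow (norm_nonneg _) (by positivity)]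
    ring
  have hbM : 0 ≤ b * ((M * b) ^ p)⁻¹ := by positivity
  calc _ ≤ ∫⁻ ω, (ENNReal.ofReal b + ENNReal.ofReal (b * ((M * b) ^ p)⁻¹) *
        ENNReal.ofReal (‖∑ i ∈ Finset.range M, n (ξ i ω)‖ ^ p)) ∂P := by
        refine lintegral_mono fun ω => (ENNReal.ofReal_le_ofReal (hpt ω)).trans ?_
        rw [← ENNReal.ofReal_mul hbM]
        exact ENNReal.ofReal_add_le
    _ = ENNReal.ofReal b + ENNReal.ofReal (b * ((M * b) ^ p)⁻¹) *
        ∫⁻ ω, ENNReal.ofReal (‖∑ i ∈ Finset.range M, n (ξ i ω)‖ ^ p) ∂P := by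
        rw [lintegral_add_left measurable_const, lintegral_const_mul' _ _ ENNReal.ofReal_ne_top]
        simp
    _ ≤ ENNReal.ofReal b + ENNReal.ofReal (b * ((M * b) ^ p)⁻¹) *
        ENNReal.ofReal (6 * M * σ ^ p) := by gcongr
    _ = ENNReal.ofReal (b + b * ((M * b) ^ p)⁻¹ * (6 * M * σ ^ p)) := by
        rw [← ENNReal.ofReal_mul hbM, ← ENNReal.ofReal_add hb.le (by positivity)]
    _ ≤ _ := by
        refine ENNReal.ofReal_le_ofReal ?_
        have h3 : ((M * b) ^ p)⁻¹ * (6 * M * σ ^ p) ≤ 1 := inv_mul_le_one_of_le₀ hMb (by positivity)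
        nlinarith

end Batch

end N2SGDA

/-! ### Exponential moment of the direction loss in one outer step -/

namespace N2SGDA

open scoped RealInnerProductSpace

/-- The call counter does not influence the iterates, so an inner loop may be analysed as a function
of the pair (x, y), with the counter reset to zero. -/
theorem innerLoop_y_congr {Ξ : Type*} {dx dy : ℕ} (G : Z dx dy → Ξ → Z dx dy) (η : ℝ) (τ : ℕ → ℝ)
    (ξ : ℕ → Ξ) {s s' : State dx dy} (hx : s.x = s'.x) (hy : s.y = s'.y) (k : ℕ) :
    (innerLoop G η τ ξ s k).y = (innerLoop G η τ ξ s' k).y := by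
  induction k with
  | zero => exact hy
  | succ k ih => simp only [innerLoop, innerStep, innerLoop_x, ih, hx]

section OuterDefs

variable {Ξ : Type*} {dx dy : ℕ}

/-- The result of the inner loop started at the pair `q`, as a function of the samples. -/
noncomputable def innerY (G : Z dx dy → Ξ → Z dx dy) (η : ℝ) (τ : ℕ → ℝ) (K : ℕ) (q : E dx × E dy)
    (w : ℕ ⊕ ℕ → Ξ) : E dy :=
  (innerLoop G η τ (fun k => w (Sum.inl k)) ⟨q.1, q.2, 0⟩ K).y

/-- The loss `‖∇Φ(x)‖ - ⟪∇Φ(x), g / ‖g‖⟫` of the direction of the estimator `g`. -/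
noncomputable def dirGap (f : Z dx dy → ℝ) (x g : E dx) : ℝ :=
  ‖gradient (Phi f) x‖ - ⟪gradient (Phi f) x, ‖g‖⁻¹ • g⟫

/-- The loss of one outer step, truncated at `c`, minus a bound on its conditional mean. -/
noncomputable def lossIncr (f : Z dx dy → ℝ) (ys : E dx → E dy) (G : Z dx dy → Ξ → Z dx dy)
    (M : ℕ) (b ℓ c : ℝ) (x : E dx) (y : E dy) (v : ℕ → Ξ) : ℝ :=
  min (dirGap f x (batchGrad G M v x y)) c - 4 * (2 * b + ℓ * ‖y - ys x‖)

end OuterDefs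

section OuterStep

variable {Ξ Ω : Type*} [MeasurableSpace Ξ] [MeasurableSpace Ω] {P : Measure Ω}
  [IsProbabilityMeasure P] {D : Measure Ξ} [IsProbabilityMeasure D] {dx dy : ℕ}
  {f : Z dx dy → ℝ} {G : Z dx dy → Ξ → Z dx dy} {ℓ μ σ p : ℝ}

theorem measurable_innerY {α : Type*} [MeasurableSpace α] (hG : Measurable (Function.uncurry G))
    (η : ℝ) (τ : ℕ → ℝ) (K : ℕ) {q : α → E dx × E dy} {w : α → ℕ ⊕ ℕ → Ξ} (hq : Measurable q)
    (hw : ∀ k, Measurable fun a => w a (Sum.inl k)) :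
    Measurable fun a => innerY G η τ K (q a) (w a) :=
  (measurable_innerLoop hG (s := fun a => (⟨(q a).1, (q a).2, 0⟩ : State dx dy))
    (measurable_fst.comp hq) (measurable_snd.comp hq) (fun i _ => hw i) η τ).2

theorem measurable_lossIncr {α : Type*} [MeasurableSpace α] (h : MinimaxAssumption f ℓ μ)
    (hdy : 0 < dy) (hG : Measurable (Function.uncurry G)) (M : ℕ) (b ℓ' c : ℝ) {x : α → E dx}
    {y : α → E dy} {v : α → ℕ → Ξ} (hx : Measurable x) (hy : Measurable y)
    (hv : ∀ i, Measurable fun a => v a i) :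
    Measurable fun a => lossIncr f h.argmax G M b ℓ' c (x a) (y a) (v a) := by
  have hg : Measurable fun a => batchGrad G M (v a) (x a) (y a) :=
    measurable_batchGrad (ξ := fun i a => v a i) hG hx hy hv M
  have hΦ : Measurable fun a => gradient (Phi f) (x a) :=
    (h.continuous_gradient_Phi hdy).measurable.comp hx
  have hys : Measurable fun a => h.argmax (x a) := (h.continuous_argmax hdy).measurable.comp hx
  have hgap : Measurable fun a => dirGap f (x a) (batchGrad G M (v a) (x a) (y a)) :=
    hΦ.norm.sub (hΦ.inner (hg.norm.inv.smul hg))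
  exact (hgap.min measurable_const).sub
    (measurable_const.mul (measurable_const.add (measurable_const.mul (hy.sub hys).norm)))

/-- The exponential moment of the loss for a fixed inner iterate. -/
theorem lintegral_exp_lossIncr_le (h : MinimaxAssumption f ℓ μ) (hdy : 0 < dy)
    (hG : PBCM f D G σ p) {ξ : ℕ → Ω → Ξ} (hξ : ∀ k, Measurable (ξ k))
    (hD : ∀ k, P.map (ξ k) = D) (hind : iIndepFun ξ P) {M : ℕ} (hM : 0 < M) {b : ℝ} (hb : 0 < b)
    (hMb : 6 * M * σ ^ p ≤ (M * b) ^ p) {c : ℝ} (hc : 0 < c) (x : E dx) (y : E dy) :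
    ∫⁻ ω, ENNReal.ofReal (Real.exp (c⁻¹ *
      lossIncr f h.argmax G M b ℓ c x y (fun i => ξ i ω))) ∂P ≤ 1 := by
  have hℓ := h.smooth_pos hdy
  set e := ‖y - h.argmax x‖ with he
  have he0 : 0 ≤ e := norm_nonneg _
  have hbatch := lintegral_batchGrad_sub_le hG hξ hD hind hM hb hMb x y
  set N : Ω → ℝ := fun ω => ‖batchGrad G M (fun i => ξ i ω) x y - (gradient f (pt x y)).fst‖ with hN
  set B := 4 * (2 * b + ℓ * e) with hB
  have hpt : ∀ ω, Real.exp (c⁻¹ * lossIncr f h.argmax G M b ℓ c x y (fun i => ξ i ω)) ≤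
      Real.exp (-(c⁻¹ * B)) * (1 + 4 * c⁻¹ * (ℓ * e)) +
        Real.exp (-(c⁻¹ * B)) * (4 * c⁻¹) * N ω := by
    intro ω
    set g := batchGrad G M (fun i => ξ i ω) x y with hg
    set u := c⁻¹ * min (dirGap f x g) c with hu
    have hu0 : 0 ≤ u := mul_nonneg (by positivity)
      (le_min (norm_sub_inner_normalize_nonneg _ _) hc.le)
    have hu1 : u ≤ 1 := by
      calc u ≤ c⁻¹ * c := by rw [hu]; gcongr; exact min_le_right _ _
        _ = 1 := inv_mul_cancel₀ hc.ne'
    have h1 : dirGap f x g ≤ 2 * (N ω + ℓ * e) := by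
      refine (norm_sub_inner_normalize_le _ _).trans ?_
      have h2 := norm_sub_le_norm_sub_add_norm_sub g (gradient f (pt x y)).fst (gradient (Phi f) x)
      have h3 := h.norm_fst_gradient_sub_le hdy x y
      have h4 : ‖g - (gradient f (pt x y)).fst‖ = N ω := rfl
      linarith
    have h5 : u ≤ c⁻¹ * (2 * (N ω + ℓ * e)) := by
      rw [hu]
      gcongr
      exact (min_le_left _ _).trans h1
    -- Valid since 0 ≤ u ≤ 1 by truncation. The factor 4 in `lossIncr` is this 2 times the 2 of
    -- `norm_sub_inner_normalize_le`.
    have h6 : Real.exp u ≤ 1 + 2 * u := by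
      have := exp_le_one_add_add_sq (u := u) (by rwa [abs_of_nonneg hu0])
      nlinarith
    have h7 : c⁻¹ * lossIncr f h.argmax G M b ℓ c x y (fun i => ξ i ω) = -(c⁻¹ * B) + u := by
      rw [lossIncr, hu, hB]
      ring
    rw [h7, Real.exp_add]
    calc Real.exp (-(c⁻¹ * B)) * Real.exp u
        ≤ Real.exp (-(c⁻¹ * B)) * (1 + 2 * (c⁻¹ * (2 * (N ω + ℓ * e)))) := by
          gcongr
          linarith
      _ = _ := by ring
  have hk : 0 ≤ Real.exp (-(c⁻¹ * B)) * (4 * c⁻¹) := by positivity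
  calc _ ≤ ∫⁻ ω, (ENNReal.ofReal (Real.exp (-(c⁻¹ * B)) * (1 + 4 * c⁻¹ * (ℓ * e))) +
        ENNReal.ofReal (Real.exp (-(c⁻¹ * B)) * (4 * c⁻¹)) * ENNReal.ofReal (N ω)) ∂P := by
        refine lintegral_mono fun ω => (ENNReal.ofReal_le_ofReal (hpt ω)).trans ?_
        rw [← ENNReal.ofReal_mul hk]
        exact ENNReal.ofReal_add_le
    _ = ENNReal.ofReal (Real.exp (-(c⁻¹ * B)) * (1 + 4 * c⁻¹ * (ℓ * e))) +
        ENNReal.ofReal (Real.exp (-(c⁻¹ * B)) * (4 * c⁻¹)) * ∫⁻ ω, ENNReal.ofReal (N ω) ∂P := by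
        rw [lintegral_add_left measurable_const, lintegral_const_mul' _ _ ENNReal.ofReal_ne_top]
        simp
    _ ≤ ENNReal.ofReal (Real.exp (-(c⁻¹ * B)) * (1 + 4 * c⁻¹ * (ℓ * e))) +
        ENNReal.ofReal (Real.exp (-(c⁻¹ * B)) * (4 * c⁻¹)) * ENNReal.ofReal (2 * b) := by gcongr
    _ = ENNReal.ofReal (Real.exp (-(c⁻¹ * B)) * (1 + c⁻¹ * B)) := by
        rw [← ENNReal.ofReal_mul hk, ← ENNReal.ofReal_add (by positivity) (by positivity), hB]
        congr 1
        ring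
    -- The centering in `lossIncr` is chosen so that exactly exp(-x)(1 + x) ≤ 1 remains, with x =
    -- c⁻¹B.
    _ ≤ 1 := by
        rw [ENNReal.ofReal_le_one]
        have h1 := Real.add_one_le_exp (c⁻¹ * B)
        calc Real.exp (-(c⁻¹ * B)) * (1 + c⁻¹ * B)
            ≤ Real.exp (-(c⁻¹ * B)) * Real.exp (c⁻¹ * B) := by gcongr; linarith
          _ = 1 := by rw [← Real.exp_add]; simp

end OuterStep

/-- A quantity built from the blocks before t is independent of the whole t-th block of samples. -/
theorem indepFun_block {Ξ Ω : Type*} [MeasurableSpace Ξ] [MeasurableSpace Ω] {P : Measure Ω}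
    {S : ℕ → ℕ ⊕ ℕ → Ω → Ξ} (hS : ∀ t i, Measurable (S t i))
    (hind : iIndepFun (fun j : ℕ × (ℕ ⊕ ℕ) => S j.1 j.2) P) {β : Type*} [MeasurableSpace β] {t : ℕ}
    {U : Ω → β} (hU : Measurable[sigmaOf (fun j : ℕ × (ℕ ⊕ ℕ) => S j.1 j.2) {j | j.1 < t}] U) :
    IndepFun U (fun ω i => S t i ω) P := by
  set B : Set (ℕ × (ℕ ⊕ ℕ)) := {j | j.1 = t} with hB
  have hi : ∀ i, (t, i) ∈ B := fun i => rfl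
  clear_value B
  have hV : Measurable[sigmaOf (fun j : ℕ × (ℕ ⊕ ℕ) => S j.1 j.2) B] fun ω i => S t i ω :=
    @measurable_pi_lambda _ _ _ (sigmaOf _ B) _ _ fun i =>
      measurable_sigmaOf (fun j : ℕ × (ℕ ⊕ ℕ) => S j.1 j.2) (j := (t, i)) (hi i)
  have hS' : ∀ j : ℕ × (ℕ ⊕ ℕ), Measurable (S j.1 j.2) := fun j => hS j.1 j.2
  refine indepFun_of_disjoint hS' hind ?_ hU hV
  rw [hB]
  rw [Set.disjoint_left]
  intro j hj hj'
  exact Nat.ne_of_lt hj hj'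

section Outer

variable {Ξ Ω : Type*} [MeasurableSpace Ξ] [MeasurableSpace Ω] {P : Measure Ω}
  [IsProbabilityMeasure P] {D : Measure Ξ} [IsProbabilityMeasure D] {dx dy : ℕ}
  {f : Z dx dy → ℝ} {G : Z dx dy → Ξ → Z dx dy} {ℓ μ σ p η R A b c ηx : ℝ} {K M : ℕ} {τ : ℕ → ℝ}
  {S : ℕ → ℕ ⊕ ℕ → Ω → Ξ}

/-- The exponential moment of the loss of one outer step, for a fixed initial state. -/
theorem lintegral_exp_lossIncr_innerY_le (h : MinimaxAssumption f ℓ μ) (hdy : 0 < dy)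
    (hG : PBCM f D G σ p) (hS : ∀ t i, Measurable (S t i)) (hD : ∀ t i, P.map (S t i) = D)
    (hind : iIndepFun (fun j : ℕ × (ℕ ⊕ ℕ) => S j.1 j.2) P) (hM : 0 < M) (hb : 0 < b)
    (hMb : 6 * M * σ ^ p ≤ (M * b) ^ p) (hc : 0 < c) (η : ℝ) (τ : ℕ → ℝ) (K t : ℕ)
    (q : E dx × E dy) :
    ∫⁻ ω, ENNReal.ofReal (Real.exp (c⁻¹ * lossIncr f h.argmax G M b ℓ c q.1
      (innerY G η τ K q fun i => S t i ω) fun i => S t (Sum.inr i) ω)) ∂P ≤ 1 := by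
  have hS' : ∀ j : ℕ × (ℕ ⊕ ℕ), Measurable (S j.1 j.2) := fun j => hS j.1 j.2
  set U : Ω → E dy := fun ω => innerY G η τ K q fun i => S t i ω with hU
  set V : Ω → ℕ → Ξ := fun ω i => S t (Sum.inr i) ω with hV
  -- Inner samples and batch samples of the same block are disjoint, so the inner iterate can be
  -- frozen while the batch is integrated out.
  set A : Set (ℕ × (ℕ ⊕ ℕ)) := {j | ∃ k, j = (t, Sum.inl k)}
  set B : Set (ℕ × (ℕ ⊕ ℕ)) := {j | ∃ k, j = (t, Sum.inr k)}
  have hUA : Measurable[sigmaOf (fun j : ℕ × (ℕ ⊕ ℕ) => S j.1 j.2) A] U :=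
    @measurable_innerY Ξ _ dx dy G Ω (sigmaOf _ A) hG.measurable η τ K (fun _ => q)
      (fun ω i => S t i ω) measurable_const fun k =>
        measurable_sigmaOf (fun j : ℕ × (ℕ ⊕ ℕ) => S j.1 j.2) (j := (t, Sum.inl k)) ⟨k, rfl⟩
  have hVB : Measurable[sigmaOf (fun j : ℕ × (ℕ ⊕ ℕ) => S j.1 j.2) B] V :=
    @measurable_pi_lambda _ _ _ (sigmaOf _ B) _ _ fun k =>
      measurable_sigmaOf (fun j : ℕ × (ℕ ⊕ ℕ) => S j.1 j.2) (j := (t, Sum.inr k)) ⟨k, rfl⟩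
  have hUV : IndepFun U V P := by
    refine indepFun_of_disjoint hS' hind (A := A) (B := B) ?_ hUA hVB
    rw [Set.disjoint_left]
    rintro j ⟨k, rfl⟩ ⟨i, hi⟩
    simp at hi
  have hF : Measurable fun r : E dy × (ℕ → Ξ) => ENNReal.ofReal (Real.exp (c⁻¹ *
      lossIncr f h.argmax G M b ℓ c q.1 r.1 r.2)) :=
    (Real.measurable_exp.comp ((measurable_lossIncr h hdy hG.measurable M b ℓ c measurable_const
      measurable_fst fun i => (measurable_pi_apply i).comp measurable_snd).const_mul _)).ennreal_ofReal
  rw [lintegral_indepFun (hUA.mono (sigmaOf_le hS' A) le_rfl) (hVB.mono (sigmaOf_le hS' B) le_rfl)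
    hUV hF]
  refine (lintegral_mono fun ω => ?_).trans (show ∫⁻ _, 1 ∂P ≤ 1 by simp)
  exact lintegral_exp_lossIncr_le h hdy hG (fun k => hS t _) (fun k => hD t _)
    (hind.precomp (g := fun k : ℕ => (t, Sum.inr k)) fun i j hij => by simpa using hij)
    hM hb hMb hc q.1 (U ω)

/-- The pair of iterates after `t` outer steps. -/
noncomputable def runPair (G : Z dx dy → Ξ → Z dx dy) (ηx η : ℝ) (τ : ℕ → ℝ) (K M : ℕ) (x₀ : E dx)
    (y₀ : E dy) (S : ℕ → ℕ ⊕ ℕ → Ξ) (t : ℕ) : E dx × E dy :=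
  ((run G ηx (fun _ => η) (fun _ => τ) K M x₀ y₀ S t).x,
    (run G ηx (fun _ => η) (fun _ => τ) K M x₀ y₀ S t).y)

/-- One outer step as a function of the pair of iterates and of the samples. -/
noncomputable def outerStep (G : Z dx dy → Ξ → Z dx dy) (ηx η : ℝ) (τ : ℕ → ℝ) (K M : ℕ)
    (q : E dx × E dy) (w : ℕ ⊕ ℕ → Ξ) : E dx × E dy :=
  (q.1 - ηx • (‖batchGrad G M (fun i => w (Sum.inr i)) q.1 (innerY G η τ K q w)‖⁻¹ •
    batchGrad G M (fun i => w (Sum.inr i)) q.1 (innerY G η τ K q w)), innerY G η τ K q w)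

theorem runPair_succ {Ξ : Type*} (G : Z dx dy → Ξ → Z dx dy) (ηx η : ℝ) (τ : ℕ → ℝ) (K M : ℕ)
    (x₀ : E dx) (y₀ : E dy) (S : ℕ → ℕ ⊕ ℕ → Ξ) (t : ℕ) :
    runPair G ηx η τ K M x₀ y₀ S (t + 1) =
      outerStep G ηx η τ K M (runPair G ηx η τ K M x₀ y₀ S t) (S t) := by
  have hy : (innerLoop G η τ (fun k => S t (Sum.inl k))
      (run G ηx (fun _ => η) (fun _ => τ) K M x₀ y₀ S t) K).y =
      innerY G η τ K (runPair G ηx η τ K M x₀ y₀ S t) (S t) :=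
    innerLoop_y_congr G η τ _ (s := run G ηx (fun _ => η) (fun _ => τ) K M x₀ y₀ S t)
      (s' := ⟨_, _, 0⟩) rfl rfl K
  simp only [runPair, outerStep, run, normalizedStep, innerLoop_x, Prod.mk.injEq]
  refine ⟨?_, hy⟩
  rw [hy]
  rfl

theorem measurable_runPair {α : Type*} [MeasurableSpace α] (hG : Measurable (Function.uncurry G))
    {S : ℕ → ℕ ⊕ ℕ → α → Ξ} {t : ℕ} (hS : ∀ s < t, ∀ i, Measurable (S s i)) (ηx η : ℝ)
    (τ : ℕ → ℝ) (K M : ℕ) (x₀ : E dx) (y₀ : E dy) :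
    Measurable fun a => runPair G ηx η τ K M x₀ y₀ (fun s i => S s i a) t :=
  have h := measurable_run hG hS ηx (fun _ => η) (fun _ => τ) K M x₀ y₀
  h.1.prodMk h.2

theorem measurable_outerStep (hG : Measurable (Function.uncurry G)) (ηx η : ℝ) (τ : ℕ → ℝ)
    (K M : ℕ) :
    Measurable fun r : (E dx × E dy) × (ℕ ⊕ ℕ → Ξ) => outerStep G ηx η τ K M r.1 r.2 := by
  have hy : Measurable fun r : (E dx × E dy) × (ℕ ⊕ ℕ → Ξ) => innerY G η τ K r.1 r.2 :=
    measurable_innerY hG η τ K measurable_fst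
      fun k => (measurable_pi_apply (Sum.inl k)).comp measurable_snd
  have hx : Measurable fun r : (E dx × E dy) × (ℕ ⊕ ℕ → Ξ) => r.1.1 :=
    measurable_fst.comp measurable_fst
  have hg := measurable_batchGrad (ξ := fun i (r : (E dx × E dy) × (ℕ ⊕ ℕ → Ξ)) => r.2 (Sum.inr i))
    hG hx hy (fun i => (measurable_pi_apply (Sum.inr i)).comp measurable_snd) M
  exact (hx.sub (measurable_const.fun_smul (hg.norm.inv.smul hg))).prodMk hy

end Outer

end N2SGDA

namespace N2SGDA

open scoped RealInnerProductSpace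

/-! ### Deterministic estimates along a trajectory -/

section Path

variable {Ξ : Type*} {dx dy : ℕ} {f : Z dx dy → ℝ} {G : Z dx dy → Ξ → Z dx dy}
  {ℓ μ η ηx : ℝ} {τ : ℕ → ℝ} {K M : ℕ} {x₀ : E dx} {y₀ : E dy}

theorem norm_outerStep_fst_sub_le (hηx : 0 ≤ ηx) (q : E dx × E dy) (w : ℕ ⊕ ℕ → Ξ) :
    ‖(outerStep G ηx η τ K M q w).1 - q.1‖ ≤ ηx := by
  have h : ∀ g : E dx, ‖q.1 - ηx • (‖g‖⁻¹ • g) - q.1‖ ≤ ηx := fun g => by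
    rw [show q.1 - ηx • (‖g‖⁻¹ • g) - q.1 = -(ηx • (‖g‖⁻¹ • g)) by abel, norm_neg, norm_smul,
      norm_smul, norm_inv, norm_norm, Real.norm_of_nonneg hηx]
    exact mul_le_of_le_one_right hηx inv_mul_le_one
  exact h _

/-- The sampled loss in the `t`-th outer step. -/
noncomputable def pathGap (f : Z dx dy → ℝ) (G : Z dx dy → Ξ → Z dx dy) (ηx η : ℝ) (τ : ℕ → ℝ)
    (K M : ℕ) (x₀ : E dx) (y₀ : E dy) (S : ℕ → ℕ ⊕ ℕ → Ξ) (t : ℕ) : ℝ :=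
  dirGap f (runPair G ηx η τ K M x₀ y₀ S t).1 (batchGrad G M (fun i => S t (Sum.inr i))
    (runPair G ηx η τ K M x₀ y₀ S t).1 (innerY G η τ K (runPair G ηx η τ K M x₀ y₀ S t) (S t)))

/-- Normalization limits every step to length η_x, whatever the noise. This sure bound shows that
the truncation level in `lossIncr` is never reached with effect. -/
theorem norm_gradient_runPair_le (h : MinimaxAssumption f ℓ μ) (hdy : 0 < dy) (hηx : 0 ≤ ηx)
    (S : ℕ → ℕ ⊕ ℕ → Ξ) (t : ℕ) :
    ‖gradient (Phi f) (runPair G ηx η τ K M x₀ y₀ S t).1‖ ≤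
      ‖gradient (Phi f) x₀‖ + (ℓ / μ + 1) * ℓ * ηx * t := by
  have := h.mu_pos
  have := h.smooth_pos hdy
  induction t with
  | zero => simp [runPair, run]
  | succ t ih =>
    set q := runPair G ηx η τ K M x₀ y₀ S t
    have h1 := h.gradient_Phi_lipschitz hdy (outerStep G ηx η τ K M q (S t)).1 q.1
    have h2 := norm_outerStep_fst_sub_le (G := G) (η := η) (τ := τ) (K := K) (M := M) hηx q (S t)
    rw [runPair_succ]
    have h3 := norm_le_norm_sub_add (gradient (Phi f) (outerStep G ηx η τ K M q (S t)).1)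
      (gradient (Phi f) q.1)
    have h4 : (ℓ / μ + 1) * ℓ * ‖(outerStep G ηx η τ K M q (S t)).1 - q.1‖ ≤
      (ℓ / μ + 1) * ℓ * ηx := by gcongr
    push_cast
    linarith

/-- Descent lemma for Φ with constant L: the inner product with the normalized step is the gradient
norm minus `pathGap`. Summation telescopes Φ, and the result is divided by η_x. -/
theorem sum_norm_gradient_le (h : MinimaxAssumption f ℓ μ) (hdy : 0 < dy) (hηx : 0 < ηx)
    (S : ℕ → ℕ ⊕ ℕ → Ξ) (T : ℕ) :
    ∑ t ∈ Finset.range T, ‖gradient (Phi f) (runPair G ηx η τ K M x₀ y₀ S t).1‖ ≤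
      gap f x₀ / ηx + T * ((ℓ / μ + 1) * ℓ * ηx / 2) +
        ∑ t ∈ Finset.range T, pathGap f G ηx η τ K M x₀ y₀ S t := by
  have hμ := h.mu_pos
  have hℓ := h.smooth_pos hdy
  set L := (ℓ / μ + 1) * ℓ with hL
  have hL0 : 0 < L := by positivity
  set X := fun t => (runPair G ηx η τ K M x₀ y₀ S t).1 with hX
  have hstep : ∀ t, Phi f (X (t + 1)) ≤ Phi f (X t) - ηx * ‖gradient (Phi f) (X t)‖ +
      ηx * pathGap f G ηx η τ K M x₀ y₀ S t + L / 2 * ηx ^ 2 := by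
    intro t
    have h1 := descent_upper (h.differentiable_Phi hdy) (h.gradient_Phi_lipschitz hdy) (X t)
      (X (t + 1))
    have h2 : ‖X (t + 1) - X t‖ ≤ ηx := by
      simp only [hX, runPair_succ]
      exact norm_outerStep_fst_sub_le hηx.le _ _
    have h3 : ⟪gradient (Phi f) (X t), X (t + 1) - X t⟫ =
        ηx * pathGap f G ηx η τ K M x₀ y₀ S t - ηx * ‖gradient (Phi f) (X t)‖ := by
      simp only [hX, runPair_succ, pathGap, dirGap, outerStep]
      rw [sub_sub_cancel_left, inner_neg_right, real_inner_smul_right]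
      ring
    have h4 : L / 2 * ‖X (t + 1) - X t‖ ^ 2 ≤ L / 2 * ηx ^ 2 := by gcongr
    linarith
  have hsum : ∀ n, Phi f (X n) + ηx * ∑ t ∈ Finset.range n, ‖gradient (Phi f) (X t)‖ ≤
      Phi f x₀ + ηx * ∑ t ∈ Finset.range n, pathGap f G ηx η τ K M x₀ y₀ S t +
        n * (L / 2 * ηx ^ 2) := by
    intro n
    induction n with
    | zero => simp [hX, runPair, run]
    | succ n ih =>
      rw [Finset.sum_range_succ, Finset.sum_range_succ]
      have := hstep n
      push_cast
      linarith
  have h1 := hsum T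
  have h2 : ⨅ x, Phi f x ≤ Phi f (X T) := ciInf_le h.lowerBounded _
  have h3 : ηx * ∑ t ∈ Finset.range T, ‖gradient (Phi f) (X t)‖ ≤ ηx * (gap f x₀ / ηx +
      T * (L * ηx / 2) + ∑ t ∈ Finset.range T, pathGap f G ηx η τ K M x₀ y₀ S t) := by
    have h4 : ηx * (gap f x₀ / ηx) = gap f x₀ := by field_simp
    have h5 : gap f x₀ = Phi f x₀ - ⨅ x, Phi f x := rfl
    rw [mul_add, mul_add, h4, h5]
    linarith
  exact le_of_mul_le_mul_left h3 hηx

end Path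

/-! ### The two kinds of exceptional events -/

section Probability

variable {Ξ Ω : Type*} [MeasurableSpace Ξ] [MeasurableSpace Ω] {P : Measure Ω}
  [IsProbabilityMeasure P] {D : Measure Ξ} [IsProbabilityMeasure D] {dx dy : ℕ}
  {f : Z dx dy → ℝ} {G : Z dx dy → Ξ → Z dx dy} {ℓ μ σ p η R A b c ηx : ℝ} {K M : ℕ} {τ : ℕ → ℝ}
  {S : ℕ → ℕ ⊕ ℕ → Ω → Ξ} {x₀ : E dx} {y₀ : E dy}

/-- Given the state before the block, this is `measure_innerLoop_le`. A good start is part of the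
event, so success of the earlier loops need not be conditioned on. -/
theorem measure_innerY_bad_le (h : MinimaxAssumption f ℓ μ) (hdy : 0 < dy) (hG : PBCM f D G σ p)
    (hS : ∀ t i, Measurable (S t i)) (hD : ∀ t i, P.map (S t i) = D)
    (hind : iIndepFun (fun j : ℕ × (ℕ ⊕ ℕ) => S j.1 j.2) P)
    (hq : InnerParams ℓ μ σ p η R A K τ) (t : ℕ) :
    P {ω | ‖(runPair G ηx η τ K M x₀ y₀ (fun s i => S s i ω) t).2 -
        h.argmax (runPair G ηx η τ K M x₀ y₀ (fun s i => S s i ω) t).1‖ ≤ R ∧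
      2 * Real.exp (-(η * μ * K)) * R ^ 2 ≤
        ‖innerY G η τ K (runPair G ηx η τ K M x₀ y₀ (fun s i => S s i ω) t) (fun i => S t i ω) -
          h.argmax (runPair G ηx η τ K M x₀ y₀ (fun s i => S s i ω) t).1‖ ^ 2} ≤
      ENNReal.ofReal (Real.exp (-A)) := by
  set X : Ω → E dx × E dy := fun ω => runPair G ηx η τ K M x₀ y₀ (fun s i => S s i ω) t with hX
  set W : Ω → ℕ ⊕ ℕ → Ξ := fun ω i => S t i ω with hW
  set B : Set ((E dx × E dy) × (ℕ ⊕ ℕ → Ξ)) := {r | ‖r.1.2 - h.argmax r.1.1‖ ≤ R ∧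
    2 * Real.exp (-(η * μ * K)) * R ^ 2 ≤ ‖innerY G η τ K r.1 r.2 - h.argmax r.1.1‖ ^ 2} with hB
  have hys : Measurable fun r : (E dx × E dy) × (ℕ ⊕ ℕ → Ξ) => h.argmax r.1.1 :=
    (h.continuous_argmax hdy).measurable.comp (measurable_fst.comp measurable_fst)
  have hBm : MeasurableSet B := by
    refine (measurableSet_le ((measurable_snd.comp measurable_fst).sub hys).norm
      measurable_const).inter (measurableSet_le measurable_const (((?_ : Measurable _).sub
        hys).norm.pow_const 2))
    exact measurable_innerY hG.measurable η τ K measurable_fst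
      fun k => (measurable_pi_apply (Sum.inl k)).comp measurable_snd
  have hXm : Measurable X := measurable_runPair hG.measurable (fun s _ => hS s) ηx η τ K M x₀ y₀
  have hWm : Measurable W := measurable_pi_lambda _ fun i => hS t i
  have hXW : IndepFun X W P := indepFun_block hS hind
    (@measurable_runPair Ξ _ dx dy G Ω (sigmaOf _ _) hG.measurable S t (fun s hs i =>
      measurable_sigmaOf (fun j : ℕ × (ℕ ⊕ ℕ) => S j.1 j.2) (j := (s, i)) hs) ηx η τ K M x₀ y₀)
  have hB1 : ∀ {F : Ω → (E dx × E dy) × (ℕ ⊕ ℕ → Ξ)}, Measurable F →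
      ∫⁻ ω, B.indicator 1 (F ω) ∂P = P {ω | F ω ∈ B} :=
    fun {F} hF => lintegral_indicator_one (hF hBm)
  have h1 : ∀ ω, ∫⁻ ω', B.indicator 1 (X ω, W ω') ∂P ≤ ENNReal.ofReal (Real.exp (-A)) := by
    intro ω
    by_cases hr : ‖(X ω).2 - h.argmax (X ω).1‖ ≤ R
    · have h2 := measure_innerLoop_le h hG hdy hq (ξ := fun k => S t (Sum.inl k))
        (fun k => hS t _) (fun k => hD t _)
        (hind.precomp (g := fun k : ℕ => (t, Sum.inl k)) fun i j hij => by simpa using hij)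
        ⟨(X ω).1, (X ω).2, 0⟩ hr
      refine (hB1 (measurable_const.prodMk hWm)).trans_le
        ((measure_mono fun ω' hω' => ?_).trans h2)
      exact hω'.2
    · refine (lintegral_mono (g := 0) fun ω' => ?_).trans (by simp)
      have : (X ω, W ω') ∉ B := fun hm => hr hm.1
      simp [this]
  calc P {ω | (X ω, W ω) ∈ B} = ∫⁻ ω, B.indicator 1 (X ω, W ω) ∂P := (hB1 (hXm.prodMk hWm)).symm
    _ = ∫⁻ ω, ∫⁻ ω', B.indicator 1 (X ω, W ω') ∂P ∂P :=
        lintegral_indepFun hXm hWm hXW (measurable_one.indicator hBm)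
    _ ≤ ∫⁻ _, ENNReal.ofReal (Real.exp (-A)) ∂P := lintegral_mono h1
    _ = _ := by simp

/-- The sum of `lossIncr` over the first `t` outer steps. -/
noncomputable def accLoss (f : Z dx dy → ℝ) (ys : E dx → E dy) (G : Z dx dy → Ξ → Z dx dy)
    (b ℓ c ηx η : ℝ) (τ : ℕ → ℝ) (K M : ℕ) (x₀ : E dx) (y₀ : E dy) (S : ℕ → ℕ ⊕ ℕ → Ξ) (t : ℕ) : ℝ :=
  ∑ s ∈ Finset.range t, lossIncr f ys G M b ℓ c (runPair G ηx η τ K M x₀ y₀ S s).1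
    (innerY G η τ K (runPair G ηx η τ K M x₀ y₀ S s) (S s)) fun i => S s (Sum.inr i)

theorem measurable_accLoss {α : Type*} [MeasurableSpace α] (h : MinimaxAssumption f ℓ μ)
    (hdy : 0 < dy) (hG : Measurable (Function.uncurry G)) {S : ℕ → ℕ ⊕ ℕ → α → Ξ} {t : ℕ}
    (hS : ∀ s < t, ∀ i, Measurable (S s i)) (b ℓ' c ηx η : ℝ) (τ : ℕ → ℝ) (K M : ℕ)
    (x₀ : E dx) (y₀ : E dy) :
    Measurable fun a =>
      accLoss f h.argmax G b ℓ' c ηx η τ K M x₀ y₀ (fun s i => S s i a) t := by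
  refine Finset.measurable_fun_sum _ fun s hs => ?_
  have hs' := Finset.mem_range.1 hs
  have hX := measurable_runPair hG (fun r hr => hS r (hr.trans hs')) ηx η τ K M x₀ y₀
  exact measurable_lossIncr h hdy hG M b ℓ' c (v := fun a i => S s (Sum.inr i) a)
    (measurable_fst.comp hX) (measurable_innerY hG η τ K hX fun k => hS s hs' (Sum.inl k))
    fun i => hS s hs' (Sum.inr i)

theorem measurable_runPair_accLoss {α : Type*} [MeasurableSpace α] (h : MinimaxAssumption f ℓ μ)
    (hdy : 0 < dy) (hG : Measurable (Function.uncurry G)) {S : ℕ → ℕ ⊕ ℕ → α → Ξ} {t : ℕ}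
    (hS : ∀ s < t, ∀ i, Measurable (S s i)) (b ℓ' c ηx η : ℝ) (τ : ℕ → ℝ) (K M : ℕ)
    (x₀ : E dx) (y₀ : E dy) :
    Measurable fun a => (runPair G ηx η τ K M x₀ y₀ (fun s i => S s i a) t,
      accLoss f h.argmax G b ℓ' c ηx η τ K M x₀ y₀ (fun s i => S s i a) t) :=
  (measurable_runPair hG hS ηx η τ K M x₀ y₀).prodMk
    (measurable_accLoss h hdy hG hS b ℓ' c ηx η τ K M x₀ y₀)

/-- One outer step together with the accumulated loss. -/
noncomputable def outerStepAcc (f : Z dx dy → ℝ) (ys : E dx → E dy) (G : Z dx dy → Ξ → Z dx dy)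
    (M : ℕ) (b ℓ c ηx η : ℝ) (τ : ℕ → ℝ) (K : ℕ) (r : ((E dx × E dy) × ℝ) × (ℕ ⊕ ℕ → Ξ)) :
    (E dx × E dy) × ℝ :=
  (outerStep G ηx η τ K M r.1.1 r.2, r.1.2 + lossIncr f ys G M b ℓ c r.1.1.1
    (innerY G η τ K r.1.1 r.2) fun i => r.2 (Sum.inr i))

theorem measurable_outerStepAcc (h : MinimaxAssumption f ℓ μ) (hdy : 0 < dy)
    (hG : Measurable (Function.uncurry G)) (M : ℕ) (b ℓ' c ηx η : ℝ) (τ : ℕ → ℝ) (K : ℕ) :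
    Measurable (outerStepAcc f h.argmax G M b ℓ' c ηx η τ K) := by
  have hq : Measurable fun r : ((E dx × E dy) × ℝ) × (ℕ ⊕ ℕ → Ξ) => r.1.1 :=
    measurable_fst.comp measurable_fst
  have hx : Measurable fun r : ((E dx × E dy) × ℝ) × (ℕ ⊕ ℕ → Ξ) => r.1.1.1 :=
    measurable_fst.comp hq
  have hw : ∀ i, Measurable fun r : ((E dx × E dy) × ℝ) × (ℕ ⊕ ℕ → Ξ) => r.2 i :=
    fun i => (measurable_pi_apply i).comp measurable_snd
  have hy : Measurable fun r : ((E dx × E dy) × ℝ) × (ℕ ⊕ ℕ → Ξ) => innerY G η τ K r.1.1 r.2 :=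
    measurable_innerY hG η τ K hq fun k => hw (Sum.inl k)
  have hl : Measurable fun r : ((E dx × E dy) × ℝ) × (ℕ ⊕ ℕ → Ξ) =>
      lossIncr f h.argmax G M b ℓ' c r.1.1.1 (innerY G η τ K r.1.1 r.2) fun i => r.2 (Sum.inr i) :=
    measurable_lossIncr h hdy hG M b ℓ' c
      (v := fun (r : ((E dx × E dy) × ℝ) × (ℕ ⊕ ℕ → Ξ)) i => r.2 (Sum.inr i)) hx hy
      fun i => hw (Sum.inr i)
  have hs : Measurable fun r : ((E dx × E dy) × ℝ) × (ℕ ⊕ ℕ → Ξ) =>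
      outerStep G ηx η τ K M r.1.1 r.2 :=
    (measurable_outerStep hG ηx η τ K M).comp (hq.prodMk measurable_snd)
  have ha : Measurable fun r : ((E dx × E dy) × ℝ) × (ℕ ⊕ ℕ → Ξ) => r.1.2 :=
    measurable_snd.comp measurable_fst
  exact hs.prodMk (ha.add hl)

/-- The exponential of c⁻¹ times the accumulated loss is a supermartingale starting at 1, and
Markov's inequality applies. The accumulated loss is carried in the state to keep the process a
Markov chain. -/
theorem measure_accLoss_bad_le (h : MinimaxAssumption f ℓ μ) (hdy : 0 < dy) (hG : PBCM f D G σ p)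
    (hS : ∀ t i, Measurable (S t i)) (hD : ∀ t i, P.map (S t i) = D)
    (hind : iIndepFun (fun j : ℕ × (ℕ ⊕ ℕ) => S j.1 j.2) P) (hM : 0 < M) (hb : 0 < b)
    (hMb : 6 * M * σ ^ p ≤ (M * b) ^ p) (hc : 0 < c) (ηx η : ℝ) (τ : ℕ → ℝ) (K T : ℕ)
    (x₀ : E dx) (y₀ : E dy) (B : ℝ) :
    P {ω | B ≤ c⁻¹ * accLoss f h.argmax G b ℓ c ηx η τ K M x₀ y₀ (fun s i => S s i ω) T} ≤
      ENNReal.ofReal (Real.exp (-B)) := by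
  set X : ℕ → Ω → (E dx × E dy) × ℝ := fun t ω =>
    (runPair G ηx η τ K M x₀ y₀ (fun s i => S s i ω) t,
      accLoss f h.argmax G b ℓ c ηx η τ K M x₀ y₀ (fun s i => S s i ω) t) with hX
  set W : ℕ → Ω → ℕ ⊕ ℕ → Ξ := fun t ω i => S t i ω with hW
  set step : ((E dx × E dy) × ℝ) × (ℕ ⊕ ℕ → Ξ) → (E dx × E dy) × ℝ :=
    outerStepAcc f h.argmax G M b ℓ c ηx η τ K with hstep
  set V : (E dx × E dy) × ℝ → ENNReal := fun r => ENNReal.ofReal (Real.exp (c⁻¹ * r.2)) with hV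
  have hXm : ∀ t, Measurable (X t) := fun t =>
    measurable_runPair_accLoss h hdy hG.measurable (fun s _ => hS s) b ℓ c ηx η τ K M x₀ y₀
  have hWm : ∀ t, Measurable (W t) := fun t => measurable_pi_lambda _ fun i => hS t i
  have hVm : Measurable V :=
    (Real.measurable_exp.comp (measurable_snd.const_mul c⁻¹)).ennreal_ofReal
  have hstepm : Measurable step := measurable_outerStepAcc h hdy hG.measurable M b ℓ c ηx η τ K
  have hXW : ∀ t, IndepFun (X t) (W t) P := fun t => by
    have hm : ∀ s < t, ∀ i,
        Measurable[sigmaOf (fun j : ℕ × (ℕ ⊕ ℕ) => S j.1 j.2) {j | j.1 < t}] (S s i) :=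
      fun s hs i => measurable_sigmaOf (fun j : ℕ × (ℕ ⊕ ℕ) => S j.1 j.2) (j := (s, i)) hs
    exact indepFun_block hS hind (@measurable_runPair_accLoss Ξ _ dx dy f G ℓ μ Ω
      (sigmaOf (fun j : ℕ × (ℕ ⊕ ℕ) => S j.1 j.2) {j | j.1 < t}) h hdy hG.measurable S t hm
        b ℓ c ηx η τ K M x₀ y₀)
  have hchain := lintegral_chain_le (P := P) (X := X) (ξ := W) (step := fun _ => step)
    (V := fun _ => V) hXm hWm (fun _ => hstepm) (fun _ => hVm) hXW
    (fun t ω => by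
      simp only [hX, hstep, hW, outerStepAcc, runPair_succ, accLoss, Finset.sum_range_succ]) (n := T)
    (fun t _ r => by
      have h1 := lintegral_exp_lossIncr_innerY_le h hdy hG hS hD hind hM hb hMb hc η τ K t r.1
      calc ∫⁻ ω, V (step (r, W t ω)) ∂P = ∫⁻ ω, V r * ENNReal.ofReal (Real.exp (c⁻¹ *
            lossIncr f h.argmax G M b ℓ c r.1.1 (innerY G η τ K r.1 fun i => S t i ω)
              fun i => S t (Sum.inr i) ω)) ∂P := by
            refine lintegral_congr fun ω => ?_
            simp only [hV, hstep, hW, outerStepAcc]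
            rw [← ENNReal.ofReal_mul (Real.exp_pos _).le, ← Real.exp_add, mul_add]
        _ = V r * _ := lintegral_const_mul' _ _ ENNReal.ofReal_ne_top
        _ ≤ V r * 1 := by gcongr
        _ = V r := mul_one _)
  have hV0 : ∀ ω, V (X 0 ω) = 1 := fun ω => by simp [hV, hX, accLoss]
  simp_rw [hV0] at hchain
  have hBpos : ENNReal.ofReal (Real.exp B) ≠ 0 := by simp [Real.exp_pos]
  calc P {ω | B ≤ c⁻¹ * accLoss f h.argmax G b ℓ c ηx η τ K M x₀ y₀ (fun s i => S s i ω) T}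
      ≤ P {ω | ENNReal.ofReal (Real.exp B) ≤ V (X T ω)} :=
        measure_mono fun ω hω => ENNReal.ofReal_le_ofReal (Real.exp_le_exp.2 hω)
    _ ≤ (∫⁻ ω, V (X T ω) ∂P) / ENNReal.ofReal (Real.exp B) :=
        meas_ge_le_lintegral_div (hVm.comp (hXm T)).aemeasurable hBpos ENNReal.ofReal_ne_top
    _ ≤ 1 / ENNReal.ofReal (Real.exp B) := by
        gcongr
        simpa using hchain
    _ = _ := by
        rw [Real.exp_neg, ENNReal.ofReal_inv_of_pos (Real.exp_pos B), one_div]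

end Probability

end N2SGDA

namespace N2SGDA

open scoped RealInnerProductSpace

/-! ### Combination of the events for abstract parameters -/

section

variable {Ξ : Type*} {dx dy : ℕ} {f : Z dx dy → ℝ} {G : Z dx dy → Ξ → Z dx dy}
  {ℓ μ η ηx R b c es B Q : ℝ} {τ : ℕ → ℝ} {K M T : ℕ} {x₀ : E dx} {y₀ : E dy}

/-- While the inner loops succeed, the inner iterates stay close to the maximizers. -/
theorem norm_innerY_sub_le (h : MinimaxAssumption f ℓ μ) (hdy : 0 < dy) (hηx : 0 ≤ ηx)
    (hes : 0 ≤ es) (hQ : Q ≤ es ^ 2) (hR : es + ℓ / μ * ηx ≤ R) (h0 : ‖y₀ - h.argmax x₀‖ ≤ R)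
    {S : ℕ → ℕ ⊕ ℕ → Ξ}
    (hgood : ∀ t < T, ‖(runPair G ηx η τ K M x₀ y₀ S t).2 -
        h.argmax (runPair G ηx η τ K M x₀ y₀ S t).1‖ ≤ R →
      ‖innerY G η τ K (runPair G ηx η τ K M x₀ y₀ S t) (S t) -
        h.argmax (runPair G ηx η τ K M x₀ y₀ S t).1‖ ^ 2 ≤ Q) :
    ∀ t < T, ‖innerY G η τ K (runPair G ηx η τ K M x₀ y₀ S t) (S t) -
      h.argmax (runPair G ηx η τ K M x₀ y₀ S t).1‖ ≤ es := by
  have hμ := h.mu_pos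
  have hℓ := h.smooth_pos hdy
  set X := runPair G ηx η τ K M x₀ y₀ S with hX
  have hnext : ∀ t < T, ‖(X t).2 - h.argmax (X t).1‖ ≤ R →
      ‖innerY G η τ K (X t) (S t) - h.argmax (X t).1‖ ≤ es := fun t ht hr =>
    (abs_le_of_sq_le_sq' ((hgood t ht hr).trans hQ) hes).2
  have hdist : ∀ t < T, ‖(X t).2 - h.argmax (X t).1‖ ≤ R := by
    intro t
    induction t with
    | zero => exact fun _ => h0
    | succ t ih =>
      intro ht
      have h1 := hnext t (by omega) (ih (by omega))
      have h2 : X (t + 1) = outerStep G ηx η τ K M (X t) (S t) := runPair_succ ..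
      have h3 : (X (t + 1)).2 = innerY G η τ K (X t) (S t) := by rw [h2]; rfl
      have h4 : ‖(X (t + 1)).1 - (X t).1‖ ≤ ηx := by
        rw [h2]
        exact norm_outerStep_fst_sub_le hηx _ _
      have h5 := h.argmax_lipschitz hdy (X t).1 (X (t + 1)).1
      rw [norm_sub_rev (X t).1] at h5
      have h6 : ℓ / μ * ‖(X (t + 1)).1 - (X t).1‖ ≤ ℓ / μ * ηx := by gcongr
      rw [h3]
      have h7 := norm_sub_le_norm_sub_add_norm_sub (innerY G η τ K (X t) (S t))
        (h.argmax (X t).1) (h.argmax (X (t + 1)).1)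
      linarith
  exact fun t ht => hnext t ht (hdist t ht)

/-- The choice of c makes the truncation inactive, so the loss is recovered from `lossIncr` by
adding back its centering, in which the inner error is at most es. -/
theorem sum_pathGap_le (h : MinimaxAssumption f ℓ μ) (hdy : 0 < dy) (hηx : 0 ≤ ηx) (hc : 0 < c)
    (hcG : 2 * (‖gradient (Phi f) x₀‖ + (ℓ / μ + 1) * ℓ * ηx * T) ≤ c) {S : ℕ → ℕ ⊕ ℕ → Ξ}
    (hacc : c⁻¹ * accLoss f h.argmax G b ℓ c ηx η τ K M x₀ y₀ S T ≤ B)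
    (hin : ∀ t < T, ‖innerY G η τ K (runPair G ηx η τ K M x₀ y₀ S t) (S t) -
      h.argmax (runPair G ηx η τ K M x₀ y₀ S t).1‖ ≤ es) :
    ∑ t ∈ Finset.range T, pathGap f G ηx η τ K M x₀ y₀ S t ≤
      c * B + T * (4 * (2 * b + ℓ * es)) := by
  have hμ := h.mu_pos
  have hℓ := h.smooth_pos hdy
  have h1 : ∀ t ∈ Finset.range T, pathGap f G ηx η τ K M x₀ y₀ S t ≤
      lossIncr f h.argmax G M b ℓ c (runPair G ηx η τ K M x₀ y₀ S t).1
        (innerY G η τ K (runPair G ηx η τ K M x₀ y₀ S t) (S t)) (fun i => S t (Sum.inr i)) +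
      4 * (2 * b + ℓ * es) := by
    intro t ht
    have ht' := Finset.mem_range.1 ht
    have h2 : pathGap f G ηx η τ K M x₀ y₀ S t ≤ c := by
      refine (norm_sub_inner_normalize_le_two_mul _ _).trans (le_trans ?_ hcG)
      have h3 := norm_gradient_runPair_le (G := G) (η := η) (τ := τ) (K := K) (M := M) (x₀ := x₀)
        (y₀ := y₀) h hdy hηx S t
      have h4 : (ℓ / μ + 1) * ℓ * ηx * t ≤ (ℓ / μ + 1) * ℓ * ηx * T := by
        gcongr
      linarith
    have h5 : ℓ * ‖innerY G η τ K (runPair G ηx η τ K M x₀ y₀ S t) (S t) -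
      h.argmax (runPair G ηx η τ K M x₀ y₀ S t).1‖ ≤ ℓ * es := by
      gcongr
      exact hin t ht'
    unfold lossIncr
    rw [show dirGap f (runPair G ηx η τ K M x₀ y₀ S t).1 _ = pathGap f G ηx η τ K M x₀ y₀ S t from
      rfl, min_eq_left h2]
    linarith
  have h2 := Finset.sum_le_sum h1
  rw [Finset.sum_add_distrib, Finset.sum_const, Finset.card_range, nsmul_eq_mul] at h2
  rw [inv_mul_le_iff₀ hc] at hacc
  exact h2.trans (by gcongr; exact hacc)

variable {Ω : Type*} [MeasurableSpace Ξ] [MeasurableSpace Ω] {P : Measure Ω}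
  [IsProbabilityMeasure P] {D : Measure Ξ} [IsProbabilityMeasure D] {σ p A : ℝ}
  {S : ℕ → ℕ ⊕ ℕ → Ω → Ξ}

/-- Union bound over one event for the accumulated loss and T events for the inner loops. The loss
event needs no good inner loops, because `lossIncr` subtracts the actual inner error. -/
theorem measure_not_sum_norm_gradient_le (h : MinimaxAssumption f ℓ μ) (hdy : 0 < dy)
    (hG : PBCM f D G σ p) (hS : ∀ t i, Measurable (S t i)) (hD : ∀ t i, P.map (S t i) = D)
    (hind : iIndepFun (fun j : ℕ × (ℕ ⊕ ℕ) => S j.1 j.2) P)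
    (hq : InnerParams ℓ μ σ p η R A K τ) (hM : 0 < M) (hb : 0 < b)
    (hMb : 6 * M * σ ^ p ≤ (M * b) ^ p) (hηx : 0 < ηx) (hc : 0 < c)
    (hcG : 2 * (‖gradient (Phi f) x₀‖ + (ℓ / μ + 1) * ℓ * ηx * T) ≤ c) (hes : 0 ≤ es)
    (hK : 2 * Real.exp (-(η * μ * K)) * R ^ 2 ≤ es ^ 2) (hR : es + ℓ / μ * ηx ≤ R)
    (h0 : ‖y₀ - h.argmax x₀‖ ≤ R) :
    P {ω | ¬ ∑ t ∈ Finset.range T,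
      ‖gradient (Phi f) (runPair G ηx η τ K M x₀ y₀ (fun s i => S s i ω) t).1‖ ≤
      gap f x₀ / ηx + T * ((ℓ / μ + 1) * ℓ * ηx / 2) + (c * B + T * (4 * (2 * b + ℓ * es)))} ≤
      ENNReal.ofReal (Real.exp (-B)) + T * ENNReal.ofReal (Real.exp (-A)) := by
  set bad₁ : Set Ω := {ω | B ≤ c⁻¹ *
    accLoss f h.argmax G b ℓ c ηx η τ K M x₀ y₀ (fun s i => S s i ω) T} with hb1
  set bad₂ : ℕ → Set Ω := fun t =>
    {ω | ‖(runPair G ηx η τ K M x₀ y₀ (fun s i => S s i ω) t).2 -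
        h.argmax (runPair G ηx η τ K M x₀ y₀ (fun s i => S s i ω) t).1‖ ≤ R ∧
      2 * Real.exp (-(η * μ * K)) * R ^ 2 ≤
        ‖innerY G η τ K (runPair G ηx η τ K M x₀ y₀ (fun s i => S s i ω) t) (fun i => S t i ω) -
          h.argmax (runPair G ηx η τ K M x₀ y₀ (fun s i => S s i ω) t).1‖ ^ 2} with hb2
  have hsub : {ω | ¬ ∑ t ∈ Finset.range T,
      ‖gradient (Phi f) (runPair G ηx η τ K M x₀ y₀ (fun s i => S s i ω) t).1‖ ≤
      gap f x₀ / ηx + T * ((ℓ / μ + 1) * ℓ * ηx / 2) + (c * B + T * (4 * (2 * b + ℓ * es)))} ⊆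
      bad₁ ∪ ⋃ t ∈ Finset.range T, bad₂ t := by
    intro ω hω
    by_contra hgood
    simp only [mem_union, mem_iUnion, not_or, not_exists, Finset.mem_range] at hgood
    obtain ⟨hg1, hg2⟩ := hgood
    refine hω ?_
    have hin := norm_innerY_sub_le (T := T) h hdy hηx.le hes hK hR h0
      (S := fun s i => S s i ω) (G := G) (η := η) (τ := τ) (K := K) (M := M)
      (fun t ht hr => le_of_not_ge fun hge => hg2 t ht ⟨hr, hge⟩)
    have hgap := sum_pathGap_le (b := b) (B := B) h hdy hηx.le hc hcG
      (S := fun s i => S s i ω) (le_of_not_ge hg1) hin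
    have := sum_norm_gradient_le (η := η) (τ := τ) (K := K) (M := M) (x₀ := x₀) (y₀ := y₀) (G := G)
      h hdy hηx (fun s i => S s i ω) T
    linarith
  refine (measure_mono hsub).trans ((measure_union_le _ _).trans (add_le_add
    (measure_accLoss_bad_le h hdy hG hS hD hind hM hb hMb hc ηx η τ K T x₀ y₀ B) ?_))
  refine (measure_biUnion_finset_le _ _).trans ((Finset.sum_le_sum fun t _ =>
    measure_innerY_bad_le h hdy hG hS hD hind hq t).trans (le_of_eq ?_))
  simp

end

end N2SGDA

/-! ### Sizes of T, K and the logarithmic terms -/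

namespace N2SGDA

/-- The conditions on the numerical data of the problem. -/
structure ProblemData (ℓ μ σ p ε δ R₀ Δ : ℝ) : Prop where
  mu_pos : 0 < μ
  mu_le : μ ≤ ℓ
  sigma_nonneg : 0 ≤ σ
  one_lt_p : 1 < p
  p_le_two : p ≤ 2
  eps_pos : 0 < ε
  delta_pos : 0 < δ
  delta_lt_one : δ < 1
  R_nonneg : 0 ≤ R₀
  gap_nonneg : 0 ≤ Δ

/-- The absolute constant in the parameters of the algorithm. -/
noncomputable def stepConst : ℝ := 10 ^ 10

theorem log_stepConst_le : Real.log stepConst ≤ 40 := by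
  have h1 : stepConst ≤ 2 ^ 40 := by norm_num [stepConst]
  have h2 := Real.log_le_log (by norm_num [stepConst]) h1
  rw [Real.log_pow] at h2
  have := Real.log_two_lt_d9
  push_cast at h2
  linarith

namespace ProblemData

variable {ℓ μ σ p ε δ R₀ Δ : ℝ} (d : ProblemData ℓ μ σ p ε δ R₀ Δ)

include d

theorem ell_pos : 0 < ℓ := d.mu_pos.trans_le d.mu_le

theorem one_le_kappa : 1 ≤ ℓ / μ := (one_le_div d.mu_pos).2 d.mu_le

theorem two_le_conj : 2 ≤ p / (p - 1) := by
  have := d.one_lt_p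
  have := d.p_le_two
  rw [le_div_iff₀ (by linarith)]
  linarith

theorem exp_logFactor : Real.exp (logFactor ℓ μ σ ε δ R₀ Δ) =
    Real.exp 1 + ℓ / μ + σ / ε + Δ * ℓ / ε ^ 2 + ℓ * R₀ / ε + 1 / δ := by
  have := d.mu_pos
  have := d.ell_pos
  have := d.sigma_nonneg
  have := d.eps_pos
  have := d.delta_pos
  have := d.R_nonneg
  have := d.gap_nonneg
  exact Real.exp_log (by positivity)

theorem exp_logFactor_bounds :
    Real.exp 1 ≤ Real.exp (logFactor ℓ μ σ ε δ R₀ Δ) ∧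
    ℓ / μ ≤ Real.exp (logFactor ℓ μ σ ε δ R₀ Δ) ∧
    σ / ε ≤ Real.exp (logFactor ℓ μ σ ε δ R₀ Δ) ∧
    Δ * ℓ / ε ^ 2 ≤ Real.exp (logFactor ℓ μ σ ε δ R₀ Δ) ∧
    ℓ * R₀ / ε + Real.exp 1 ≤ Real.exp (logFactor ℓ μ σ ε δ R₀ Δ) ∧
    1 / δ ≤ Real.exp (logFactor ℓ μ σ ε δ R₀ Δ) := by
  have := d.mu_pos
  have := d.ell_pos
  have := d.sigma_nonneg
  have := d.eps_pos
  have := d.delta_pos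
  have := d.R_nonneg
  have := d.gap_nonneg
  have h1 : 0 ≤ Real.exp 1 := (Real.exp_pos 1).le
  have h2 : 0 ≤ ℓ / μ := by positivity
  have h3 : 0 ≤ σ / ε := by positivity
  have h4 : 0 ≤ Δ * ℓ / ε ^ 2 := by positivity
  have h5 : 0 ≤ ℓ * R₀ / ε := by positivity
  have h6 : 0 ≤ 1 / δ := by positivity
  rw [d.exp_logFactor]
  refine ⟨?_, ?_, ?_, ?_, ?_, ?_⟩ <;> linarith

theorem one_le_logFactor : 1 ≤ logFactor ℓ μ σ ε δ R₀ Δ :=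
  Real.exp_le_exp.1 d.exp_logFactor_bounds.1

theorem log_inv_delta_nonneg : 0 ≤ Real.log (1 / δ) :=
  Real.log_nonneg ((one_le_div d.delta_pos).2 d.delta_lt_one.le)

theorem log_inv_delta_le : Real.log (1 / δ) ≤ logFactor ℓ μ σ ε δ R₀ Δ := by
  have := d.delta_pos
  rw [Real.log_le_iff_le_exp (by positivity)]
  exact d.exp_logFactor_bounds.2.2.2.2.2

theorem variance_ratio_eq : (ℓ ^ 2 * σ ^ 2 / (μ ^ 2 * ε ^ 2)) ^ (p / (2 * (p - 1))) =
    (ℓ / μ * (σ / ε)) ^ (p / (p - 1)) := by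
  have := d.mu_pos
  have := d.ell_pos
  have := d.sigma_nonneg
  have := d.eps_pos
  have hp : 0 < p - 1 := by linarith [d.one_lt_p]
  rw [show ℓ ^ 2 * σ ^ 2 / (μ ^ 2 * ε ^ 2) = (ℓ / μ * (σ / ε)) ^ (2 : ℝ) by
    rw [Real.rpow_two]; field_simp, ← Real.rpow_mul (by positivity)]
  congr 1
  field_simp

theorem outerIters_le {C : ℝ} (hC : 0 ≤ C) : (outerIters C ℓ μ ε δ Δ : ℝ) ≤
    C * (1 + Real.log (1 / δ)) ^ 2 * (Δ * (ℓ / μ) * ℓ / ε ^ 2) + 1 := by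
  have := d.mu_pos
  have := d.ell_pos
  have := d.gap_nonneg
  have h0 : 0 ≤ C * (1 + Real.log (1 / δ)) ^ 2 * (Δ * (ℓ / μ) * ℓ / ε ^ 2) := by positivity
  rw [outerIters, Nat.cast_max, Nat.cast_one]
  exact max_le (by linarith) (Nat.ceil_lt_add_one h0).le

theorem outerIters_le_exp {C : ℝ} (hC : 1 ≤ C) : (outerIters C ℓ μ ε δ Δ : ℝ) ≤
    2 * C * Real.exp (4 * logFactor ℓ μ σ ε δ R₀ Δ) := by
  have := d.mu_pos
  have := d.ell_pos
  have := d.gap_nonneg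
  obtain ⟨h1, h2, -, h4, -, -⟩ := d.exp_logFactor_bounds
  have hΛ := d.one_le_logFactor
  have hδ := d.log_inv_delta_le
  have hδ0 := d.log_inv_delta_nonneg
  set Λ := logFactor ℓ μ σ ε δ R₀ Δ
  have h5 : 1 + Real.log (1 / δ) ≤ Real.exp Λ := by
    have := Real.add_one_le_exp Λ
    linarith
  have h6 : Real.exp (4 * Λ) = Real.exp Λ ^ 2 * (Real.exp Λ * Real.exp Λ) := by
    rw [show 4 * Λ = ((4 : ℕ) : ℝ) * Λ by norm_num, Real.exp_nat_mul]
    ring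
  have h7 : Δ * (ℓ / μ) * ℓ / ε ^ 2 ≤ Real.exp Λ * Real.exp Λ := by
    calc Δ * (ℓ / μ) * ℓ / ε ^ 2 = (Δ * ℓ / ε ^ 2) * (ℓ / μ) := by ring
      _ ≤ _ := by gcongr
  have h8 : 1 ≤ Real.exp (4 * Λ) := Real.one_le_exp (by linarith)
  refine (d.outerIters_le (by linarith)).trans ?_
  have h9 : C * (1 + Real.log (1 / δ)) ^ 2 * (Δ * (ℓ / μ) * ℓ / ε ^ 2) ≤ C * Real.exp (4 * Λ) := by
    rw [h6, mul_assoc]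
    gcongr
  nlinarith

theorem innerIters_arg_nonneg {C : ℝ} (hC : 0 ≤ C) : 0 ≤ C ^ (p / (p - 1)) *
    (ℓ / μ * logFactor ℓ μ σ ε δ R₀ Δ ^ 2 + (ℓ / μ * (σ / ε)) ^ (p / (p - 1)) *
      logFactor ℓ μ σ ε δ R₀ Δ ^ (p / (p - 1) + 1)) := by
  have := d.mu_pos
  have := d.ell_pos
  have := d.sigma_nonneg
  have := d.eps_pos
  have := d.one_le_logFactor
  positivity

theorem innerIters_le {C : ℝ} (hC : 0 ≤ C) : (innerIters C ℓ μ σ p ε δ R₀ Δ : ℝ) ≤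
    C ^ (p / (p - 1)) * (ℓ / μ * logFactor ℓ μ σ ε δ R₀ Δ ^ 2 +
      (ℓ / μ * (σ / ε)) ^ (p / (p - 1)) * logFactor ℓ μ σ ε δ R₀ Δ ^ (p / (p - 1) + 1)) + 1 := by
  rw [innerIters, d.variance_ratio_eq]
  exact (Nat.ceil_lt_add_one (d.innerIters_arg_nonneg hC)).le

theorem le_innerIters (C : ℝ) : C ^ (p / (p - 1)) * (ℓ / μ * logFactor ℓ μ σ ε δ R₀ Δ ^ 2 +
    (ℓ / μ * (σ / ε)) ^ (p / (p - 1)) * logFactor ℓ μ σ ε δ R₀ Δ ^ (p / (p - 1) + 1)) ≤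
    (innerIters C ℓ μ σ p ε δ R₀ Δ : ℝ) := by
  rw [innerIters, d.variance_ratio_eq]
  exact Nat.le_ceil _

theorem innerIters_pos {C : ℝ} (hC : 1 ≤ C) : 0 < innerIters C ℓ μ σ p ε δ R₀ Δ := by
  have := d.mu_pos
  have := d.ell_pos
  have := d.sigma_nonneg
  have := d.eps_pos
  have := d.one_le_logFactor
  rw [← Nat.cast_pos (α := ℝ)]
  refine lt_of_lt_of_le ?_ (d.le_innerIters C)
  positivity

theorem innerIters_le_exp {C : ℝ} (hC : 1 ≤ C) : (innerIters C ℓ μ σ p ε δ R₀ Δ : ℝ) ≤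
    3 * C ^ (p / (p - 1)) * Real.exp (4 * (p / (p - 1)) * logFactor ℓ μ σ ε δ R₀ Δ) := by
  have := d.mu_pos
  have := d.ell_pos
  have := d.sigma_nonneg
  have := d.eps_pos
  have hq := d.two_le_conj
  have hΛ := d.one_le_logFactor
  obtain ⟨-, h2, h3, -, -, -⟩ := d.exp_logFactor_bounds
  refine (d.innerIters_le (by linarith)).trans ?_
  set q := p / (p - 1)
  set Λ := logFactor ℓ μ σ ε δ R₀ Δ
  have hΛe : Λ ≤ Real.exp Λ := by linarith [Real.add_one_le_exp Λ]
  have h4 : ℓ / μ * Λ ^ 2 ≤ Real.exp (4 * q * Λ) := by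
    calc ℓ / μ * Λ ^ 2 ≤ Real.exp Λ * Real.exp Λ ^ 2 := by gcongr
      _ = Real.exp (3 * Λ) := by
          rw [← Real.exp_nat_mul, ← Real.exp_add]
          congr 1
          push_cast
          ring
      _ ≤ _ := Real.exp_le_exp.2 (by nlinarith)
  have h5 : (ℓ / μ * (σ / ε)) ^ q * Λ ^ (q + 1) ≤ Real.exp (4 * q * Λ) := by
    calc (ℓ / μ * (σ / ε)) ^ q * Λ ^ (q + 1)
        ≤ (Real.exp Λ * Real.exp Λ) ^ q * Real.exp Λ ^ (q + 1) := by gcongr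
      _ = Real.exp ((3 * q + 1) * Λ) := by
          rw [← Real.exp_add, ← Real.exp_mul, ← Real.exp_mul, ← Real.exp_add]
          congr 1
          ring
      _ ≤ _ := Real.exp_le_exp.2 (by nlinarith)
  have h6 : 1 ≤ C ^ q := Real.one_le_rpow hC (by linarith)
  have h7 : 1 ≤ Real.exp (4 * q * Λ) := Real.one_le_exp (by positivity)
  have h8 : C ^ q * (ℓ / μ * Λ ^ 2 + (ℓ / μ * (σ / ε)) ^ q * Λ ^ (q + 1)) ≤
      C ^ q * (Real.exp (4 * q * Λ) + Real.exp (4 * q * Λ)) := by gcongr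
  nlinarith

theorem exp_logTerm {C : ℝ} (hC : 1 ≤ C) :
    Real.exp (logTerm (outerIters C ℓ μ ε δ Δ) (innerIters C ℓ μ σ p ε δ R₀ Δ) δ) =
      8 * outerIters C ℓ μ ε δ Δ * innerIters C ℓ μ σ p ε δ R₀ Δ / δ := by
  have hT : 0 < outerIters C ℓ μ ε δ Δ := lt_max_of_lt_left one_pos
  have hK := d.innerIters_pos hC
  have := d.delta_pos
  exact Real.exp_log (by positivity)

theorem one_le_logTerm {C : ℝ} (hC : 1 ≤ C) :
    1 ≤ logTerm (outerIters C ℓ μ ε δ Δ) (innerIters C ℓ μ σ p ε δ R₀ Δ) δ := by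
  have hT : (1 : ℝ) ≤ outerIters C ℓ μ ε δ Δ := by exact_mod_cast le_max_left 1 _
  have hK : (1 : ℝ) ≤ innerIters C ℓ μ σ p ε δ R₀ Δ := by exact_mod_cast d.innerIters_pos hC
  rw [← Real.exp_le_exp, d.exp_logTerm hC, le_div_iff₀ d.delta_pos]
  have h1 := Real.exp_one_lt_d9
  have h2 := d.delta_lt_one
  have h3 := d.delta_pos
  have h4 : 1 ≤ (outerIters C ℓ μ ε δ Δ : ℝ) * innerIters C ℓ μ σ p ε δ R₀ Δ :=
    one_le_mul_of_one_le_of_one_le hT hK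
  nlinarith

/-- K enters the logarithm that K itself has to dominate. The circle is broken since T and K are at
most exponentials of multiples of Λ and of (p/(p-1))Λ. -/
theorem logTerm_le :
    logTerm (outerIters stepConst ℓ μ ε δ Δ) (innerIters stepConst ℓ μ σ p ε δ R₀ Δ) δ ≤
      87 * (p / (p - 1)) * logFactor ℓ μ σ ε δ R₀ Δ := by
  have hC : (1 : ℝ) ≤ stepConst := by norm_num [stepConst]
  have hC0 : (0 : ℝ) < stepConst := by linarith
  have hlog := log_stepConst_le
  have hq := d.two_le_conj
  have hΛ := d.one_le_logFactor
  have hT := d.outerIters_le_exp hC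
  have hK := d.innerIters_le_exp hC
  obtain ⟨-, -, -, -, -, h6⟩ := d.exp_logFactor_bounds
  rw [← Real.exp_le_exp, d.exp_logTerm hC]
  set q := p / (p - 1)
  set Λ := logFactor ℓ μ σ ε δ R₀ Δ
  have hCe : stepConst ≤ Real.exp 40 := by
    rwa [← Real.log_le_iff_le_exp hC0]
  have h48 : (48 : ℝ) ≤ Real.exp 40 := le_trans (by norm_num [stepConst]) hCe
  have hCq : stepConst ^ q ≤ Real.exp (40 * q) := by
    rw [Real.exp_mul]
    exact Real.rpow_le_rpow hC0.le hCe (by linarith)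
  have hδ := d.delta_pos
  calc 8 * (outerIters stepConst ℓ μ ε δ Δ : ℝ) * innerIters stepConst ℓ μ σ p ε δ R₀ Δ / δ
      = 8 * (outerIters stepConst ℓ μ ε δ Δ : ℝ) * innerIters stepConst ℓ μ σ p ε δ R₀ Δ *
          (1 / δ) := by ring
    _ ≤ 8 * (2 * stepConst * Real.exp (4 * Λ)) * (3 * stepConst ^ q * Real.exp (4 * q * Λ)) *
          Real.exp Λ := by gcongr
    _ = 48 * stepConst * stepConst ^ q * (Real.exp (4 * Λ) * Real.exp (4 * q * Λ) * Real.exp Λ) := by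
        ring
    _ ≤ Real.exp 40 * Real.exp 40 * Real.exp (40 * q) *
          (Real.exp (4 * Λ) * Real.exp (4 * q * Λ) * Real.exp Λ) := by gcongr
    _ = Real.exp (40 + 40 + 40 * q + (4 * Λ + 4 * q * Λ + Λ)) := by simp only [Real.exp_add]
    -- With q ≥ 2 and Λ ≥ 1 the exponent is at most (40 + 40 + 5/2 + 4)qΛ, which is below 87qΛ.
    _ ≤ _ := Real.exp_le_exp.2 (by nlinarith)

end ProblemData

end N2SGDA

/-! ### The implicit equation for B and the inner parameters -/

namespace N2SGDA

/-- Bernoulli's inequality. It lets the constant C^(p/(p-1)) absorb the factor p/(p-1) of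
`logTerm_le`, which is unbounded as p → 1. -/
theorem mul_sub_one_le_rpow {q x : ℝ} (hq : 1 ≤ q) (hx : 0 ≤ x) : q * (x - 1) ≤ x ^ q := by
  have h := one_add_mul_self_le_rpow_one_add (s := x - 1) (by linarith) hq
  rw [add_sub_cancel] at h
  linarith

theorem two_le_implicitB {c : ℝ} (hc : 0 ≤ c) : 2 ≤ implicitB c := by
  rw [implicitB_eq hc]
  exact le_max_left _ _

/-- If `c` is large, then the solution of the implicit equation is large. -/
theorem le_implicitB {c H b : ℝ} (hb : 0 < b) (hH : Real.log H ≤ b) (hc : H * b ^ 2 ≤ c)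
    (hc0 : 0 ≤ c) : H ≤ implicitB c := by
  by_contra hlt
  rw [not_le] at hlt
  have h2 := two_le_implicitB hc0
  have hlog : 0 < Real.log (implicitB c) := Real.log_pos (by linarith)
  have hle : Real.log (implicitB c) ≤ b := (Real.log_le_log (by linarith) hlt.le).trans hH
  have h3 : c / Real.log (implicitB c) ^ 2 ≤ implicitB c := by
    conv_rhs => rw [implicitB_eq hc0]
    exact le_max_right _ _
  rw [div_le_iff₀ (by positivity)] at h3
  have h4 : implicitB c * Real.log (implicitB c) ^ 2 ≤ implicitB c * b ^ 2 := by gcongr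
  have h5 : implicitB c * b ^ 2 < H * b ^ 2 := by gcongr
  linarith

theorem implicitB_mul_sq_log {c : ℝ} (hc : 0 ≤ c) (h : 2 < implicitB c) :
    implicitB c * Real.log (implicitB c) ^ 2 = c := by
  have h1 := implicitB_eq hc
  have hlog : 0 < Real.log (implicitB c) := Real.log_pos (by linarith)
  rcases max_choice 2 (c / Real.log (implicitB c) ^ 2) with h2 | h2
  · rw [h2] at h1
    linarith
  · rw [h2] at h1
    exact (eq_div_iff (by positivity)).1 h1

/-- Written as a square, so that the equation for B becomes √B ln B = r, with r the root of the
argument. -/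
theorem implicit_arg_eq {μ p R K A σ : ℝ} (hK : 0 ≤ K) (hA : 0 ≤ A) :
    μ ^ 2 * K ^ (2 * (p - 1) / p) * R ^ 2 / ((5400 : ℝ) ^ (2 / p) * σ ^ 2 * A ^ (2 * (p - 1) / p)) =
      (μ * R * (K / A) ^ ((p - 1) / p) / ((5400 : ℝ) ^ (1 / p) * σ)) ^ 2 := by
  have h1 : ∀ x : ℝ, 0 ≤ x → x ^ (2 * (p - 1) / p) = (x ^ ((p - 1) / p)) ^ 2 := fun x hx => by
    rw [show 2 * (p - 1) / p = (p - 1) / p * 2 by ring, Real.rpow_mul hx, Real.rpow_two]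
  have h2 : (5400 : ℝ) ^ (2 / p) = (5400 ^ (1 / p)) ^ 2 := by
    rw [show 2 / p = 1 / p * 2 by ring, Real.rpow_mul (by norm_num), Real.rpow_two]
  rw [h1 K hK, h1 A hA, h2, Real.div_rpow hK hA]
  ring

/-- The balance between the stepsize and the noise level in the inner loop. -/
theorem noise_balance {μ σ p R A K η b t : ℝ} (hμ : 0 < μ) (hσ : 0 < σ) (hp : 1 < p)
    (hp2 : p ≤ 2) (hR : 0 < R) (hA : 0 < A) (hK : 0 < K) (hη : 0 < η) (hb : η * μ * K ≤ b)
    (hB : Real.exp b * b ^ 2 =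
      (μ * R * (K / A) ^ ((p - 1) / p) / ((5400 : ℝ) ^ (1 / p) * σ)) ^ 2)
    (ht : R / (132 * η * A * Real.exp (η * μ * K / 2)) ≤ t) :
    σ ^ p / t ^ p ≤ 8 * A / K := by
  have hp0 : 0 < p := by linarith
  set ψ := (K / A) ^ ((p - 1) / p) with hψ
  have hψ0 : 0 < ψ := by positivity
  have hb0 : 0 ≤ b := le_trans (by positivity) hb
  -- Square root of the equation for B = exp b; the function b exp(b/2) is increasing and ημK ≤ b.
  have hy : η * μ * K * Real.exp (η * μ * K / 2) ≤ μ * R * ψ / ((5400 : ℝ) ^ (1 / p) * σ) := by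
    have h1 : (b * Real.exp (b / 2)) ^ 2 = (μ * R * ψ / ((5400 : ℝ) ^ (1 / p) * σ)) ^ 2 := by
      rw [← hB, mul_pow, ← Real.exp_nat_mul]
      push_cast
      rw [mul_div_cancel₀ _ two_ne_zero]
      ring
    have h2 := (pow_left_inj₀ (by positivity) (by positivity) two_ne_zero).1 h1
    rw [← h2]
    gcongr
  have ht0 : 0 < t := lt_of_lt_of_le (by positivity) ht
  have hquot : σ / t ≤ 132 * (A / K) * ψ / (5400 : ℝ) ^ (1 / p) := by
    calc σ / t ≤ σ / (R / (132 * η * A * Real.exp (η * μ * K / 2))) := by gcongr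
      _ = 132 * σ * A / (R * μ * K) * (η * μ * K * Real.exp (η * μ * K / 2)) := by field_simp
      _ ≤ 132 * σ * A / (R * μ * K) * (μ * R * ψ / ((5400 : ℝ) ^ (1 / p) * σ)) := by gcongr
      _ = _ := by field_simp
  have hpow : (132 * (A / K) * ψ / (5400 : ℝ) ^ (1 / p)) ^ p = 132 ^ p * (A / K) / 5400 := by
    have h1 : ((5400 : ℝ) ^ (1 / p)) ^ p = 5400 := by
      rw [← Real.rpow_mul (by norm_num), one_div_mul_cancel hp0.ne', Real.rpow_one]
    have h2 : ψ ^ p = (K / A) ^ (p - 1) := by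
      rw [hψ, ← Real.rpow_mul (by positivity), div_mul_cancel₀ _ hp0.ne']
    have h3 : (A / K) ^ p * (K / A) ^ (p - 1) = A / K := by
      rw [← inv_div A K, Real.inv_rpow (by positivity), ← Real.rpow_neg (by positivity),
        ← Real.rpow_add (by positivity)]
      rw [show p + -(p - 1) = 1 by ring, Real.rpow_one]
    rw [Real.div_rpow (by positivity) (by positivity), Real.mul_rpow (by positivity) (by positivity),
      Real.mul_rpow (by positivity) (by positivity), h1, h2, mul_assoc, h3]
  have h132 : (132 : ℝ) ^ p ≤ 132 ^ 2 := by
    rw [← Real.rpow_two]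
    exact Real.rpow_le_rpow_of_exponent_le (by norm_num) hp2
  calc σ ^ p / t ^ p = (σ / t) ^ p := (Real.div_rpow hσ.le ht0.le p).symm
    _ ≤ _ := Real.rpow_le_rpow (by positivity) hquot hp0.le
    _ = 132 ^ p * (A / K) / 5400 := hpow
    _ ≤ 132 ^ 2 * (A / K) / 5400 := by gcongr
    -- Here 132² = 17424 is below 8 · 5400 = 43200.
    _ ≤ 8 * (A / K) := by nlinarith [div_pos hA hK]
    _ = _ := by ring

namespace ProblemData

variable {ℓ μ σ p ε δ R₀ Δ : ℝ} (d : ProblemData ℓ μ σ p ε δ R₀ Δ)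

include d

theorem radius_eq : radius ℓ ε R₀ = ε / ℓ * (ℓ * R₀ / ε + 4) := by
  have := d.ell_pos
  have := d.eps_pos
  rw [radius]
  field_simp

theorem radius_pos : 0 < radius ℓ ε R₀ := by
  have := d.ell_pos
  have := d.eps_pos
  have := d.R_nonneg
  rw [radius]
  positivity

/-- The left side is the factor by which the inner loop has to shrink the squared distance: 2R_y²
against (ε/(16ℓ))², with 512 = 2 · 16². Its logarithm is thus at most 10Λ. -/
theorem contraction_target_le :
    512 * (ℓ * R₀ / ε + 4) ^ 2 ≤ Real.exp (10 * logFactor ℓ μ σ ε δ R₀ Δ) := by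
  have := d.ell_pos
  have := d.eps_pos
  have := d.R_nonneg
  obtain ⟨h1, -, -, -, h5, -⟩ := d.exp_logFactor_bounds
  have hΛ := d.one_le_logFactor
  set Λ := logFactor ℓ μ σ ε δ R₀ Δ
  have he := Real.exp_one_gt_d9
  have h2 : ℓ * R₀ / ε + 4 ≤ 2 * Real.exp Λ := by linarith
  have h3 : (2048 : ℝ) ≤ Real.exp (8 * Λ) := by
    calc (2048 : ℝ) ≤ 2.7 ^ 8 := by norm_num
      _ ≤ Real.exp 1 ^ 8 := by gcongr; linarith
      _ = Real.exp 8 := by rw [← Real.exp_nat_mul]; norm_num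
      _ ≤ _ := Real.exp_le_exp.2 (by linarith)
  have h4 : 0 ≤ ℓ * R₀ / ε := by positivity
  calc 512 * (ℓ * R₀ / ε + 4) ^ 2 ≤ 512 * (2 * Real.exp Λ) ^ 2 := by gcongr
    _ = 2048 * Real.exp Λ ^ 2 := by ring
    _ ≤ Real.exp (8 * Λ) * Real.exp Λ ^ 2 := by gcongr
    _ = Real.exp (10 * Λ) := by
        rw [← Real.exp_nat_mul, ← Real.exp_add]
        congr 1
        push_cast
        ring

theorem const_rpow_ge {x N : ℝ} (hx : 0 ≤ x) (hxN : N + 1 ≤ x) :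
    p / (p - 1) * N ≤ x ^ (p / (p - 1)) := by
  have hq := d.two_le_conj
  refine le_trans ?_ (mul_sub_one_le_rpow (by linarith) hx)
  gcongr
  linarith

/-- The second summand of K gives K/A ≥ (1242000 κ(σ/ε)Λ)^(p/(p-1)), and the power (p-1)/p undoes
the exponent. Here 1242000 = 230 · 5400, and 230² exceeds 512 · 10², as needed for the implicit
equation. -/
theorem sqrt_implicit_arg_ge (hσ : 0 < σ) {K A : ℝ} (hA : 0 < A)
    (hAle : A ≤ 87 * (p / (p - 1)) * logFactor ℓ μ σ ε δ R₀ Δ)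
    (hK : stepConst ^ (p / (p - 1)) * (ℓ / μ * logFactor ℓ μ σ ε δ R₀ Δ ^ 2 +
      (ℓ / μ * (σ / ε)) ^ (p / (p - 1)) * logFactor ℓ μ σ ε δ R₀ Δ ^ (p / (p - 1) + 1)) ≤ K) :
    230 * (ℓ * R₀ / ε + 4) * logFactor ℓ μ σ ε δ R₀ Δ ≤
      μ * radius ℓ ε R₀ * (K / A) ^ ((p - 1) / p) / ((5400 : ℝ) ^ (1 / p) * σ) := by
  have hμ := d.mu_pos
  have hℓ := d.ell_pos
  have hε := d.eps_pos
  have hR := d.radius_pos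
  have hp := d.one_lt_p
  have hΛ := d.one_le_logFactor
  have hq := d.two_le_conj
  have hC0 : (0 : ℝ) ≤ stepConst / 1242000 := by norm_num [stepConst]
  have hCq := d.const_rpow_ge (N := 87) hC0 (by norm_num [stepConst])
  rw [d.radius_eq] at *
  set Λ := logFactor ℓ μ σ ε δ R₀ Δ
  have hqp : p / (p - 1) * ((p - 1) / p) = 1 := by
    have : p - 1 ≠ 0 := by linarith
    field_simp
  set q := p / (p - 1)
  have h1 : (1242000 * (ℓ / μ * (σ / ε)) * Λ) ^ q ≤ K / A := by
    rw [le_div_iff₀ hA]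
    refine le_trans ?_ hK
    calc (1242000 * (ℓ / μ * (σ / ε)) * Λ) ^ q * A
        ≤ (1242000 * (ℓ / μ * (σ / ε)) * Λ) ^ q * (87 * q * Λ) := by gcongr
      _ = 1242000 ^ q * (q * 87) * ((ℓ / μ * (σ / ε)) ^ q * Λ ^ (q + 1)) := by
          rw [Real.mul_rpow (by positivity) (by positivity),
            Real.mul_rpow (by positivity) (by positivity), Real.rpow_add_one (by positivity)]
          ring
      _ ≤ 1242000 ^ q * (stepConst / 1242000) ^ q *
          ((ℓ / μ * (σ / ε)) ^ q * Λ ^ (q + 1)) := by gcongr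
      _ = stepConst ^ q * ((ℓ / μ * (σ / ε)) ^ q * Λ ^ (q + 1)) := by
          rw [← Real.mul_rpow (by norm_num) hC0, mul_div_cancel₀ _ (by norm_num)]
      _ ≤ _ := by
          have : 0 ≤ stepConst ^ q := by unfold stepConst; positivity
          gcongr
          have : 0 ≤ ℓ / μ * Λ ^ 2 := by positivity
          linarith
  have h2 : 1242000 * (ℓ / μ * (σ / ε)) * Λ ≤ (K / A) ^ ((p - 1) / p) := by
    have h3 := Real.rpow_le_rpow (by positivity) h1 (show 0 ≤ (p - 1) / p by
      exact div_nonneg (by linarith) (by linarith))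
    rwa [← Real.rpow_mul (by positivity), hqp, Real.rpow_one] at h3
  have h4 : (5400 : ℝ) ^ (1 / p) ≤ 5400 := by
    calc (5400 : ℝ) ^ (1 / p) ≤ 5400 ^ (1 : ℝ) := by
          refine Real.rpow_le_rpow_of_exponent_le (by norm_num) ?_
          rw [div_le_one (by linarith)]
          exact hp.le
      _ = 5400 := Real.rpow_one _
  have h5 : 0 < (5400 : ℝ) ^ (1 / p) := by positivity
  rw [le_div_iff₀ (by positivity)]
  calc 230 * (ℓ * R₀ / ε + 4) * Λ * ((5400 : ℝ) ^ (1 / p) * σ)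
      ≤ 230 * (ℓ * R₀ / ε + 4) * Λ * (5400 * σ) := by
        have := d.R_nonneg
        gcongr
    _ = μ * (ε / ℓ * (ℓ * R₀ / ε + 4)) * (1242000 * (ℓ / μ * (σ / ε)) * Λ) := by
        field_simp
        ring
    _ ≤ _ := by gcongr

end ProblemData

end N2SGDA

namespace N2SGDA

section Params

variable {ℓ μ σ p ε δ R₀ : ℝ} {T K : ℕ}

theorem paramB_eq (hA : 0 ≤ logTerm T K δ) : paramB ℓ μ σ p ε δ R₀ T K =
    implicitB ((μ * radius ℓ ε R₀ * ((K : ℝ) / logTerm T K δ) ^ ((p - 1) / p) /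
      ((5400 : ℝ) ^ (1 / p) * σ)) ^ 2) := by
  rw [paramB, implicit_arg_eq (Nat.cast_nonneg K) hA]

theorem etaY_le (ℓ μ σ p ε δ R₀ : ℝ) (T K : ℕ) : etaY ℓ μ σ p ε δ R₀ T K ≤ 1 / (400 * ℓ * logTerm T K δ) := by
  rw [etaY]
  split_ifs with h
  · exact le_rfl
  · exact min_le_left _ _

end Params

namespace ProblemData

variable {ℓ μ σ p ε δ R₀ Δ : ℝ} (d : ProblemData ℓ μ σ p ε δ R₀ Δ) {T K : ℕ}

include d

theorem etaY_pos (hK : 0 < K) (hA : 0 < logTerm T K δ) : 0 < etaY ℓ μ σ p ε δ R₀ T K := by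
  have hμ := d.mu_pos
  have hℓ := d.ell_pos
  rw [etaY]
  split_ifs with h
  · positivity
  · have h2 : 2 ≤ paramB ℓ μ σ p ε δ R₀ T K := by
      rw [paramB_eq hA.le]
      exact two_le_implicitB (sq_nonneg _)
    have hlog : 0 < Real.log (paramB ℓ μ σ p ε δ R₀ T K) := Real.log_pos (by linarith)
    exact lt_min (by positivity) (by positivity)

theorem contraction_target_le_paramB (hσ : 0 < σ) (hA : 0 < logTerm T K δ)
    (hAle : logTerm T K δ ≤ 87 * (p / (p - 1)) * logFactor ℓ μ σ ε δ R₀ Δ)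
    (hK : stepConst ^ (p / (p - 1)) * (ℓ / μ * logFactor ℓ μ σ ε δ R₀ Δ ^ 2 +
      (ℓ / μ * (σ / ε)) ^ (p / (p - 1)) * logFactor ℓ μ σ ε δ R₀ Δ ^ (p / (p - 1) + 1)) ≤ K) :
    512 * (ℓ * R₀ / ε + 4) ^ 2 ≤ paramB ℓ μ σ p ε δ R₀ T K := by
  have hℓ := d.ell_pos
  have hε := d.eps_pos
  have hR := d.R_nonneg
  have hΛ := d.one_le_logFactor
  have h1 := d.sqrt_implicit_arg_ge hσ hA hAle hK
  rw [paramB_eq hA.le]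
  refine le_implicitB (b := 10 * logFactor ℓ μ σ ε δ R₀ Δ) (by positivity) ?_ ?_ (sq_nonneg _)
  · rw [Real.log_le_iff_le_exp (by positivity)]
    exact d.contraction_target_le
  · refine le_trans ?_ (pow_le_pow_left₀ (by positivity) h1 2)
    have : 0 ≤ ((ℓ * R₀ / ε + 4) * logFactor ℓ μ σ ε δ R₀ Δ) ^ 2 := sq_nonneg _
    nlinarith

/-- Either member of the minimum defining η_y suffices: the first because K contains κΛ² with a
factor at least 348000q = 10 · 400 · 87q, q = p/(p-1); the second because then exp(ημK) = B, which
is large by `contraction_target_le_paramB`. -/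
theorem contraction_target_le_exp (hA : 0 < logTerm T K δ)
    (hAle : logTerm T K δ ≤ 87 * (p / (p - 1)) * logFactor ℓ μ σ ε δ R₀ Δ) (hK0 : 0 < K)
    (hK : stepConst ^ (p / (p - 1)) * (ℓ / μ * logFactor ℓ μ σ ε δ R₀ Δ ^ 2 +
      (ℓ / μ * (σ / ε)) ^ (p / (p - 1)) * logFactor ℓ μ σ ε δ R₀ Δ ^ (p / (p - 1) + 1)) ≤ K) :
    512 * (ℓ * R₀ / ε + 4) ^ 2 ≤ Real.exp (etaY ℓ μ σ p ε δ R₀ T K * μ * K) := by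
  have hμ := d.mu_pos
  have hℓ := d.ell_pos
  have hε := d.eps_pos
  have hσ := d.sigma_nonneg
  have hΛ := d.one_le_logFactor
  have hq := d.two_le_conj
  have hfirst : 512 * (ℓ * R₀ / ε + 4) ^ 2 ≤
      Real.exp (1 / (400 * ℓ * logTerm T K δ) * μ * K) := by
    refine d.contraction_target_le.trans (Real.exp_le_exp.2 ?_)
    have hCq := d.const_rpow_ge (x := stepConst) (N := 348000) (by norm_num [stepConst])
      (by norm_num [stepConst])
    set Λ := logFactor ℓ μ σ ε δ R₀ Δ
    set q := p / (p - 1)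
    have h1 : q * 348000 * (ℓ / μ * Λ ^ 2) ≤ K := by
      refine le_trans ?_ hK
      have h2 : 0 ≤ (ℓ / μ * (σ / ε)) ^ q * Λ ^ (q + 1) := by positivity
      have h3 : 0 ≤ stepConst ^ q := by unfold stepConst; positivity
      gcongr
      linarith
    rw [show 1 / (400 * ℓ * logTerm T K δ) * μ * K = μ * K / (400 * ℓ * logTerm T K δ) by ring,
      le_div_iff₀ (by positivity)]
    calc 10 * Λ * (400 * ℓ * logTerm T K δ) ≤ 10 * Λ * (400 * ℓ * (87 * q * Λ)) := by gcongr
      _ = μ * (q * 348000 * (ℓ / μ * Λ ^ 2)) := by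
          field_simp
          ring
      _ ≤ _ := by gcongr
  rw [etaY]
  split_ifs with h0
  · exact hfirst
  · rcases min_choice (1 / (400 * ℓ * logTerm T K δ))
      (Real.log (paramB ℓ μ σ p ε δ R₀ T K) / (μ * K)) with h | h
    · rw [h]
      exact hfirst
    · have hB := d.contraction_target_le_paramB (lt_of_le_of_ne hσ (Ne.symm h0)) hA hAle hK
      have hK' : (0 : ℝ) < K := Nat.cast_pos.2 hK0
      have hR := d.R_nonneg
      rw [h, mul_assoc, div_mul_cancel₀ _ (by positivity),
        Real.exp_log (lt_of_lt_of_le (by positivity) hB)]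
      exact hB

theorem noise_le_clipLevel (hA1 : 1 ≤ logTerm T K δ)
    (hAle : logTerm T K δ ≤ 87 * (p / (p - 1)) * logFactor ℓ μ σ ε δ R₀ Δ) (hK0 : 0 < K)
    (hK : stepConst ^ (p / (p - 1)) * (ℓ / μ * logFactor ℓ μ σ ε δ R₀ Δ ^ 2 +
      (ℓ / μ * (σ / ε)) ^ (p / (p - 1)) * logFactor ℓ μ σ ε δ R₀ Δ ^ (p / (p - 1) + 1)) ≤ K)
    {k : ℕ} (hk : k < K) :
    σ ^ p / clipLevel ℓ μ σ p ε δ R₀ T K k ^ p ≤ 8 * logTerm T K δ / K := by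
  have hA : 0 < logTerm T K δ := by linarith
  have hμ := d.mu_pos
  have hℓ := d.ell_pos
  have hε := d.eps_pos
  have hR0 := d.R_nonneg
  have hR := d.radius_pos
  have hp := d.one_lt_p
  have hK' : (0 : ℝ) < K := Nat.cast_pos.2 hK0
  rcases d.sigma_nonneg.eq_or_lt with h0 | hσ
  · rw [← h0, Real.zero_rpow (by linarith), zero_div]
    positivity
  have hη := d.etaY_pos hK0 hA (T := T)
  have hB := d.contraction_target_le_paramB hσ hA hAle hK
  -- Strictly above 2 the maximum in the equation for B is attained by its second member, so B(ln
  -- B)² equals the argument.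
  have hB2 : 2 < paramB ℓ μ σ p ε δ R₀ T K := by
    refine lt_of_lt_of_le ?_ hB
    have : 0 ≤ ℓ * R₀ / ε := by positivity
    nlinarith
  have hηle := etaY_le ℓ μ σ p ε δ R₀ T K
  have hηB : etaY ℓ μ σ p ε δ R₀ T K * μ * K ≤ Real.log (paramB ℓ μ σ p ε δ R₀ T K) := by
    have h1 : etaY ℓ μ σ p ε δ R₀ T K ≤
        Real.log (paramB ℓ μ σ p ε δ R₀ T K) / (μ * K) := by
      rw [etaY, if_neg hσ.ne']
      exact min_le_right _ _
    rwa [le_div_iff₀ (by positivity), ← mul_assoc] at h1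
  refine noise_balance (b := Real.log (paramB ℓ μ σ p ε δ R₀ T K)) hμ hσ hp d.p_le_two hR hA hK'
    hη hηB ?_ ?_
  · rw [Real.exp_log (by linarith)]
    rw [paramB_eq hA.le] at hB2 ⊢
    exact implicitB_mul_sq_log (sq_nonneg _) hB2
  · rw [clipLevel]
    generalize etaY ℓ μ σ p ε δ R₀ T K = η at *
    have h1 : η * μ ≤ 1 / 400 := by
      rw [le_div_iff₀ (by positivity)] at hηle
      have h2 : η * μ ≤ η * ℓ * logTerm T K δ := by
        calc η * μ ≤ η * ℓ := by gcongr; exact d.mu_le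
          _ ≤ _ := le_mul_of_one_le_right (by positivity) hA1
      linarith
    have h2 : Real.exp (η * μ) ≤ 11 / 10 := by
      have h3 : 0 ≤ η * μ := by positivity
      have := exp_le_one_add_add_sq (u := η * μ) (by rw [abs_of_nonneg h3]; linarith)
      nlinarith
    -- The least clipping level is compared with k = K; the factor 11/10 turns 120 into the 132 of
    -- `noise_balance`.
    have h4 : Real.exp (η * μ * (1 + k / 2)) ≤ 11 / 10 * Real.exp (η * μ * K / 2) := by
      have h5 : (k : ℝ) ≤ K := Nat.cast_le.2 hk.le
      calc Real.exp (η * μ * (1 + k / 2)) ≤ Real.exp (η * μ * (1 + K / 2)) := by gcongr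
        _ = Real.exp (η * μ) * Real.exp (η * μ * K / 2) := by
            rw [← Real.exp_add]
            congr 1
            ring
        _ ≤ _ := by gcongr
    rw [Real.exp_neg, inv_mul_eq_div, div_div]
    refine div_le_div_of_nonneg_left hR.le (by positivity) ?_
    calc Real.exp (η * μ * (1 + k / 2)) * (120 * η * logTerm T K δ)
        ≤ 11 / 10 * Real.exp (η * μ * K / 2) * (120 * η * logTerm T K δ) := by gcongr
      _ = _ := by ring

theorem innerParams : InnerParams ℓ μ σ p
    (etaY ℓ μ σ p ε δ R₀ (outerIters stepConst ℓ μ ε δ Δ) (innerIters stepConst ℓ μ σ p ε δ R₀ Δ))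
    (radius ℓ ε R₀)
    (logTerm (outerIters stepConst ℓ μ ε δ Δ) (innerIters stepConst ℓ μ σ p ε δ R₀ Δ) δ)
    (innerIters stepConst ℓ μ σ p ε δ R₀ Δ)
    (clipLevel ℓ μ σ p ε δ R₀ (outerIters stepConst ℓ μ ε δ Δ)
      (innerIters stepConst ℓ μ σ p ε δ R₀ Δ)) := by
  have hC : (1 : ℝ) ≤ stepConst := by norm_num [stepConst]
  have hA := d.one_le_logTerm hC
  have hK := d.innerIters_pos hC
  have hAle := d.logTerm_le
  have hKle := d.le_innerIters stepConst
  have hℓ := d.ell_pos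
  refine ⟨hA, d.etaY_pos hK (by linarith), ?_, d.radius_pos, hK, fun k => rfl,
    fun k hk => d.noise_le_clipLevel hA hAle hK hKle hk⟩
  have h := etaY_le ℓ μ σ p ε δ R₀ (outerIters stepConst ℓ μ ε δ Δ)
    (innerIters stepConst ℓ μ σ p ε δ R₀ Δ)
  rw [le_div_iff₀ (by positivity)] at h
  linarith

theorem contraction_le :
    2 * Real.exp (-(etaY ℓ μ σ p ε δ R₀ (outerIters stepConst ℓ μ ε δ Δ)
      (innerIters stepConst ℓ μ σ p ε δ R₀ Δ) * μ * innerIters stepConst ℓ μ σ p ε δ R₀ Δ)) *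
      radius ℓ ε R₀ ^ 2 ≤ (ε / (16 * ℓ)) ^ 2 := by
  have hC : (1 : ℝ) ≤ stepConst := by norm_num [stepConst]
  have hℓ := d.ell_pos
  have hε := d.eps_pos
  have hR0 := d.R_nonneg
  have h := d.contraction_target_le_exp (lt_of_lt_of_le one_pos (d.one_le_logTerm hC)) d.logTerm_le
    (d.innerIters_pos hC) (d.le_innerIters stepConst)
  rw [d.radius_eq, Real.exp_neg]
  set H := Real.exp (etaY ℓ μ σ p ε δ R₀ (outerIters stepConst ℓ μ ε δ Δ)
    (innerIters stepConst ℓ μ σ p ε δ R₀ Δ) * μ * innerIters stepConst ℓ μ σ p ε δ R₀ Δ)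
  have hH : 0 < H := Real.exp_pos _
  rw [mul_comm (2 : ℝ), mul_assoc, inv_mul_le_iff₀ hH]
  calc 2 * (ε / ℓ * (ℓ * R₀ / ε + 4)) ^ 2
      = 512 * (ℓ * R₀ / ε + 4) ^ 2 * (ε / (16 * ℓ)) ^ 2 := by
        field_simp
        norm_num
    _ ≤ H * (ε / (16 * ℓ)) ^ 2 := by gcongr

/-- After division by M this says 6σ^p ≤ M^(p-1)(ε/32)^p. The factor 6 is at most 6^p, and 192 = 6 ·
32. -/
theorem batchSize_ge : 6 * (batchSize stepConst σ p ε : ℝ) * σ ^ p ≤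
    (batchSize stepConst σ p ε * (ε / 32)) ^ p := by
  have hε := d.eps_pos
  have hσ := d.sigma_nonneg
  have hp := d.one_lt_p
  have hM1 : (1 : ℝ) ≤ batchSize stepConst σ p ε := by exact_mod_cast le_max_left 1 _
  have hM : (stepConst * σ / ε) ^ (p / (p - 1)) ≤ batchSize stepConst σ p ε := by
    refine (Nat.le_ceil _).trans ?_
    exact_mod_cast le_max_right 1 _
  set M : ℝ := ((batchSize stepConst σ p ε : ℕ) : ℝ)
  have hC : (192 : ℝ) ≤ stepConst := by norm_num [stepConst]
  have h1 : (192 * σ / ε) ^ p ≤ M ^ (p - 1) := by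
    have h2 : (192 * σ / ε) ^ (p / (p - 1)) ≤ M := by
      refine le_trans (Real.rpow_le_rpow (by positivity) ?_ ?_) hM
      · gcongr
      · exact div_nonneg (by linarith) (by linarith)
    have h3 := Real.rpow_le_rpow (by positivity) h2 (show 0 ≤ p - 1 by linarith)
    rwa [← Real.rpow_mul (by positivity), div_mul_cancel₀ _ (by linarith)] at h3
  have h4 : (6 : ℝ) ≤ 6 ^ p := Real.self_le_rpow_of_one_le (by norm_num) hp.le
  have h5 : (192 * σ / ε) ^ p = 6 ^ p * σ ^ p / (ε / 32) ^ p := by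
    rw [← Real.mul_rpow (by norm_num) hσ, ← Real.div_rpow (by positivity) (by positivity)]
    congr 1
    field_simp
    ring
  rw [h5, div_le_iff₀ (by positivity)] at h1
  have h6 : M ^ p = M * M ^ (p - 1) := by
    rw [mul_comm, ← Real.rpow_add_one (by linarith), sub_add_cancel]
  rw [Real.mul_rpow (by linarith) (by positivity), h6]
  have h7 : 6 * σ ^ p ≤ 6 ^ p * σ ^ p := by gcongr
  calc 6 * M * σ ^ p = M * (6 * σ ^ p) := by ring
    _ ≤ M * (M ^ (p - 1) * (ε / 32) ^ p) := by
        exact mul_le_mul_of_nonneg_left (h7.trans h1) (by linarith)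
    _ = _ := by ring

end ProblemData

end N2SGDA

namespace N2SGDA

/-! ### Number of oracle calls and bounds for η_x -/

section Calls

variable {Ξ : Type*} {dx dy : ℕ} (G : Z dx dy → Ξ → Z dx dy)

theorem innerLoop_calls (η : ℝ) (τ : ℕ → ℝ) (ξ : ℕ → Ξ) (s : State dx dy) (k : ℕ) :
    (innerLoop G η τ ξ s k).calls = s.calls + k := by
  induction k with
  | zero => rfl
  | succ k ih => simp only [innerLoop, innerStep, ih, add_assoc]

theorem run_calls (ηx : ℝ) (ηy : ℕ → ℝ) (τ : ℕ → ℕ → ℝ) (K M : ℕ) (x₀ : E dx) (y₀ : E dy)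
    (S : ℕ → ℕ ⊕ ℕ → Ξ) (t : ℕ) :
    (run G ηx ηy τ K M x₀ y₀ S t).calls = t * (K + M) := by
  induction t with
  | zero => simp [run]
  | succ t ih =>
    simp only [run, normalizedStep, innerLoop_calls, ih]
    ring

end Calls

namespace ProblemData

variable {ℓ μ σ p ε δ R₀ Δ : ℝ} (d : ProblemData ℓ μ σ p ε δ R₀ Δ)

include d

theorem sfoRateOneIter_eq :
    sfoRateOneIter ℓ μ σ p ε = ℓ / μ + (ℓ / μ * (σ / ε)) ^ (p / (p - 1)) := by
  rw [sfoRateOneIter, d.variance_ratio_eq]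

/-- Number of outer iterations times cost of one, logarithms aside; the exponents are p/(p-1) + 1
and p/(p-1) + 2. -/
theorem sfoRate_eq : sfoRate ℓ μ σ p ε Δ =
    Δ * (ℓ / μ) * ℓ / ε ^ 2 * (ℓ / μ + (ℓ / μ * (σ / ε)) ^ (p / (p - 1))) := by
  have hκ := d.one_le_kappa
  have hε := d.eps_pos
  have hσ := d.sigma_nonneg
  have hp : p - 1 ≠ 0 := by linarith [d.one_lt_p]
  have h1 : (2 * p - 1) / (p - 1) = p / (p - 1) + 1 := by
    field_simp
    ring
  have h2 : (3 * p - 2) / (p - 1) = p / (p - 1) + 2 := by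
    field_simp
    ring
  rw [sfoRate, h1, h2, Real.mul_rpow (by linarith) (by positivity),
    Real.rpow_add_one (by linarith), Real.rpow_add hε, Real.rpow_two,
    Real.div_rpow hσ hε.le]
  generalize ℓ / μ = κ
  field_simp
  ring

/-- The batch is no larger than the stochastic part of K up to rounding, as κ ≥ 1. The common
majorant is at least 1, so four copies cover K, M and both roundings. -/
theorem innerIters_add_batchSize_le {C : ℝ} (hC : 1 ≤ C) :
    (innerIters C ℓ μ σ p ε δ R₀ Δ + batchSize C σ p ε : ℝ) ≤
      4 * C ^ (p / (p - 1)) * logFactor ℓ μ σ ε δ R₀ Δ ^ (p / (p - 1) + 1) *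
        sfoRateOneIter ℓ μ σ p ε := by
  have hκ := d.one_le_kappa
  have hε := d.eps_pos
  have hσ := d.sigma_nonneg
  have hΛ := d.one_le_logFactor
  have hq := d.two_le_conj
  have hK := d.innerIters_le (C := C) (by linarith)
  have hM : (batchSize C σ p ε : ℝ) ≤ (C * σ / ε) ^ (p / (p - 1)) + 1 := by
    have h0 : 0 ≤ (C * σ / ε) ^ (p / (p - 1)) := by positivity
    rw [batchSize, Nat.cast_max, Nat.cast_one]
    exact max_le (by linarith) (Nat.ceil_lt_add_one h0).le
  rw [d.sfoRateOneIter_eq]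
  set q := p / (p - 1)
  set Λ := logFactor ℓ μ σ ε δ R₀ Δ
  set s := (ℓ / μ * (σ / ε)) ^ q with hs
  have hs0 : 0 ≤ s := by positivity
  have hCq : 1 ≤ C ^ q := Real.one_le_rpow hC (by linarith)
  have hΛq : 1 ≤ Λ ^ (q + 1) := Real.one_le_rpow hΛ (by linarith)
  have hΛ2 : Λ ^ 2 ≤ Λ ^ (q + 1) := by
    rw [← Real.rpow_two]
    exact Real.rpow_le_rpow_of_exponent_le hΛ (by linarith)
  have h1 : ℓ / μ * Λ ^ 2 + s * Λ ^ (q + 1) ≤ Λ ^ (q + 1) * (ℓ / μ + s) := by nlinarith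
  have h2 : (C * σ / ε) ^ q ≤ C ^ q * s := by
    rw [hs, ← Real.mul_rpow (by positivity) (by positivity), mul_div_assoc]
    refine Real.rpow_le_rpow (by positivity) ?_ (by linarith)
    gcongr
    exact le_mul_of_one_le_left (by positivity) hκ
  have h3 : 1 ≤ C ^ q * (Λ ^ (q + 1) * (ℓ / μ + s)) :=
    one_le_mul_of_one_le_of_one_le hCq (one_le_mul_of_one_le_of_one_le hΛq (by linarith))
  have h4 : C ^ q * s ≤ C ^ q * (Λ ^ (q + 1) * (ℓ / μ + s)) := by
    gcongr
    calc s ≤ ℓ / μ + s := by linarith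
      _ ≤ _ := le_mul_of_one_le_left (by linarith) hΛq
  have h5 : C ^ q * (ℓ / μ * Λ ^ 2 + s * Λ ^ (q + 1)) ≤ C ^ q * (Λ ^ (q + 1) * (ℓ / μ + s)) := by
    gcongr
  linarith

theorem outerIters_le_logFactor {C : ℝ} (hC : 0 ≤ C) : (outerIters C ℓ μ ε δ Δ : ℝ) ≤
    4 * C * logFactor ℓ μ σ ε δ R₀ Δ ^ 2 * (Δ * (ℓ / μ) * ℓ / ε ^ 2) + 1 := by
  have := d.mu_pos
  have := d.ell_pos
  have := d.gap_nonneg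
  have hΛ := d.one_le_logFactor
  have h1 := d.log_inv_delta_le
  have h0 := d.log_inv_delta_nonneg
  have h2 : C * (1 + Real.log (1 / δ)) ^ 2 ≤ 4 * C * logFactor ℓ μ σ ε δ R₀ Δ ^ 2 :=
    calc C * (1 + Real.log (1 / δ)) ^ 2 ≤ C * (2 * logFactor ℓ μ σ ε δ R₀ Δ) ^ 2 := by
          gcongr
          linarith
      _ = _ := by ring
  exact (d.outerIters_le hC).trans
    (add_le_add (mul_le_mul_of_nonneg_right h2 (by positivity)) le_rfl)

theorem calls_const_le {m : ℝ} (hm : 0 ≤ m) :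
    5 * stepConst * logFactor ℓ μ σ ε δ R₀ Δ ^ 2 * m *
      (4 * stepConst ^ (p / (p - 1)) * logFactor ℓ μ σ ε δ R₀ Δ ^ (p / (p - 1) + 1) *
        sfoRateOneIter ℓ μ σ p ε) ≤
      (stepConst ^ 3) ^ (p / (p - 1)) * logFactor ℓ μ σ ε δ R₀ Δ ^ (p / (p - 1) + 3) *
        (m * sfoRateOneIter ℓ μ σ p ε) := by
  have hκ := d.one_le_kappa
  have hε := d.eps_pos
  have hσ := d.sigma_nonneg
  have hΛ := d.one_le_logFactor
  have hq := d.two_le_conj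
  have hC : (20 : ℝ) ≤ stepConst := by norm_num [stepConst]
  have hs : 0 ≤ sfoRateOneIter ℓ μ σ p ε := by
    rw [d.sfoRateOneIter_eq]
    positivity
  set q := p / (p - 1)
  set Λ := logFactor ℓ μ σ ε δ R₀ Δ
  have h1 : 20 * stepConst * stepConst ^ q ≤ (stepConst ^ 3) ^ q := by
    have h2 : stepConst ≤ stepConst ^ q := Real.self_le_rpow_of_one_le (by linarith) (by linarith)
    have h3 : (stepConst ^ 3) ^ q = stepConst ^ q * stepConst ^ q * stepConst ^ q := by
      rw [← Real.mul_rpow (by linarith) (by linarith), ← Real.mul_rpow (by nlinarith) (by linarith)]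
      congr 1
      ring
    rw [h3]
    gcongr
    linarith
  have h4 : Λ ^ (q + 3) = Λ ^ 2 * Λ ^ (q + 1) := by
    rw [← Real.rpow_two, ← Real.rpow_add (by linarith)]
    congr 1
    ring
  rw [h4]
  calc _ = 20 * stepConst * stepConst ^ q * (Λ ^ 2 * Λ ^ (q + 1)) *
        (m * sfoRateOneIter ℓ μ σ p ε) := by ring
    _ ≤ _ := by gcongr

theorem calls_le : (outerIters stepConst ℓ μ ε δ Δ : ℝ) *
    (innerIters stepConst ℓ μ σ p ε δ R₀ Δ + batchSize stepConst σ p ε) ≤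
    (stepConst ^ 3) ^ (p / (p - 1)) * logFactor ℓ μ σ ε δ R₀ Δ ^ (p / (p - 1) + 3) *
      (sfoRate ℓ μ σ p ε Δ + sfoRateOneIter ℓ μ σ p ε) := by
  have := d.mu_pos
  have := d.ell_pos
  have := d.gap_nonneg
  have hε := d.eps_pos
  have hΛ := d.one_le_logFactor
  have hC : (1 : ℝ) ≤ stepConst := by norm_num [stepConst]
  have hT := d.outerIters_le_logFactor (C := stepConst) (by linarith)
  have hN : 0 ≤ Δ * (ℓ / μ) * ℓ / ε ^ 2 := by positivity
  have h1 := d.calls_const_le (m := Δ * (ℓ / μ) * ℓ / ε ^ 2 + 1) (by positivity)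
  have h2 : sfoRate ℓ μ σ p ε Δ + sfoRateOneIter ℓ μ σ p ε =
      (Δ * (ℓ / μ) * ℓ / ε ^ 2 + 1) * sfoRateOneIter ℓ μ σ p ε := by
    rw [d.sfoRate_eq, d.sfoRateOneIter_eq]
    ring
  rw [h2]
  refine le_trans (mul_le_mul ?_ (d.innerIters_add_batchSize_le hC) (by positivity)
    (by positivity)) h1
  have h3 : 1 ≤ stepConst * logFactor ℓ μ σ ε δ R₀ Δ ^ 2 :=
    one_le_mul_of_one_le_of_one_le hC (one_le_pow₀ hΛ)
  nlinarith

theorem calls_le_of_le (hle : ε ^ 2 ≤ Δ * (ℓ / μ) * ℓ) : (outerIters stepConst ℓ μ ε δ Δ : ℝ) *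
    (innerIters stepConst ℓ μ σ p ε δ R₀ Δ + batchSize stepConst σ p ε) ≤
    (stepConst ^ 3) ^ (p / (p - 1)) * logFactor ℓ μ σ ε δ R₀ Δ ^ (p / (p - 1) + 3) *
      sfoRate ℓ μ σ p ε Δ := by
  have hε := d.eps_pos
  have hΛ := d.one_le_logFactor
  have hC : (1 : ℝ) ≤ stepConst := by norm_num [stepConst]
  have hT := d.outerIters_le_logFactor (C := stepConst) (by linarith)
  have hN : 1 ≤ Δ * (ℓ / μ) * ℓ / ε ^ 2 := (one_le_div (by positivity)).2 hle
  have h1 := d.calls_const_le (m := Δ * (ℓ / μ) * ℓ / ε ^ 2) (by linarith)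
  rw [d.sfoRate_eq, ← d.sfoRateOneIter_eq]
  refine le_trans (mul_le_mul ?_ (d.innerIters_add_batchSize_le hC) (by positivity)
    (by positivity)) h1
  have h3 : 1 ≤ stepConst * logFactor ℓ μ σ ε δ R₀ Δ ^ 2 :=
    one_le_mul_of_one_le_of_one_le hC (one_le_pow₀ hΛ)
  nlinarith

theorem le_outerIters (C : ℝ) :
    C * (1 + Real.log (1 / δ)) ^ 2 * (Δ * (ℓ / μ) * ℓ) ≤ outerIters C ℓ μ ε δ Δ * ε ^ 2 := by
  have hε := d.eps_pos
  have h1 : C * (1 + Real.log (1 / δ)) ^ 2 * (Δ * (ℓ / μ) * ℓ / ε ^ 2) ≤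
      outerIters C ℓ μ ε δ Δ := by
    refine (Nat.le_ceil _).trans ?_
    exact_mod_cast le_max_right 1 _
  rwa [← mul_div_assoc, div_le_iff₀ (by positivity)] at h1

theorem etaX_sq {T : ℕ} (hT : 0 < T) :
    etaX ℓ μ Δ T ^ 2 * ((ℓ / μ + 1) * ℓ * T) = Δ := by
  have := d.mu_pos
  have := d.ell_pos
  have := d.gap_nonneg
  have hT' : (0 : ℝ) < T := Nat.cast_pos.2 hT
  rw [etaX, Real.sq_sqrt (by positivity), div_mul_cancel₀ _ (by positivity)]

/-- The drift of the maximizer in one outer step; it fits into the slack 4ε/ℓ of R_y. -/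
theorem kappa_mul_etaX_le :
    ℓ / μ * etaX ℓ μ Δ (outerIters stepConst ℓ μ ε δ Δ) ≤ ε / ℓ := by
  have hμ := d.mu_pos
  have hℓ := d.ell_pos
  have hε := d.eps_pos
  have hΔ := d.gap_nonneg
  have hT0 : 0 < outerIters stepConst ℓ μ ε δ Δ := lt_max_of_lt_left one_pos
  have hT := d.le_outerIters stepConst
  have hη := d.etaX_sq hT0
  have hδ := d.log_inv_delta_nonneg
  have hC : (1 : ℝ) ≤ stepConst := by norm_num [stepConst]
  have hT' : (0 : ℝ) < outerIters stepConst ℓ μ ε δ Δ := Nat.cast_pos.2 hT0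
  have hη0 : 0 ≤ etaX ℓ μ Δ (outerIters stepConst ℓ μ ε δ Δ) := Real.sqrt_nonneg _
  have hκ := d.one_le_kappa
  set T : ℝ := ((outerIters stepConst ℓ μ ε δ Δ : ℕ) : ℝ)
  set η := etaX ℓ μ Δ (outerIters stepConst ℓ μ ε δ Δ)
  have h1 : Δ * (ℓ / μ) * ℓ ≤ T * ε ^ 2 := by
    refine le_trans (le_mul_of_one_le_left (by positivity) ?_) hT
    exact one_le_mul_of_one_le_of_one_le hC (one_le_pow₀ (by linarith))
  refine abs_le_of_sq_le_sq' ?_ (by positivity) |>.2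
  set κ := ℓ / μ
  have h2 : (κ * η) ^ 2 * ℓ ^ 2 * T ≤ ε ^ 2 * T := by
    calc (κ * η) ^ 2 * ℓ ^ 2 * T = η ^ 2 * (κ * ℓ * T) * (κ * ℓ) := by ring
      _ ≤ η ^ 2 * ((κ + 1) * ℓ * T) * (κ * ℓ) := by
          gcongr
          linarith
      _ = Δ * κ * ℓ := by rw [hη]; ring
      _ ≤ _ := by linarith
  rw [div_pow, le_div_iff₀ (by positivity)]
  exact le_of_mul_le_mul_right h2 hT'

/-- By the choice of η_x, the square of Lη_x is ΔL/T. The square of 1 + ln(1/δ) in T pays for the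
logarithm, and 450 = 2 · 15² with κ + 1 ≤ 2κ gives 1/15. -/
theorem lipschitz_mul_etaX_le :
    (ℓ / μ + 1) * ℓ * etaX ℓ μ Δ (outerIters stepConst ℓ μ ε δ Δ) * (1 + Real.log (1 / δ)) ≤
      ε / 15 := by
  have hμ := d.mu_pos
  have hℓ := d.ell_pos
  have hε := d.eps_pos
  have hΔ := d.gap_nonneg
  have hT0 : 0 < outerIters stepConst ℓ μ ε δ Δ := lt_max_of_lt_left one_pos
  have hT := d.le_outerIters stepConst
  have hη := d.etaX_sq hT0
  have hδ := d.log_inv_delta_nonneg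
  have hC : (450 : ℝ) ≤ stepConst := by norm_num [stepConst]
  have hT' : (0 : ℝ) < outerIters stepConst ℓ μ ε δ Δ := Nat.cast_pos.2 hT0
  have hκ := d.one_le_kappa
  set T : ℝ := ((outerIters stepConst ℓ μ ε δ Δ : ℕ) : ℝ)
  set η := etaX ℓ μ Δ (outerIters stepConst ℓ μ ε δ Δ)
  set κ := ℓ / μ
  set w := 1 + Real.log (1 / δ)
  refine abs_le_of_sq_le_sq' ?_ (by positivity) |>.2
  have h1 : 450 * w ^ 2 * (Δ * κ * ℓ) ≤ T * ε ^ 2 := by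
    refine le_trans ?_ hT
    gcongr
  have h2 : ((κ + 1) * ℓ * η * w) ^ 2 * T ≤ (ε / 15) ^ 2 * T := by
    calc ((κ + 1) * ℓ * η * w) ^ 2 * T = η ^ 2 * ((κ + 1) * ℓ * T) * ((κ + 1) * ℓ) * w ^ 2 := by
          ring
      _ = Δ * ((κ + 1) * ℓ) * w ^ 2 := by rw [hη]
      _ ≤ Δ * ((κ + κ) * ℓ) * w ^ 2 := by gcongr
      _ = 450 * w ^ 2 * (Δ * κ * ℓ) / 225 := by ring
      _ ≤ T * ε ^ 2 / 225 := by gcongr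
      _ = _ := by ring
  exact le_of_mul_le_mul_right h2 hT'

end ProblemData

/-! ### Assembly of the probability bound -/

section Final

variable {Ξ Ω : Type*} [MeasurableSpace Ξ] [MeasurableSpace Ω] {P : Measure Ω}
  [IsProbabilityMeasure P] {D : Measure Ξ} [IsProbabilityMeasure D] {dx dy : ℕ}
  {f : Z dx dy → ℝ} {G : Z dx dy → Ξ → Z dx dy} {ℓ μ σ p ε δ R₀ : ℝ}
  {S : ℕ → ℕ ⊕ ℕ → Ω → Ξ} {x₀ : E dx} {y₀ : E dy}

theorem le_measure_of_measure_not_le {s : Set Ω} (h : P {ω | ω ∉ s} ≤ ENNReal.ofReal δ)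
    (hδ : 0 ≤ δ) : ENNReal.ofReal (1 - δ) ≤ P s := by
  rw [ENNReal.ofReal_sub _ hδ, ENNReal.ofReal_one, tsub_le_iff_right]
  calc 1 = P (s ∪ sᶜ) := by simp
    _ ≤ P s + P sᶜ := measure_union_le _ _
    _ ≤ _ := by gcongr; exact h

/-- If Δ_Φ = 0 then x₀ minimizes Φ and the step size is zero, so the iterate never leaves a critical
point. The general estimate divides by η_x and excludes this case. -/
theorem gradient_runPair_eq_zero_of_gap_eq_zero {Ξ : Type*} {G : Z dx dy → Ξ → Z dx dy} (h : MinimaxAssumption f ℓ μ) (hdy : 0 < dy)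
    (hΔ : gap f x₀ = 0) (η : ℝ) (τ : ℕ → ℝ) (K M : ℕ) (w : ℕ → ℕ ⊕ ℕ → Ξ) (t : ℕ) :
    ‖gradient (Phi f) (runPair G 0 η τ K M x₀ y₀ w t).1‖ = 0 := by
  have hμ := h.mu_pos
  have hℓ := h.smooth_pos hdy
  have h1 := norm_sq_gradient_le (h.differentiable_Phi hdy) (L := (ℓ / μ + 1) * ℓ) (by positivity)
    (h.gradient_Phi_lipschitz hdy) h.lowerBounded x₀
  rw [show Phi f x₀ - ⨅ z, Phi f z = gap f x₀ from rfl, hΔ, mul_zero] at h1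
  have h2 : ‖gradient (Phi f) x₀‖ = 0 :=
    pow_eq_zero_iff two_ne_zero |>.1 (le_antisymm h1 (by positivity))
  have h3 := norm_gradient_runPair_le (G := G) (η := η) (τ := τ) (K := K) (M := M) (x₀ := x₀)
    (y₀ := y₀) h hdy le_rfl w t
  rw [h2] at h3
  exact le_antisymm (by simpa using h3) (norm_nonneg _)

theorem measure_average_gradient_ge (h : MinimaxAssumption f ℓ μ) (hdy : 0 < dy)
    (hG : PBCM f D G σ p) (d : ProblemData ℓ μ σ p ε δ R₀ (gap f x₀))
    (hy : ‖y₀ - h.argmax x₀‖ ≤ R₀) (hS : ∀ t i, Measurable (S t i))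
    (hD : ∀ t i, P.map (S t i) = D)
    (hind : iIndepFun (fun j : ℕ × (ℕ ⊕ ℕ) => S j.1 j.2) P) {T M K : ℕ} {η : ℝ} {τ : ℕ → ℝ}
    (hT : T = outerIters stepConst ℓ μ ε δ (gap f x₀)) (hM : M = batchSize stepConst σ p ε)
    (hK : K = innerIters stepConst ℓ μ σ p ε δ R₀ (gap f x₀))
    (hη : η = etaY ℓ μ σ p ε δ R₀ T K) (hτ : τ = clipLevel ℓ μ σ p ε δ R₀ T K) :
    ENNReal.ofReal (1 - δ) ≤ P {ω | (∑ t ∈ Finset.range T, ‖gradient (Phi f)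
      (runPair G (etaX ℓ μ (gap f x₀) T) η τ K M x₀ y₀ (fun s i => S s i ω) t).1‖) / T ≤ ε} := by
  have hμ := h.mu_pos
  have hℓ := h.smooth_pos hdy
  have hε := d.eps_pos
  have hδ := d.delta_pos
  have hκ := d.one_le_kappa
  have hT0 : 0 < T := hT ▸ lt_max_of_lt_left one_pos
  have hM0 : 0 < M := hM ▸ lt_max_of_lt_left one_pos
  have hT1 : (1 : ℝ) ≤ T := by exact_mod_cast hT0
  refine le_measure_of_measure_not_le ?_ hδ.le
  rcases d.gap_nonneg.eq_or_lt with hΔ | hΔ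
  · have hη0 : etaX ℓ μ (gap f x₀) T = 0 := by rw [etaX, ← hΔ, zero_div, Real.sqrt_zero]
    refine le_trans (le_of_eq ?_) zero_le
    convert measure_empty (μ := P)
    refine Set.eq_empty_of_forall_notMem fun ω hω => hω ?_
    rw [mem_ofPred_eq, hη0]
    simp only [gradient_runPair_eq_zero_of_gap_eq_zero h hdy hΔ.symm, Finset.sum_const_zero, zero_div]
    exact hε.le
  have hC : (1 : ℝ) ≤ stepConst := by norm_num [stepConst]
  have hsq := d.etaX_sq hT0
  have hκη := hT ▸ d.kappa_mul_etaX_le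
  have hLη := hT ▸ d.lipschitz_mul_etaX_le
  have hηx : 0 < etaX ℓ μ (gap f x₀) T := Real.sqrt_pos.2 (by positivity)
  have hA := hT ▸ hK ▸ d.exp_logTerm hC
  have hq := d.innerParams
  have hcon := d.contraction_le
  have hbatch := d.batchSize_ge
  rw [← hT, ← hK, ← hη, ← hτ] at hq
  rw [← hT, ← hK, ← hη] at hcon
  rw [← hM] at hbatch
  have hK1 : (1 : ℝ) ≤ K := by exact_mod_cast hq.K_pos
  set ηx := etaX ℓ μ (gap f x₀) T
  set L := (ℓ / μ + 1) * ℓ with hL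
  have hL0 : 0 < L := by positivity
  have hgrad : ‖gradient (Phi f) x₀‖ ≤ 2 * (T * (L * ηx)) := by
    have h1 := norm_sq_gradient_le (h.differentiable_Phi hdy) hL0 (h.gradient_Phi_lipschitz hdy)
      h.lowerBounded x₀
    rw [show Phi f x₀ - ⨅ z, Phi f z = gap f x₀ from rfl, ← hsq] at h1
    refine abs_le_of_sq_le_sq' (h1.trans ?_) (by positivity) |>.2
    calc 2 * L * (ηx ^ 2 * (L * T)) = 2 * T * (L * ηx) ^ 2 := by ring
      _ ≤ 4 * (T * T) * (L * ηx) ^ 2 := by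
          gcongr
          · norm_num
          · exact le_mul_of_one_le_left (by linarith) hT1
      _ = _ := by ring
  -- The initial gradient is at most 2TLη_x and grows by at most TLη_x; twice the sum is c = 6TLη_x.
  -- The term ln(2/δ) spends half of δ on the accumulated loss.
  have hmain := measure_not_sum_norm_gradient_le (T := T) (x₀ := x₀) (y₀ := y₀)
    (c := 6 * (T * (L * ηx))) (b := ε / 32) (es := ε / (16 * ℓ)) (B := Real.log (2 / δ)) h hdy hG hS
    hD hind hq hM0 (by positivity) hbatch hηx (by positivity) (by linarith) (by positivity) hcon
    (by
      have h1 : ε / (16 * ℓ) ≤ ε / ℓ := by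
        gcongr
        linarith
      have h2 : radius ℓ ε R₀ = R₀ + 4 * (ε / ℓ) := by rw [radius, mul_div_assoc]
      have h3 : 0 < ε / ℓ := by positivity
      linarith [d.R_nonneg])
    (hy.trans (by
      rw [radius]
      have : 0 ≤ 4 * ε / ℓ := by positivity
      linarith))
  refine le_trans (measure_mono ?_) (hmain.trans ?_)
  · intro ω hω hle
    refine hω ?_
    rw [mem_ofPred_eq, div_le_iff₀ (by linarith)]
    refine hle.trans ?_
    have h1 : gap f x₀ / ηx = T * (L * ηx) := by
      rw [div_eq_iff hηx.ne', ← hsq]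
      ring
    have h2 : ℓ * (ε / (16 * ℓ)) = ε / 16 := by field_simp
    have h3 : Real.log (2 / δ) ≤ 1 + Real.log (1 / δ) := by
      rw [Real.log_div two_ne_zero hδ.ne', Real.log_div one_ne_zero hδ.ne', Real.log_one]
      linarith [Real.log_two_lt_d9]
    have h4 : L * ηx * Real.log (2 / δ) ≤ ε / 15 := le_trans (by gcongr) hLη
    have h5 : L * ηx ≤ ε / 15 :=
      le_trans (le_mul_of_one_le_right (by positivity) (by linarith [d.log_inv_delta_nonneg])) hLη
    rw [h1, h2]
    -- The budget is met exactly: 1/15 + 1/30 + 6/15 = 1/2 for the optimization terms and 4(1/16 +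
    -- 1/16) = 1/2 for the errors of the estimators.
    have h6 : L * ηx + L * ηx / 2 + 6 * (L * ηx * Real.log (2 / δ)) +
        4 * (2 * (ε / 32) + ε / 16) ≤ ε := by linarith
    have h7 := mul_le_mul_of_nonneg_left h6 (show (0 : ℝ) ≤ T by linarith)
    linarith
  · have h1 : Real.exp (-Real.log (2 / δ)) = δ / 2 := by
      rw [Real.exp_neg, Real.exp_log (by positivity), inv_div]
    -- The T inner loops fail with total probability at most T · δ/(8TK), which is below δ/2.
    have h2 : (T : ENNReal) * ENNReal.ofReal (Real.exp (-logTerm T K δ)) =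
        ENNReal.ofReal (δ / (8 * K)) := by
      rw [Real.exp_neg, hA, ← ENNReal.ofReal_natCast, ← ENNReal.ofReal_mul (by linarith)]
      congr 1
      field_simp
    rw [h1, h2, ← ENNReal.ofReal_add (by positivity) (by positivity)]
    refine ENNReal.ofReal_le_ofReal ?_
    have h3 : δ / (8 * K) ≤ δ / 2 := by
      gcongr
      linarith
    linarith

end Final

end N2SGDA
theorem mainTheorem4 :
    ∃ C C' : ℝ, 1 ≤ C ∧ 1 ≤ C' ∧
      ∀ (dx dy : ℕ) (_ : 0 < dy) (f : N2SGDA.Z dx dy → ℝ) (ℓ μ σ p ε δ R₀ : ℝ)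
        (x₀ : N2SGDA.E dx) (y₀ yStar : N2SGDA.E dy)
        (Ξ : Type*) [MeasurableSpace Ξ] (D : Measure Ξ) [IsProbabilityMeasure D]
        (G : N2SGDA.Z dx dy → Ξ → N2SGDA.Z dx dy)
        (Ω : Type*) [MeasurableSpace Ω] (P : Measure Ω) [IsProbabilityMeasure P]
        (S : ℕ → ℕ ⊕ ℕ → Ω → Ξ),
        N2SGDA.MinimaxAssumption f ℓ μ →
        N2SGDA.PBCM f D G σ p →
        0 < ε → 0 < δ → δ < 1 →
        -- `yStar` is the maximizer of `f (x₀, ·)`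
        (∀ y, f (N2SGDA.pt x₀ y) ≤ f (N2SGDA.pt x₀ yStar)) →
        ‖y₀ - yStar‖ ≤ R₀ →
        -- the samples are independent with law `D`
        (∀ t i, Measurable (S t i)) →
        (∀ t i, P.map (S t i) = D) →
        iIndepFun (fun j : ℕ × (ℕ ⊕ ℕ) => S j.1 j.2) P →
        let Δ := N2SGDA.gap f x₀
        let Λ := N2SGDA.logFactor ℓ μ σ ε δ R₀ Δ
        let T := N2SGDA.outerIters C ℓ μ ε δ Δ
        let M := N2SGDA.batchSize C σ p ε
        let K := N2SGDA.innerIters C ℓ μ σ p ε δ R₀ Δ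
        let state : Ω → ℕ → N2SGDA.State dx dy := fun ω t =>
          N2SGDA.run G (N2SGDA.etaX ℓ μ Δ T) (fun _ => N2SGDA.etaY ℓ μ σ p ε δ R₀ T K)
            (fun _ k => N2SGDA.clipLevel ℓ μ σ p ε δ R₀ T K k) K M x₀ y₀
            (fun s i => S s i ω) t
        Differentiable ℝ (N2SGDA.Phi f) ∧
        ENNReal.ofReal (1 - δ) ≤
          P {ω | (∑ t ∈ Finset.range T, ‖gradient (N2SGDA.Phi f) (state ω t).x‖) / T ≤ ε} ∧
        -- number of oracle calls
        (∀ ω, ((state ω T).calls : ℝ) ≤ C' ^ (p / (p - 1)) * Λ ^ (p / (p - 1) + 3) *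
          (N2SGDA.sfoRate ℓ μ σ p ε Δ + N2SGDA.sfoRateOneIter ℓ μ σ p ε)) ∧
        (ε ^ 2 ≤ Δ * (ℓ / μ) * ℓ →
          ∀ ω, ((state ω T).calls : ℝ) ≤ C' ^ (p / (p - 1)) * Λ ^ (p / (p - 1) + 3) *
            N2SGDA.sfoRate ℓ μ σ p ε Δ) := by
  refine ⟨N2SGDA.stepConst, N2SGDA.stepConst ^ 3, by norm_num [N2SGDA.stepConst],
    by norm_num [N2SGDA.stepConst], ?_⟩
  intro dx dy hdy f ℓ μ σ p ε δ R₀ x₀ y₀ yStar Ξ _ D _ G Ω _ P _ S h hG hε hδ hδ1 hstar hR hS hD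
    hind Δ Λ T M K state
  have d : N2SGDA.ProblemData ℓ μ σ p ε δ R₀ Δ :=
    { mu_pos := h.mu_pos
      mu_le := h.mu_le_smooth hdy
      sigma_nonneg := hG.sigma_nonneg
      one_lt_p := hG.one_lt_p
      p_le_two := hG.p_le_two
      eps_pos := hε
      delta_pos := hδ
      delta_lt_one := hδ1
      R_nonneg := (norm_nonneg _).trans hR
      gap_nonneg := h.gap_nonneg x₀ }
  rw [h.eq_argmax hdy hstar] at hR
  have hcalls (ω : Ω) : ((state ω T).calls : ℝ) = T * (K + M) := by
    rw [N2SGDA.run_calls]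
    push_cast
    rfl
  refine ⟨h.differentiable_Phi hdy, ?_, fun ω => ?_, fun hle ω => ?_⟩
  · exact N2SGDA.measure_average_gradient_ge h hdy hG d hR hS hD hind rfl rfl rfl rfl rfl
  · rw [hcalls]
    exact d.calls_le
  · rw [hcalls]
    exact d.calls_le_of_le hle
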